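/- For a permutation $\pi$ of the vertex set $V$ of a graph $G$ on $n$ vertices, let $\mathrm{RGMIS}(\pi)$ be the maximal independent set obtained by visiting the vertices in the order $\pi(1),\dots,\pi(n)$ and adding each visited vertex to the (initially empty) set if none of its neighbours is already in the set. Theorem. For any $\varepsilon\in(0,1)$ there is a randomized algorithm that, given a graph $G$ on $n\ge 1$ vertices with oracle access to its adjacency matrix, runs in $\widetilde O(n^{3/2}/\varepsilon^2)$ time and with high probability reports a multiplicative $(1+\varepsilon)$-approximation to the value $|\mathrm{RGMIS}(\pi)|$ for some permutation $\pi$ of $V$, that is, a number $y$ with $|\mathrm{RGMIS}(\pi)|\le y\le(1+\varepsilon)\,|\mathrm{RGMIS}(\pi)|$. Precisely: there is a constant $c$ such that for every $k\in\mathbb{N}$ there is a constant $C$ such that for every $\varepsilon\in(0,1)$ there is a randomized random-access-machine program which, on every graph $G$ with vertex set $\{0,\dots,n-1\}$, $n\ge1$, given $n$ and oracle access to the adjacency matrix of $G$, always halts in time at most $C\,\frac{n^{3/2}}{\varepsilon^2}(1+\log n)^c$ (logarithmic cost criterion), and with probability at least $1-n^{-k}$ outputs a number $y$ such that $|\mathrm{RGMIS}(\pi)|\le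 y\le(1+\varepsilon)|\mathrm{RGMIS}(\pi)|$ for some permutation $\pi$ of the vertices. -/

import Mathlib

open scoped ENNReal

namespace SublinearMIS

/-! ## Random greedy maximal independent set -/

open Classical in
/-- One greedy step: add `v` to `I` if none of its neighbours is in `I`. -/
noncomputable def greedyStep {V : Type*} (G : SimpleGraph V) (I : Finset V) (v : V) : Finset V :=
  if ∀ u ∈ I, ¬ G.Adj u v then insert v I else I

/-- The set produced by the greedy process that visits the vertices in the order
`π 0, π 1, ..., π (n - 1)`, starting from the empty set. -/
noncomputable def RGMIS {V : Type*} {n : ℕ} (G : SimpleGraph V) (π : Fin n ≃ V) : Finset V :=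
  (List.ofFn π).foldl (greedyStep G) ∅

/-- `y` is an `(α, β)`-estimate of the true value `x`. -/
def IsEstimate (α β y x : ℝ) : Prop := x ≤ y ∧ y ≤ α * x + β

/-! ## The machine model

Randomized programs over a random access memory with cells indexed by `ℕ`, each holding a natural
number, with oracle access to an adjacency matrix. Time is measured by the logarithmic cost
criterion: every operation costs one plus the bit lengths of the numbers it handles. -/

/-- Arithmetic expressions. `mem a` is the content of the cell whose address is the value of `a`
(so nested `mem` gives indirect addressing); `sub` is truncated, `div` is rounded down. -/
inductive Expr : Type
  | const (k : ℕ) : Expr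
  | mem (a : Expr) : Expr
  | add (a b : Expr) : Expr
  | sub (a b : Expr) : Expr
  | mul (a b : Expr) : Expr
  | div (a b : Expr) : Expr

/-- The value of an expression in a given memory. -/
def Expr.val (m : ℕ → ℕ) : Expr → ℕ
  | .const k => k
  | .mem a => m (a.val m)
  | .add a b => a.val m + b.val m
  | .sub a b => a.val m - b.val m
  | .mul a b => a.val m * b.val m
  | .div a b => a.val m / b.val m

/-- The time needed to evaluate an expression: each node costs one plus the bit length of its
value (the operands and addresses are paid for at the child nodes). -/
def Expr.cost (m : ℕ → ℕ) : Expr → ℕ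
  | .const k => 1 + Nat.size k
  | .mem a => a.cost m + (1 + Nat.size (m (a.val m)))
  | .add a b => a.cost m + b.cost m + (1 + Nat.size (a.val m + b.val m))
  | .sub a b => a.cost m + b.cost m + (1 + Nat.size (a.val m - b.val m))
  | .mul a b => a.cost m + b.cost m + (1 + Nat.size (a.val m * b.val m))
  | .div a b => a.cost m + b.cost m + (1 + Nat.size (a.val m / b.val m))

/-- Programs. A program is a finite object that depends neither on the graph nor on its size.
* `assign a e`: write the value of `e` into the cell with address `a`;
* `query a u v`: write the adjacency matrix entry `(u, v)` into the cell with address `a`;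
* `rand a e`: write a fresh uniformly random element of `{0, ..., e}` into the cell with address `a`;
* `ite` and `loop` (a while loop) branch on whether the value of `e` is nonzero. -/
inductive Prog : Type
  | skip : Prog
  | assign (a e : Expr) : Prog
  | query (a u v : Expr) : Prog
  | rand (a e : Expr) : Prog
  | seq (p q : Prog) : Prog
  | ite (e : Expr) (p q : Prog) : Prog
  | loop (e : Expr) (p : Prog) : Prog

/-- The memory, together with the time spent so far. -/
@[ext] structure State : Type where
  mem : ℕ → ℕ
  time : ℕ

/-- Spend `t` units of time. -/
def State.tick (s : State) (t : ℕ) : State := ⟨s.mem, s.time + t⟩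

/-- Write `x` into the cell with address `a`. -/
def State.write (s : State) (a x : ℕ) : State := ⟨Function.update s.mem a x, s.time⟩

/-- Continue an execution with `f`, unless it has been cut off. -/
noncomputable def andThen (μ : PMF (Option State)) (f : State → PMF (Option State)) :
    PMF (Option State) :=
  μ.bind fun o => match o with
    | none => PMF.pure none
    | some s => f s

/-- A while loop on the test `e`; it is cut off (result `none`) when it is about to start
its `(N + 1)`-st test. -/
noncomputable def whileLoop (e : Expr) (body : State → PMF (Option State)) :
    ℕ → State → PMF (Option State)
  | 0, _ => PMF.pure none
  | N + 1, s =>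
    if e.val s.mem = 0 then PMF.pure (some (s.tick (1 + e.cost s.mem)))
    else andThen (body (s.tick (1 + e.cost s.mem))) (whileLoop e body N)

/-- The distribution of the final state of a program started in a given state, where `M` is the
adjacency matrix oracle. While loops are cut off after `N` tests, and `none` means that this
has happened. As every test takes time, no execution that takes time at most `N` is cut off, and an
execution that is not cut off is the genuine execution of the program. -/
noncomputable def Prog.exec (M : ℕ → ℕ → ℕ) (N : ℕ) : Prog → State → PMF (Option State)
  | .skip, s => PMF.pure (some (s.tick 1))
  | .assign a e, s =>
    PMF.pure (some ((s.write (a.val s.mem) (e.val s.mem)).tick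
      (1 + a.cost s.mem + e.cost s.mem)))
  | .query a u v, s =>
    PMF.pure (some ((s.write (a.val s.mem) (M (u.val s.mem) (v.val s.mem))).tick
      (1 + a.cost s.mem + u.cost s.mem + v.cost s.mem)))
  | .rand a e, s =>
    (PMF.uniformOfFinset (Finset.range (e.val s.mem + 1)) Finset.nonempty_range_add_one).map
      fun x => some ((s.write (a.val s.mem) x).tick (1 + a.cost s.mem + e.cost s.mem))
  | .seq p q, s => andThen (p.exec M N s) (q.exec M N)
  | .ite e p q, s =>
    if e.val s.mem = 0 then q.exec M N (s.tick (1 + e.cost s.mem))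
    else p.exec M N (s.tick (1 + e.cost s.mem))
  | .loop e p, s => whileLoop e (p.exec M N) N s

open Classical in
/-- The adjacency matrix of a graph on `{0, ..., n - 1}`, as an oracle on pairs of numbers. -/
noncomputable def adjOracle {n : ℕ} (G : SimpleGraph (Fin n)) (u v : ℕ) : ℕ :=
  if ∃ (hu : u < n) (hv : v < n), G.Adj ⟨u, hu⟩ ⟨v, hv⟩ then 1 else 0

/-- The initial state: cell `0` holds the number `n` of vertices, all other cells hold `0`. -/
def initState (n : ℕ) : State := ⟨Function.update (fun _ => 0) 0 n, 0⟩

/-- The distribution of the final state of the program `P` on the input graph `G`. -/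
noncomputable def Prog.run (P : Prog) {n : ℕ} (G : SimpleGraph (Fin n)) (N : ℕ) :
    PMF (Option State) :=
  P.exec (adjOracle G) N (initState n)

/-- On input `G`, whatever the random choices, the program `P` halts after time at most `T`. -/
def Prog.RunsInTime (P : Prog) {n : ℕ} (G : SimpleGraph (Fin n)) (T : ℝ) : Prop :=
  ∀ o ∈ (P.run G ⌊T⌋₊).support, ∃ s : State, o = some s ∧ (s.time : ℝ) ≤ T

/-- The probability that, on input `G`, the program `P` halts after time at most `T` with an
output (the content of cell `0`) that satisfies `R`. -/
noncomputable def Prog.outputProb (P : Prog) {n : ℕ} (G : SimpleGraph (Fin n)) (T : ℝ)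
    (R : ℕ → Prop) : ℝ≥0∞ :=
  (P.run G ⌊T⌋₊).toOuterMeasure {o | ∃ s : State, o = some s ∧ (s.time : ℝ) ≤ T ∧ R (s.mem 0)}

/-- The time bound `C · n^{3/2} / ε² · (1 + log n)^c`. -/
noncomputable def timeBound (C : ℝ) (c n : ℕ) (ε : ℝ) : ℝ :=
  C * (n : ℝ) ^ (3 / 2 : ℝ) / ε ^ 2 * (1 + Real.log n) ^ c

end SublinearMIS

/-!
Approximating the size of a random greedy maximal independent set in time `Õ(n ^ (3 / 2) / ε ^ 2)`.

A random permutation is replaced by a sequence `x 0, x 1, …` of independent uniform vertices. Call a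
vertex alive if the greedy set of the sequence so far contains neither it nor a neighbour of it. A
vertex stays alive for `L` steps with probability at most `(1 - 1 / n) ^ L`, so after
`L = O(n log n)` steps no vertex is alive, with high probability, and the greedy set `I` is a
maximal independent set. Every such set is `RGMIS G π` for each `π` that lists its elements first
(`exists_RGMIS_eq`). Hence it suffices to approximate `|I|`.

* If `|I|` is at most `K ≈ 3 √n / ε ^ 2`, the greedy process is carried out with `O(L K)` queries to
  the adjacency matrix.
* Otherwise `s = Õ(√n)` further uniform vertices are tested for membership in `I`. By the Chernoff
  bound the number of hits determines `|I|` up to the factor `1 + ε`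
  (`estimate_of_deviation_le`). Membership of `v` in the greedy set is decided by a recursive oracle
  that scans the sequence from its start and recursively tests every neighbour of `v` it meets,
  until it meets `v` or a neighbour of `v` in the set. The central estimate
  `avg_sum_callCost_le` says that a call on a uniform vertex takes at most `n` steps in expectation.
  It is proved by induction on the length of the sequence, exposing its first element `y`: if
  `c u` is the cost of a call on `u` after the first element, then a call on `v` adjacent to `y`
  costs an additional call on `y`, so the induction has to control the sum of the costs
  `c y * (1 + deg y)`, where the degree counts alive neighbours only.

By Markov's inequality a round exceeds twice its expected cost with probability at most `1 / 2`, so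
with a cost budget per round and `O(log n)` rounds the time is bounded in the worst case while some
round succeeds with high probability (`prob_isReliable_ge`).

The program draws all random vertices into a tape first; everything after that is deterministic, so
its correctness is a statement about a fixed tape. The oracle is run as an explicit stack machine
(`scanStep`), which `scanLoop` implements. All cells have bit length `O(log n)`, so `Prog.ends_eff`
bounds the logarithmic cost of a loop-free program by a constant times `log n`.
-/

namespace SublinearMIS

/-! ### Averages over sequences of independent uniform elements -/

section Average

variable {V : Type*} [Fintype V]

/-- The average of `φ` over all lists of length `d`, that is, its expectation on a sequence of `d`
independent uniform elements of `V`. The recursion exposes the first element of the sequence. -/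
noncomputable def avg : ℕ → (List V → ℝ) → ℝ
  | 0, φ => φ []
  | d + 1, φ => (Fintype.card V : ℝ)⁻¹ * ∑ x, avg d fun l => φ (x :: l)

theorem avg_mono {d : ℕ} {φ ψ : List V → ℝ} (h : ∀ l, l.length = d → φ l ≤ ψ l) :
    avg d φ ≤ avg d ψ := by
  induction d generalizing φ ψ with
  | zero => exact h [] rfl
  | succ d ih =>
    exact mul_le_mul_of_nonneg_left
      (Finset.sum_le_sum fun x _ => ih fun l hl => h _ (by simp [hl])) (by positivity)

theorem avg_congr {d : ℕ} {φ ψ : List V → ℝ} (h : ∀ l, l.length = d → φ l = ψ l) :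
    avg d φ = avg d ψ :=
  le_antisymm (avg_mono fun l hl => (h l hl).le) (avg_mono fun l hl => (h l hl).ge)

theorem avg_add (d : ℕ) (φ ψ : List V → ℝ) :
    avg d (fun l => φ l + ψ l) = avg d φ + avg d ψ := by
  induction d generalizing φ ψ with
  | zero => rfl
  | succ d ih => simp only [avg, ih, Finset.sum_add_distrib, mul_add]

theorem avg_const_mul (d : ℕ) (a : ℝ) (φ : List V → ℝ) :
    avg d (fun l => a * φ l) = a * avg d φ := by
  induction d generalizing φ with
  | zero => rfl
  | succ d ih => simp only [avg, ih, ← Finset.mul_sum]; ring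

theorem avg_mul_const (d : ℕ) (a : ℝ) (φ : List V → ℝ) :
    avg d (fun l => φ l * a) = avg d φ * a := by
  simp_rw [mul_comm _ a, avg_const_mul]

theorem avg_const [Nonempty V] (d : ℕ) (a : ℝ) : avg d (fun _ : List V => a) = a := by
  induction d with
  | zero => rfl
  | succ d ih =>
    have : (Fintype.card V : ℝ) ≠ 0 := by exact_mod_cast Fintype.card_ne_zero
    simp only [avg, ih, Finset.sum_const, Finset.card_univ, nsmul_eq_mul]
    field_simp

theorem avg_sum {ι : Type*} (s : Finset ι) (d : ℕ) (φ : ι → List V → ℝ) :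
    avg d (fun l => ∑ i ∈ s, φ i l) = ∑ i ∈ s, avg d (φ i) := by
  classical
  induction s using Finset.induction_on with
  | empty => simpa using avg_const_mul d 0 (fun _ : List V => (0 : ℝ))
  | insert i s hi ih => simp only [Finset.sum_insert hi, avg_add, ih]

theorem avg_append (a b : ℕ) (φ : List V → ℝ) :
    avg (a + b) φ = avg a fun l₁ => avg b fun l₂ => φ (l₁ ++ l₂) := by
  induction a generalizing φ with
  | zero => simp [avg]
  | succ a ih => rw [Nat.succ_add]; simp only [avg, ih, List.cons_append]

theorem avg_nonneg {d : ℕ} {φ : List V → ℝ} (h : ∀ l, 0 ≤ φ l) : 0 ≤ avg d φ := by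
  have h0 := avg_const_mul d 0 (fun _ : List V => (0 : ℝ))
  simp only [zero_mul] at h0
  exact h0 ▸ avg_mono fun l _ => h l

open Classical in
/-- The probability that a sequence of `d` independent uniform elements of `V` satisfies `p`. -/
noncomputable def prob (d : ℕ) (p : List V → Prop) : ℝ := avg d fun l => if p l then 1 else 0

theorem prob_mono {d : ℕ} {p q : List V → Prop} (h : ∀ l, l.length = d → p l → q l) :
    prob d p ≤ prob d q := by
  classical
  refine avg_mono fun l hl => ?_
  by_cases hp : p l
  · simp [hp, h l hl hp]
  · simp only [hp, if_false]; split_ifs <;> norm_num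

theorem prob_nonneg (d : ℕ) (p : List V → Prop) : 0 ≤ prob d p :=
  avg_nonneg fun l => by split_ifs <;> norm_num

theorem prob_or_le (d : ℕ) (p q : List V → Prop) :
    prob d (fun l => p l ∨ q l) ≤ prob d p + prob d q := by
  classical
  rw [prob, prob, prob, ← avg_add]
  refine avg_mono fun l _ => ?_
  by_cases hp : p l <;> by_cases hq : q l <;> simp [hp, hq]

theorem prob_not [Nonempty V] (d : ℕ) (p : List V → Prop) :
    prob d (fun l => ¬ p l) = 1 - prob d p := by
  classical
  rw [eq_sub_iff_add_eq, prob, prob, ← avg_add]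
  refine (avg_congr fun l _ => ?_).trans (avg_const d 1)
  by_cases hp : p l <;> simp [hp]

/-- Markov's inequality. -/
theorem prob_le_avg {d : ℕ} {p : List V → Prop} {φ : List V → ℝ} (h0 : ∀ l, 0 ≤ φ l)
    (h : ∀ l, l.length = d → p l → 1 ≤ φ l) : prob d p ≤ avg d φ := by
  refine avg_mono fun l hl => ?_
  split_ifs with hp
  · exact h l hl hp
  · exact h0 l

theorem prob_append_le [Nonempty V] {a b : ℕ} {p : List V → Prop} {δ : ℝ}
    (h : ∀ l₁, l₁.length = a → prob b (fun l₂ => p (l₁ ++ l₂)) ≤ δ) : prob (a + b) p ≤ δ := by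
  rw [prob, avg_append, ← avg_const (V := V) a δ]
  exact avg_mono fun l hl => h l hl

theorem prob_append_left [Nonempty V] (a b : ℕ) (p : List V → Prop) :
    prob (a + b) (fun l => p (l.take a)) = prob a p := by
  rw [prob, avg_append, prob]
  refine avg_congr fun l hl => ?_
  subst hl
  refine (avg_congr fun l₂ _ => ?_).trans (avg_const b _)
  rw [List.take_left]

end Average

/-! ### The greedy process and the expected cost of the recursive membership oracle -/

section Greedy

variable {V : Type*} [Fintype V] (G : SimpleGraph V)

open Classical in
/-- The vertices that are still undetermined when the greedy process has built `I`: they are not in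
`I` and have no neighbour in `I`. -/
noncomputable def alive (I : Finset V) : Finset V :=
  Finset.univ.filter fun v => v ∉ I ∧ ∀ u ∈ I, ¬ G.Adj u v

theorem mem_alive {I : Finset V} {v : V} :
    v ∈ alive G I ↔ v ∉ I ∧ ∀ u ∈ I, ¬ G.Adj u v := by
  simp [alive]

theorem greedyStep_of_mem [DecidableEq V] {I : Finset V} {v : V} (h : v ∈ alive G I) :
    greedyStep G I v = insert v I := by
  rw [greedyStep, if_pos ((mem_alive G).1 h).2]
  congr!

theorem greedyStep_of_notMem {I : Finset V} {v : V} (h : v ∉ alive G I) :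
    greedyStep G I v = I := by
  rw [mem_alive] at h
  classical
  unfold greedyStep
  split_ifs with h'
  · exact Finset.insert_eq_of_mem (by_contra fun hv => h ⟨hv, h'⟩)
  · rfl

theorem subset_greedyStep {V : Type*} (G : SimpleGraph V) (I : Finset V) (v : V) :
    I ⊆ greedyStep G I v := by
  classical
  unfold greedyStep
  split_ifs
  · exact Finset.subset_insert _ _
  · exact subset_rfl

theorem mem_alive_greedyStep {I : Finset V} {u v : V} :
    v ∈ alive G (greedyStep G I u) ↔
      v ∈ alive G I ∧ (u ∈ alive G I → v ≠ u ∧ ¬ G.Adj u v) := by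
  classical
  by_cases h : u ∈ alive G I
  · rw [greedyStep_of_mem G h, mem_alive, mem_alive]
    simp only [Finset.mem_insert, not_or, forall_eq_or_imp, h, true_implies]
    tauto
  · rw [greedyStep_of_notMem G h]; simp [h]

theorem alive_greedyStep_subset (I : Finset V) (u : V) :
    alive G (greedyStep G I u) ⊆ alive G I := fun _ h => ((mem_alive_greedyStep G).1 h).1

open Classical in
/-- The number of undetermined neighbours of `v`. -/
noncomputable def aliveDeg (I : Finset V) (v : V) : ℕ := ((alive G I).filter (G.Adj v)).card

theorem aliveDeg_greedyStep_le (I : Finset V) (u v : V) :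
    aliveDeg G (greedyStep G I u) v ≤ aliveDeg G I v := by
  classical
  unfold aliveDeg
  exact Finset.card_le_card (Finset.filter_subset_filter _ (alive_greedyStep_subset G I u))

open Classical in
/-- An undetermined vertex `z` becomes determined when the next vertex is `z` itself or one of
its undetermined neighbours. -/
theorem card_filter_mem_alive_greedyStep {I : Finset V} {z : V} (hz : z ∈ alive G I) :
    (Finset.univ.filter fun u => z ∈ alive G (greedyStep G I u)).card + (1 + aliveDeg G I z) =
      Fintype.card V := by
  have h : (Finset.univ.filter fun u => ¬ z ∈ alive G (greedyStep G I u)) =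
      insert z ((alive G I).filter (G.Adj z)) := by
    ext u
    simp only [mem_alive_greedyStep, Finset.mem_filter, Finset.mem_univ, true_and, hz,
      Finset.mem_insert, G.adj_comm z u, Classical.not_imp]
    constructor
    · rintro ⟨h1, h2⟩
      by_cases hzu : z = u
      · exact Or.inl hzu.symm
      · exact Or.inr ⟨h1, by_contra fun h3 => h2 ⟨hzu, h3⟩⟩
    · rintro (rfl | ⟨h1, h2⟩)
      · exact ⟨hz, by simp⟩
      · exact ⟨h1, by simp [h2]⟩
  have hc := Finset.card_filter_add_card_filter_not (s := (Finset.univ : Finset V))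
    (fun u => z ∈ alive G (greedyStep G I u))
  rw [h, Finset.card_insert_of_notMem (by simp), Finset.card_univ] at hc
  rw [aliveDeg]; omega

open Classical in
theorem sum_card_alive_greedyStep (I : Finset V) :
    ∑ u, (alive G (greedyStep G I u)).card + ∑ z ∈ alive G I, (1 + aliveDeg G I z) =
      Fintype.card V * (alive G I).card := by
  have h : ∀ u, (alive G (greedyStep G I u)).card =
      ∑ z ∈ alive G I, if z ∈ alive G (greedyStep G I u) then 1 else 0 := by
    intro u
    rw [← Finset.card_filter]
    congr 1
    ext z
    simp only [Finset.mem_filter]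
    exact ⟨fun hz => ⟨alive_greedyStep_subset G I u hz, hz⟩, fun hz => hz.2⟩
  simp_rw [h]
  rw [Finset.sum_comm, ← Finset.sum_add_distrib,
    Finset.sum_congr rfl (g := fun _ => Fintype.card V), Finset.sum_const, smul_eq_mul, mul_comm]
  intro z hz
  rw [← Finset.card_filter]
  exact card_filter_mem_alive_greedyStep G hz

open Classical in
/-- The degree lost by `y` in one greedy step with a uniform vertex pays, on average, for the calls
on `y` that the undetermined neighbours of `y` make. -/
theorem sum_aliveDeg_greedyStep (I : Finset V) (y : V) :
    ∑ u, aliveDeg G (greedyStep G I u) y +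
      ∑ z ∈ (alive G I).filter (G.Adj y), (1 + aliveDeg G I z) =
      Fintype.card V * aliveDeg G I y := by
  have h : ∀ u, aliveDeg G (greedyStep G I u) y =
      ∑ z ∈ (alive G I).filter (G.Adj y), if z ∈ alive G (greedyStep G I u) then 1 else 0 := by
    intro u
    rw [← Finset.card_filter, aliveDeg]
    congr 1
    ext z
    simp only [Finset.mem_filter]
    exact ⟨fun hz => ⟨⟨alive_greedyStep_subset G I u hz.1, hz.2⟩, hz.1⟩, fun hz => ⟨hz.2, hz.1.2⟩⟩
  simp_rw [h]
  rw [Finset.sum_comm, ← Finset.sum_add_distrib,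
    Finset.sum_congr rfl (g := fun _ => Fintype.card V), Finset.sum_const, smul_eq_mul, mul_comm,
    aliveDeg]
  intro z hz
  rw [← Finset.card_filter]
  exact card_filter_mem_alive_greedyStep G (Finset.mem_filter.1 hz).1

theorem avg_card_alive_le (d : ℕ) (I : Finset V) :
    avg d (fun l => ((alive G (l.foldl (greedyStep G) I)).card : ℝ)) ≤
      (1 - (Fintype.card V : ℝ)⁻¹) ^ d * (alive G I).card := by
  induction d generalizing I with
  | zero => simp [avg]
  | succ d ih =>
    rcases isEmpty_or_nonempty V with hV | hV
    · simp [avg]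
    have hn : (0 : ℝ) < Fintype.card V := by exact_mod_cast Fintype.card_pos
    have h1 : (1 : ℝ) ≤ Fintype.card V := by exact_mod_cast Fintype.card_pos
    have h0 : 0 ≤ 1 - (Fintype.card V : ℝ)⁻¹ := by
      rw [sub_nonneg]; exact inv_le_one_of_one_le₀ h1
    simp only [avg, List.foldl_cons]
    have h2 : ∑ u, (alive G (greedyStep G I u)).card + (alive G I).card ≤
        Fintype.card V * (alive G I).card := by
      rw [← sum_card_alive_greedyStep, add_le_add_iff_left, Finset.card_eq_sum_ones]
      exact Finset.sum_le_sum fun z _ => Nat.le_add_right _ _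
    have h3 : (∑ u, ((alive G (greedyStep G I u)).card : ℝ)) ≤
        (Fintype.card V : ℝ) * (alive G I).card - (alive G I).card := by
      rw [le_sub_iff_add_le]; exact_mod_cast h2
    calc _ ≤ (Fintype.card V : ℝ)⁻¹ * ∑ u, (1 - (Fintype.card V : ℝ)⁻¹) ^ d *
          ((alive G (greedyStep G I u)).card : ℝ) := by
          gcongr; exact ih _
      _ ≤ (Fintype.card V : ℝ)⁻¹ * ((1 - (Fintype.card V : ℝ)⁻¹) ^ d *
          ((Fintype.card V : ℝ) * (alive G I).card - (alive G I).card)) := by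
          rw [← Finset.mul_sum]; gcongr
      _ = _ := by rw [pow_succ]; field_simp

open Classical in
/-- The number of scanning steps of a call of the recursive oracle. The oracle decides whether the
vertex `y` is chosen by the greedy process on `x₀, x₁, …` by scanning this sequence until `y` is
determined, and it calls itself on every neighbour of `y` that it meets. The state holds the set
built so far and, for each `y`, the steps made so far by a call on `y`; `callCost` adds the last
step of a call that ends because it reaches its own position. -/
noncomputable def callCost (s : Finset V × (V → ℕ)) (v : V) : ℕ :=
  s.2 v + if v ∈ alive G s.1 then 1 else 0

theorem sum_callCost_mul (s : Finset V × (V → ℕ)) (f : V → ℕ) :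
    ∑ v, callCost G s v * f v = ∑ v, s.2 v * f v + ∑ v ∈ alive G s.1, f v := by
  classical
  simp only [callCost, add_mul _ _ (f _), ite_mul, one_mul, zero_mul]
  rw [Finset.sum_add_distrib, ← Finset.sum_filter, Finset.filter_mem_eq_inter, Finset.univ_inter]

open Classical in
/-- How the greedy set and the numbers of scanning steps change when `u` is the next vertex. -/
noncomputable def costStep (s : Finset V × (V → ℕ)) (u : V) : Finset V × (V → ℕ) :=
  (greedyStep G s.1 u, fun y =>
    s.2 y + if y ∈ alive G s.1 then 1 + (if G.Adj u y then callCost G s u else 0) else 0)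

theorem foldl_costStep_fst (l : List V) (s : Finset V × (V → ℕ)) :
    (l.foldl (costStep G) s).1 = l.foldl (greedyStep G) s.1 := by
  induction l generalizing s with
  | nil => rfl
  | cons x l ih => simp only [List.foldl_cons, ih]; rfl

open Classical in
theorem sum_costStep_le (I : Finset V) (c : V → ℕ) :
    ∑ u, ∑ y, (costStep G (I, c) u).2 y * (1 + aliveDeg G (greedyStep G I u) y) ≤
      Fintype.card V * ∑ y, callCost G (I, c) y * (1 + aliveDeg G I y) := by
  have hstep : ∀ u y, (costStep G (I, c) u).2 y =
      callCost G (I, c) y + if y ∈ alive G I ∧ G.Adj u y then callCost G (I, c) u else 0 := by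
    intro u y
    simp only [costStep, callCost]
    by_cases h1 : y ∈ alive G I <;> by_cases h2 : G.Adj u y <;> simp [h1, h2]; ring
  simp only [hstep, add_mul _ _ (1 + _), Finset.sum_add_distrib]
  rw [Finset.sum_comm, ← Finset.sum_add_distrib, Finset.mul_sum]
  refine Finset.sum_le_sum fun y _ => ?_
  have h := sum_aliveDeg_greedyStep G I y
  rw [← Finset.mul_sum]
  have h2 : ∑ z, (if z ∈ alive G I ∧ G.Adj y z then callCost G (I, c) y else 0) *
      (1 + aliveDeg G (greedyStep G I y) z) ≤
      callCost G (I, c) y * ∑ z ∈ (alive G I).filter (G.Adj y), (1 + aliveDeg G I z) := by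
    rw [Finset.mul_sum]
    simp only [ite_mul, zero_mul]
    rw [← Finset.sum_filter]
    rw [show Finset.univ.filter (fun z => z ∈ alive G I ∧ G.Adj y z) =
      (alive G I).filter (G.Adj y) by ext; simp]
    refine Finset.sum_le_sum fun z _ => ?_
    gcongr
    exact aliveDeg_greedyStep_le G I y z
  calc _ ≤ callCost G (I, c) y * ∑ u, (1 + aliveDeg G (greedyStep G I u) y) +
        callCost G (I, c) y * ∑ z ∈ (alive G I).filter (G.Adj y), (1 + aliveDeg G I z) := by
        gcongr
    _ = callCost G (I, c) y * (Fintype.card V + Fintype.card V * aliveDeg G I y) := by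
        rw [← h, Finset.sum_add_distrib]; simp; ring
    _ = _ := by ring

/-- The expected number of scanning steps of a call on a uniform vertex, after a sequence of `d`
uniform vertices. The potential weighs a step already charged to `y` by one plus the number of
undetermined neighbours of `y`, as these may still call `y`. -/
theorem avg_sum_callCost_le [Nonempty V] (d : ℕ) (I : Finset V) (c : V → ℕ) :
    avg d (fun l => ((∑ v, callCost G (l.foldl (costStep G) (I, c)) v : ℕ) : ℝ)) ≤
      ((∑ y, c y * (1 + aliveDeg G I y) + Fintype.card V * (alive G I).card : ℕ) : ℝ) := by
  classical
  have hn : 0 < Fintype.card V := Fintype.card_pos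
  induction d generalizing I c with
  | zero =>
    have h := sum_callCost_mul G (I, c) 1
    simp only [Pi.one_apply, mul_one, ← Finset.card_eq_sum_ones] at h
    simp only [avg, List.foldl_nil, h]
    rw [Nat.cast_le]
    refine add_le_add (Finset.sum_le_sum fun y _ => ?_) (Nat.le_mul_of_pos_left _ hn)
    exact Nat.le_mul_of_pos_right _ (by omega)
  | succ d ih =>
    simp only [avg, List.foldl_cons]
    rw [inv_mul_le_iff₀ (by exact_mod_cast hn)]
    calc _ ≤ ∑ u, ((∑ y, (costStep G (I, c) u).2 y * (1 + aliveDeg G (greedyStep G I u) y) +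
          Fintype.card V * (alive G (greedyStep G I u)).card : ℕ) : ℝ) :=
          Finset.sum_le_sum fun u _ => ih _ _
      _ ≤ _ := by
        rw [← Nat.cast_sum, ← Nat.cast_mul, Nat.cast_le, Finset.sum_add_distrib, ← Finset.mul_sum]
        have h1 := sum_costStep_le G I c
        have h2 := sum_card_alive_greedyStep G I
        have h3 : ∑ y, callCost G (I, c) y * (1 + aliveDeg G I y) =
            ∑ y, c y * (1 + aliveDeg G I y) + ∑ z ∈ alive G I, (1 + aliveDeg G I z) :=
          sum_callCost_mul G (I, c) _
        rw [h3] at h1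
        calc _ ≤ Fintype.card V * (∑ y, c y * (1 + aliveDeg G I y) +
              ∑ z ∈ alive G I, (1 + aliveDeg G I z)) +
              Fintype.card V * ∑ u, (alive G (greedyStep G I u)).card := by gcongr
          _ = Fintype.card V * (∑ y, c y * (1 + aliveDeg G I y) +
              (∑ u, (alive G (greedyStep G I u)).card +
                ∑ z ∈ alive G I, (1 + aliveDeg G I z))) := by ring
          _ ≤ _ := by rw [h2]

end Greedy

/-! ### Maximal independent sets are greedy sets -/

section Greedy

variable {V : Type*} (G : SimpleGraph V)

theorem foldl_greedyStep_eq_union [DecidableEq V] (l : List V) (J : Finset V)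
    (h : ∀ u ∈ J ∪ l.toFinset, ∀ v ∈ J ∪ l.toFinset, ¬ G.Adj u v) :
    l.foldl (greedyStep G) J = J ∪ l.toFinset := by
  induction l generalizing J with
  | nil => simp
  | cons x l ih =>
    have hx : greedyStep G J x = insert x J := by
      rw [greedyStep, if_pos fun u hu => h u (by simp [hu]) x (by simp)]
      congr!
    have he : insert x J ∪ l.toFinset = J ∪ (x :: l).toFinset := by ext; simp
    rw [List.foldl_cons, hx, ih _ (by rwa [he]), he]

theorem foldl_greedyStep_of_alive_eq_empty [Fintype V] {I : Finset V} (h : alive G I = ∅)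
    (l : List V) : l.foldl (greedyStep G) I = I := by
  induction l with
  | nil => rfl
  | cons x l ih => rw [List.foldl_cons, greedyStep_of_notMem G (by simp [h]), ih]

theorem foldl_greedyStep_independent (l : List V) (I : Finset V)
    (h : ∀ u ∈ I, ∀ v ∈ I, ¬ G.Adj u v) :
    ∀ u ∈ l.foldl (greedyStep G) I, ∀ v ∈ l.foldl (greedyStep G) I, ¬ G.Adj u v := by
  classical
  induction l generalizing I with
  | nil => exact h
  | cons x l ih =>
    refine ih _ ?_
    unfold greedyStep
    split_ifs with hx
    · intro u hu v hv
      rcases Finset.mem_insert.1 hu with rfl | hu' <;>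
        rcases Finset.mem_insert.1 hv with rfl | hv'
      · exact G.irrefl
      · exact fun ha => hx v hv' ha.symm
      · exact hx u hu'
      · exact h u hu' v hv'
    · exact h

/-- The greedy process finds every maximal independent set: it only has to visit it first. -/
theorem exists_RGMIS_eq {n : ℕ} (G : SimpleGraph (Fin n)) (I : Finset (Fin n))
    (hI : ∀ u ∈ I, ∀ v ∈ I, ¬ G.Adj u v) (hmax : alive G I = ∅) :
    ∃ π : Fin n ≃ Fin n, RGMIS G π = I := by
  classical
  set l : List (Fin n) := I.toList ++ Iᶜ.toList with hl
  have hnd : l.Nodup := by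
    refine List.nodup_append.2 ⟨I.nodup_toList, Iᶜ.nodup_toList, fun a ha b hb hab => ?_⟩
    rw [Finset.mem_toList] at ha hb
    rw [Finset.mem_compl] at hb
    exact hb (hab ▸ ha)
  have hmem : ∀ v, v ∈ l := fun v => by
    by_cases hv : v ∈ I <;> simp [hl, hv]
  have hlen : n = l.length := by
    simp [hl, Finset.card_compl, Nat.add_sub_cancel' (card_finset_fin_le I)]
  refine ⟨(finCongr hlen).trans (hnd.getEquivOfForallMemList l hmem), ?_⟩
  have hof : List.ofFn ((finCongr hlen).trans (hnd.getEquivOfForallMemList l hmem)) = l := by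
    refine List.ext_getElem (by simpa using hlen) fun i h1 h2 => ?_
    simp [List.Nodup.getEquivOfForallMemList]
  have hfold := foldl_greedyStep_eq_union G I.toList ∅ (by simpa using hI)
  rw [Finset.empty_union, Finset.toList_toFinset] at hfold
  rw [RGMIS, hof, hl, List.foldl_append, hfold, foldl_greedyStep_of_alive_eq_empty G hmax]

end Greedy

/-! ### Failure probabilities -/

section Rows

theorem map_range_getD {V : Type*} (l : List V) (v₀ : V) {q : ℕ} (hq : q ≤ l.length) :
    (List.range q).map (fun j => l.getD j v₀) = l.take q := by
  refine List.ext_getElem (by simpa using hq) fun i h1 h2 => ?_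
  simp only [List.getElem_map, List.getElem_range, List.getElem_take]
  rw [List.getD_eq_getElem]

variable {V : Type*} [Fintype V] (G : SimpleGraph V)

/-- The state of `costStep` after the first `j` vertices of the sequence `x`. -/
noncomputable def stateAt (x : ℕ → V) : ℕ → Finset V × (V → ℕ)
  | 0 => (∅, 0)
  | j + 1 => costStep G (stateAt x j) (x j)

theorem stateAt_eq_foldl (x : ℕ → V) (j : ℕ) :
    stateAt G x j = ((List.range j).map x).foldl (costStep G) (∅, 0) := by
  induction j with
  | zero => rfl
  | succ j ih => simp [stateAt, ih, List.range_succ]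

theorem stateAt_fst_eq_foldl (x : ℕ → V) (j : ℕ) :
    (stateAt G x j).1 = ((List.range j).map x).foldl (greedyStep G) ∅ := by
  rw [stateAt_eq_foldl, foldl_costStep_fst]

theorem stateAt_congr {x y : ℕ → V} {j : ℕ} (h : ∀ i < j, x i = y i) :
    stateAt G x j = stateAt G y j := by
  rw [stateAt_eq_foldl, stateAt_eq_foldl]
  congr 1
  exact List.map_congr_left fun i hi => h i (List.mem_range.1 hi)

/-- The number of scanning steps of all calls on the positions `L, …, W - 1`. -/
noncomputable def rowCost (L W : ℕ) (x : ℕ → V) : ℕ :=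
  ∑ q ∈ Finset.Ico L W, callCost G (stateAt G x q) (x q)

open Classical in
/-- The number of positions `L, …, W - 1` that hold a vertex chosen by the greedy process on the
first `L` vertices. -/
noncomputable def hits (L W : ℕ) (x : ℕ → V) : ℕ :=
  ((Finset.Ico L W).filter fun q => x q ∈ (stateAt G x L).1).card

theorem avg_callCost_le [Nonempty V] (v₀ : V) {q W : ℕ} (hq : q < W) :
    avg W (fun l => (callCost G (stateAt G (fun j => l.getD j v₀) q) (l.getD q v₀) : ℝ)) ≤
      Fintype.card V := by
  have hn : 0 < (Fintype.card V : ℝ) := by exact_mod_cast Fintype.card_pos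
  obtain ⟨d, rfl⟩ := Nat.exists_eq_add_of_lt hq
  have h := avg_sum_callCost_le G q ∅ 0
  have ha : alive G ∅ = Finset.univ := by ext; simp [mem_alive]
  rw [show q + d + 1 = q + (d + 1) by ring, avg_append]
  calc _ = avg q (fun l => (Fintype.card V : ℝ)⁻¹ *
        ((∑ v, callCost G (l.foldl (costStep G) (∅, 0)) v : ℕ) : ℝ)) := by
        refine avg_congr fun l hl => ?_
        subst hl
        simp only [avg]
        congr 1
        rw [Nat.cast_sum]
        refine Finset.sum_congr rfl fun v _ => ?_
        rw [← avg_const (V := V) d (callCost G (l.foldl (costStep G) (∅, 0)) v : ℝ)]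
        refine avg_congr fun l' _ => ?_
        rw [stateAt_eq_foldl, map_range_getD _ _ (by simp)]
        simp
    _ ≤ _ := by
      rw [avg_const_mul, inv_mul_le_iff₀ hn]
      refine h.trans (le_of_eq ?_)
      simp [ha]

theorem prob_rowCost_le [Nonempty V] (v₀ : V) (L s : ℕ) :
    prob (L + s) (fun l => 2 * s * Fintype.card V <
      rowCost G L (L + s) fun j => l.getD j v₀) ≤ 1 / 2 := by
  rcases Nat.eq_zero_or_pos s with rfl | hs
  · rw [prob, avg_congr (ψ := fun _ => 0)]
    · rw [avg_const]; norm_num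
    · intro l _; simp [rowCost]
  have hn : 0 < (Fintype.card V : ℝ) := by exact_mod_cast Fintype.card_pos
  have hs' : (0 : ℝ) < s := by exact_mod_cast hs
  refine (prob_le_avg (φ := fun l => (2 * s * Fintype.card V : ℝ)⁻¹ *
    ∑ q ∈ Finset.Ico L (L + s),
      (callCost G (stateAt G (fun j => l.getD j v₀) q) (l.getD q v₀) : ℝ)) ?_ ?_).trans ?_
  · intro l; positivity
  · intro l _ h
    rw [← div_eq_inv_mul, one_le_div (by positivity)]
    exact_mod_cast h.le
  · rw [avg_const_mul, avg_sum]
    have : ∑ q ∈ Finset.Ico L (L + s), avg (L + s) (fun l : List V =>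
        (callCost G (stateAt G (fun j => l.getD j v₀) q) (l.getD q v₀) : ℝ)) ≤
        ∑ q ∈ Finset.Ico L (L + s), (Fintype.card V : ℝ) :=
      Finset.sum_le_sum fun q hq => avg_callCost_le G v₀ (Finset.mem_Ico.1 hq).2
    rw [Finset.sum_const, Nat.card_Ico, Nat.add_sub_cancel_left, nsmul_eq_mul] at this
    calc _ ≤ (2 * s * Fintype.card V : ℝ)⁻¹ * (s * Fintype.card V) := by gcongr
      _ = 1 / 2 := by field_simp

theorem prob_alive_nonempty_le [Nonempty V] (L : ℕ) :
    prob L (fun l => (alive G (l.foldl (greedyStep G) ∅)).Nonempty) ≤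
      Fintype.card V * Real.exp (-(L / Fintype.card V : ℝ)) := by
  have hn : (1 : ℝ) ≤ Fintype.card V := by exact_mod_cast Fintype.card_pos
  refine (prob_le_avg (φ := fun l => ((alive G (l.foldl (greedyStep G) ∅)).card : ℝ))
    (fun _ => by positivity) fun l _ h => by exact_mod_cast h.card_pos).trans ?_
  refine (avg_card_alive_le G L ∅).trans ?_
  have ha : alive G ∅ = Finset.univ := by ext; simp [mem_alive]
  rw [ha, Finset.card_univ, mul_comm]
  gcongr
  rw [div_eq_mul_inv, ← mul_neg, Real.exp_nat_mul]
  gcongr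
  · rw [sub_nonneg]; exact inv_le_one_of_one_le₀ hn
  · have := Real.add_one_le_exp (-(Fintype.card V : ℝ)⁻¹); linarith

open Classical in
theorem avg_exp_countP_le [Nonempty V] (I : Finset V) (d : ℕ) (z : ℝ) :
    avg d (fun l => Real.exp (z * l.countP fun v => v ∈ I)) ≤
      Real.exp (d * (I.card / Fintype.card V * (Real.exp z - 1))) := by
  induction d with
  | zero => simp [avg]
  | succ d ih =>
    have hn : (0 : ℝ) < Fintype.card V := by exact_mod_cast Fintype.card_pos
    have h1 : ∀ x, avg d (fun l => Real.exp (z * (x :: l).countP fun v => v ∈ I)) =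
        (1 + if x ∈ I then Real.exp z - 1 else 0) *
          avg d (fun l => Real.exp (z * l.countP fun v => v ∈ I)) := by
      intro x
      rw [← avg_const_mul]
      refine avg_congr fun l _ => ?_
      by_cases hx : x ∈ I
      · simp [hx, mul_add, Real.exp_add]; ring
      · simp [hx]
    simp only [avg, h1, ← Finset.sum_mul]
    have h2 : (Fintype.card V : ℝ)⁻¹ * ∑ x, (1 + if x ∈ I then Real.exp z - 1 else 0) =
        1 + I.card / Fintype.card V * (Real.exp z - 1) := by
      simp [Finset.sum_add_distrib]
      field_simp
    rw [← mul_assoc, h2]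
    push_cast
    rw [add_one_mul, add_comm (d * _ : ℝ), Real.exp_add]
    have h3 := Real.add_one_le_exp (I.card / Fintype.card V * (Real.exp z - 1))
    gcongr
    · exact avg_nonneg fun l => Real.exp_nonneg _
    · linarith

open Classical in
/-- A multiplicative Chernoff bound. -/
theorem prob_deviation_le [Nonempty V] (I : Finset V) (d : ℕ) {δ : ℝ} (h0 : 0 < δ) (h1 : δ ≤ 1) :
    prob d (fun l => δ * (d * I.card / Fintype.card V) <
      |((l.countP fun v => v ∈ I : ℕ) : ℝ) - d * I.card / Fintype.card V|) ≤
      2 * Real.exp (-(δ ^ 2 / 4 * (d * I.card / Fintype.card V))) := by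
  set μ : ℝ := d * I.card / Fintype.card V with hμ
  have hμ0 : 0 ≤ μ := by positivity
  have key : ∀ z : ℝ, |z| = δ / 2 → prob d (fun l => z * μ + |z| * (δ * μ) ≤
      z * (l.countP fun v => v ∈ I : ℕ)) ≤ Real.exp (-(δ ^ 2 / 4 * μ)) := by
    intro z hz
    have hexp : Real.exp z - 1 ≤ z + z ^ 2 := by
      have := Real.abs_exp_sub_one_sub_id_le (x := z) (by rw [hz]; linarith)
      linarith [le_abs_self (Real.exp z - 1 - z)]
    have hz2 : z ^ 2 = δ ^ 2 / 4 := by rw [← sq_abs, hz]; ring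
    refine (prob_le_avg (φ := fun l => Real.exp (-(z * μ + |z| * (δ * μ))) *
      Real.exp (z * (l.countP fun v => v ∈ I : ℕ))) (fun l => by positivity) ?_).trans ?_
    · intro l _ h
      rw [← Real.exp_add, Real.one_le_exp_iff]
      linarith
    · rw [avg_const_mul]
      calc _ ≤ Real.exp (-(z * μ + |z| * (δ * μ))) *
            Real.exp (d * (I.card / Fintype.card V * (Real.exp z - 1))) := by
            gcongr; exact avg_exp_countP_le I d z
        _ ≤ _ := by
          rw [← Real.exp_add, Real.exp_le_exp]
          have : (d * (I.card / Fintype.card V * (Real.exp z - 1)) : ℝ) =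
              μ * (Real.exp z - 1) := by rw [hμ]; ring
          rw [this, hz]
          have := mul_le_mul_of_nonneg_left hexp hμ0
          rw [hz2] at this
          nlinarith
  refine (prob_mono (q := fun l => (δ / 2 * μ + |δ / 2| * (δ * μ) ≤
      δ / 2 * (l.countP fun v => v ∈ I : ℕ)) ∨ (-(δ / 2) * μ + |-(δ / 2)| * (δ * μ) ≤
      -(δ / 2) * (l.countP fun v => v ∈ I : ℕ))) ?_).trans ((prob_or_le _ _ _).trans ?_)
  · intro l _ h
    rw [abs_neg, abs_of_pos (by positivity : 0 < δ / 2)]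
    rcases lt_abs.1 h with h | h
    · left; nlinarith
    · right; nlinarith
  · have ha := key (δ / 2) (abs_of_pos (by positivity))
    have hb := key (-(δ / 2)) (by rw [abs_neg, abs_of_pos (by positivity)])
    linarith

/-- Scaling up the number of hits gives a good estimate when it is within a factor `1 ± 1/(6E)` of
its mean. The summand `1` makes up for the rounding. -/
theorem estimate_of_deviation_le {n s M X E : ℕ} (hn : 0 < n) (hs : 0 < s) (hE : 0 < E)
    (hM : 3 * E ≤ M)
    (h : |(X : ℝ) - s * M / n| ≤ (1 / (6 * E)) * (s * M / n)) :
    (M : ℝ) ≤ ((X * n * (3 * E + 1) / (3 * E * s) + 1 : ℕ) : ℝ) ∧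
      ((X * n * (3 * E + 1) / (3 * E * s) + 1 : ℕ) : ℝ) ≤ (1 + 1 / E) * M := by
  have hn' : (0 : ℝ) < n := by exact_mod_cast hn
  have hs' : (0 : ℝ) < s := by exact_mod_cast hs
  have hE' : (1 : ℝ) ≤ E := by exact_mod_cast hE
  have hE0 : (0 : ℝ) < E := by linarith
  have hM' : 3 * (E : ℝ) ≤ M := by exact_mod_cast hM
  obtain ⟨t, ht⟩ : ∃ t : ℝ, (X : ℝ) = t * (s / n) := ⟨X * n / s, by field_simp⟩
  have hsn : (0 : ℝ) < s / n := by positivity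
  have htM : |t - M| ≤ 1 / (6 * E) * M := by
    have h2 : (X : ℝ) - s * M / n = (t - M) * (s / n) := by rw [ht]; ring
    rw [h2, abs_mul, abs_of_pos hsn, show (1 / (6 * E) * (s * M / n) : ℝ) =
      1 / (6 * E) * M * (s / n) by ring] at h
    exact le_of_mul_le_mul_right h hsn
  rw [abs_le] at htM
  have hval : ((X * n * (3 * E + 1) : ℕ) : ℝ) / ((3 * E * s : ℕ) : ℝ) =
      t * (1 + 1 / (3 * E)) := by
    push_cast
    rw [ht]; field_simp
  obtain ⟨e, he⟩ : ∃ e : ℝ, e = 1 / E := ⟨_, rfl⟩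
  have he0 : 0 < e := by rw [he]; positivity
  have he1 : e ≤ 1 := by rw [he, div_le_one hE0]; exact hE'
  have heM : 3 ≤ e * M := by rw [he, one_div, ← div_eq_inv_mul, le_div_iff₀ hE0]; exact hM'
  have h6 : (1 / (6 * E) : ℝ) = e / 6 := by rw [he]; field_simp
  have h3 : (1 / (3 * E) : ℝ) = e / 3 := by rw [he]; field_simp
  rw [h6] at htM
  rw [h3] at hval
  rw [← he]
  have hM0 : (0 : ℝ) ≤ M := by positivity
  have heM' : e * (e * M) ≤ 1 * (e * M) := by gcongr
  constructor
  · have := Nat.lt_floor_add_one (((X * n * (3 * E + 1) : ℕ) : ℝ) / ((3 * E * s : ℕ) : ℝ))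
    rw [Nat.floor_div_eq_div, hval] at this
    push_cast at this ⊢
    refine le_trans ?_ this.le
    nlinarith
  · have := Nat.cast_div_le (α := ℝ) (m := X * n * (3 * E + 1)) (n := 3 * E * s)
    rw [hval] at this
    push_cast at this ⊢
    nlinarith

end Rows

/-! ### Reliable tapes -/

section Rows

/-- The `r`-th row of length `W` of a tape. -/
def row {V : Type*} (v₀ : V) (W : ℕ) (l : List V) (r : ℕ) : ℕ → V := fun j => l.getD (r * W + j) v₀

theorem row_append_succ {V : Type*} (v₀ : V) {W : ℕ} {a : List V} (ha : a.length = W) (b : List V)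
    (r : ℕ) :
    row v₀ W (a ++ b) (r + 1) = row v₀ W b r := by
  funext j
  have : (r + 1) * W + j - W = r * W + j := by rw [add_mul, one_mul]; omega
  rw [row, List.getD_append_right _ _ _ _ (by rw [ha, add_mul, one_mul]; omega), ha, this, row]

theorem row_append_zero {V : Type*} (v₀ : V) {W : ℕ} {a : List V} (ha : a.length = W) (b : List V)
    {j : ℕ} (hj : j < W) : row v₀ W (a ++ b) 0 j = a.getD j v₀ := by
  rw [row, zero_mul, zero_add, List.getD_append _ _ _ _ (by omega)]

variable {V : Type*} [Fintype V] (G : SimpleGraph V)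

/-- The estimate of the size of the greedy set computed from `X` hits among `s` samples. -/
def estimate (n s E X : ℕ) : ℕ := X * n * (3 * E + 1) / (3 * E * s) + 1

/-- The sequence `x` is misleading if its first `L` vertices do not determine all vertices, or if
the greedy set is large but the estimate of its size from the positions `L, …, L + s - 1` is
wrong. -/
def IsMisleading (L s K E : ℕ) (x : ℕ → V) : Prop :=
  (alive G (stateAt G x L).1).Nonempty ∨
    (K < (stateAt G x L).1.card ∧
      ¬ (((stateAt G x L).1.card : ℝ) ≤ estimate (Fintype.card V) s E (hits G L (L + s) x) ∧
        (estimate (Fintype.card V) s E (hits G L (L + s) x) : ℝ) ≤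
          (1 + 1 / E) * (stateAt G x L).1.card))

theorem hits_eq_countP [DecidableEq V] (v₀ : V) (L s : ℕ) (l₁ l₂ : List V) (h₁ : l₁.length = L)
    (h₂ : l₂.length = s) :
    hits G L (L + s) (fun j => (l₁ ++ l₂).getD j v₀) =
      l₂.countP fun v => v ∈ l₁.foldl (greedyStep G) ∅ := by
  have hI : (stateAt G (fun j => (l₁ ++ l₂).getD j v₀) L).1 = l₁.foldl (greedyStep G) ∅ := by
    rw [stateAt_fst_eq_foldl, map_range_getD _ _ (by simp; omega), ← h₁, List.take_left]
  rw [hits, hI]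
  generalize l₁.foldl (greedyStep G) ∅ = I
  have hl : l₂ = (List.range' L s).map fun j => (l₁ ++ l₂).getD j v₀ := by
    refine List.ext_getElem (by simp [h₂]) fun i hi _ => ?_
    simp only [List.getElem_map, List.getElem_range', one_mul]
    rw [List.getD_eq_getElem _ _ (by simp; omega), List.getElem_append_right (by omega)]
    congr 1; omega
  conv_rhs => rw [hl]
  rw [List.countP_map, List.countP_eq_length_filter]
  have hnd : ((List.range' L s).filter
      ((fun v => decide (v ∈ I)) ∘ fun j => (l₁ ++ l₂).getD j v₀)).Nodup :=
    (List.nodup_range' (step := 1) (by norm_num)).filter _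
  rw [← List.toFinset_card_of_nodup hnd]
  congr 1
  ext q
  simp [List.mem_range'_1]

theorem prob_isMisleading_le [Nonempty V] (v₀ : V) {L s K E : ℕ} (hs : 0 < s) (hE : 0 < E)
    (hK : 3 * E ≤ K + 1) :
    prob (L + s) (fun l => IsMisleading G L s K E fun j => l.getD j v₀) ≤
      Fintype.card V * Real.exp (-(L / Fintype.card V : ℝ)) +
        2 * Real.exp (-(s * (K + 1) / (144 * E ^ 2 * Fintype.card V) : ℝ)) := by
  classical
  have hn : 0 < (Fintype.card V : ℝ) := by exact_mod_cast Fintype.card_pos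
  have hE' : (0 : ℝ) < E := by exact_mod_cast hE
  have hI : ∀ l : List V, l.length = L + s →
      (stateAt G (fun j => l.getD j v₀) L).1 = (l.take L).foldl (greedyStep G) ∅ := by
    intro l hl
    rw [stateAt_fst_eq_foldl, map_range_getD _ _ (by omega)]
  refine (prob_or_le _ _ _).trans (add_le_add ?_ ?_)
  · refine le_trans ?_ (prob_alive_nonempty_le G L)
    rw [← prob_append_left L s]
    exact prob_mono fun l hl h => by rwa [hI l hl] at h
  · refine prob_append_le fun l₁ h₁ => ?_
    set I := l₁.foldl (greedyStep G) ∅ with hIdef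
    by_cases hM : K < I.card
    · have hE1 : (1 / (6 * E) : ℝ) ≤ 1 := by
        rw [div_le_one (by positivity)]
        have : (1 : ℝ) ≤ E := by exact_mod_cast hE
        linarith
      refine le_trans (prob_mono ?_) ((prob_deviation_le I s (δ := 1 / (6 * E))
        (by positivity) hE1).trans ?_)
      · intro l₂ h₂ h
        rw [hI _ (by simp [h₁, h₂]), ← h₁, List.take_left, h₁,
          hits_eq_countP G v₀ L s l₁ l₂ h₁ h₂] at h
        by_contra hd
        exact h.2 (estimate_of_deviation_le Fintype.card_pos hs hE (by omega) (not_lt.1 hd))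
      · gcongr
        have hM' : (K : ℝ) + 1 ≤ I.card := by exact_mod_cast hM
        calc (s * (K + 1) / (144 * E ^ 2 * Fintype.card V) : ℝ) ≤
            s * I.card / (144 * E ^ 2 * Fintype.card V) := by gcongr
          _ = _ := by field_simp; ring
    · refine le_trans (prob_mono (q := fun _ => False) ?_) ?_
      · intro l₂ h₂ h
        rw [hI _ (by simp [h₁, h₂]), ← h₁, List.take_left] at h
        exact hM h.1
      · rw [prob]
        simp only [if_false]
        rw [avg_const]
        positivity

variable [Nonempty V]

theorem prob_exists_row_le (v₀ : V) {W : ℕ} {p : (ℕ → V) → Prop}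
    (hp : ∀ x y : ℕ → V, (∀ j < W, x j = y j) → p x → p y) (R : ℕ) :
    prob (R * W) (fun l => ∃ r < R, p (row v₀ W l r)) ≤
      R * prob W fun l => p fun j => l.getD j v₀ := by
  classical
  induction R with
  | zero => simp [prob, avg_const]
  | succ R ih =>
    rw [show (R + 1) * W = W + R * W by ring]
    refine (prob_mono (q := fun l => p (fun j => (l.take W).getD j v₀) ∨
      ∃ r < R, p (row v₀ W (l.drop W) r)) ?_).trans ((prob_or_le _ _ _).trans ?_)
    · rintro l hl ⟨r, hr, h⟩
      have ha : (l.take W).length = W := by rw [List.length_take]; omega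
      rw [← List.take_append_drop W l] at h
      rcases r with - | r
      · exact Or.inl (hp _ _ (fun j hj => row_append_zero v₀ ha _ hj) h)
      · exact Or.inr ⟨r, by omega, row_append_succ v₀ ha _ r ▸ h⟩
    · rw [prob_append_left W (R * W) fun l => p fun j => l.getD j v₀]
      push_cast
      rw [add_mul, one_mul, add_comm]
      refine add_le_add_left (prob_append_le fun l₁ h₁ => ?_) _
      subst h₁
      simpa using ih

theorem prob_forall_row_le (v₀ : V) {W : ℕ} {p : (ℕ → V) → Prop}
    (hp : ∀ x y : ℕ → V, (∀ j < W, x j = y j) → p x → p y) (R : ℕ) :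
    prob (R * W) (fun l => ∀ r < R, p (row v₀ W l r)) ≤
      (prob W fun l => p fun j => l.getD j v₀) ^ R := by
  classical
  induction R with
  | zero => simp [prob, avg_const]
  | succ R ih =>
    rw [show (R + 1) * W = W + R * W by ring, pow_succ']
    set q := prob W fun l => p fun j => l.getD j v₀ with hq
    have hstep : prob (W + R * W) (fun l => ∀ r < R + 1, p (row v₀ W l r)) ≤
        avg W fun l₁ => (if p (fun j => l₁.getD j v₀) then 1 else 0) * q ^ R := by
      rw [prob, avg_append]
      refine avg_mono fun l₁ h₁ => ?_
      by_cases h : p fun j => l₁.getD j v₀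
      · rw [if_pos h, one_mul]
        refine le_trans (prob_mono fun l₂ _ hl r hr => ?_) ih
        exact row_append_succ v₀ h₁ l₂ r ▸ hl (r + 1) (by omega)
      · rw [if_neg h, zero_mul]
        refine le_trans (avg_mono (ψ := fun _ => 0) fun l₂ _ => le_of_eq (if_neg fun hl => h ?_))
          (avg_const _ _).le
        exact hp _ _ (fun j hj => row_append_zero v₀ h₁ _ hj) (hl 0 (by omega))
    rwa [avg_mul_const] at hstep

/-- A tape is reliable if none of its rows is misleading and the calls of at least one row are
cheap. -/
def IsReliable (v₀ : V) (L s K E R : ℕ) (l : List V) : Prop :=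
  (∀ r < R, ¬ IsMisleading G L s K E (row v₀ (L + s) l r)) ∧
    ∃ r < R, rowCost G L (L + s) (row v₀ (L + s) l r) ≤ 2 * s * Fintype.card V

theorem prob_isReliable_ge (v₀ : V) {L s K E : ℕ} (hs : 0 < s) (hE : 0 < E)
    (hK : 3 * E ≤ K + 1) (R : ℕ) :
    1 - (R * (Fintype.card V * Real.exp (-(L / Fintype.card V : ℝ)) +
        2 * Real.exp (-(s * (K + 1) / (144 * E ^ 2 * Fintype.card V) : ℝ))) + (1 / 2) ^ R) ≤
      prob (R * (L + s)) (IsReliable G v₀ L s K E R) := by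
  have h1 := prob_exists_row_le v₀ (W := L + s) (p := IsMisleading G L s K E) (fun x y h hx => by
    have hst := stateAt_congr G (x := x) (y := y) (j := L) fun i hi => h i (by omega)
    have hh : hits G L (L + s) x = hits G L (L + s) y := by
      classical
      rw [hits, hits, hst]
      refine congrArg _ (Finset.filter_congr fun q hq => ?_)
      rw [h q (Finset.mem_Ico.1 hq).2]
    rwa [IsMisleading, hst, hh] at hx) R
  have h2 := prob_forall_row_le v₀ (W := L + s)
    (p := fun x => 2 * s * Fintype.card V < rowCost G L (L + s) x) (fun x y h hx => by
    have : rowCost G L (L + s) x = rowCost G L (L + s) y := by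
      refine Finset.sum_congr rfl fun q hq => ?_
      have hq := (Finset.mem_Ico.1 hq).2
      rw [stateAt_congr G (x := x) (y := y) (j := q) fun i hi => h i (by omega), h q hq]
    rwa [this] at hx) R
  have h3 := prob_not (R * (L + s)) (IsReliable G v₀ L s K E R)
  have h4 : prob (R * (L + s)) (fun l => ¬ IsReliable G v₀ L s K E R l) ≤ _ :=
    (prob_mono (q := fun l => (∃ r < R, IsMisleading G L s K E (row v₀ (L + s) l r)) ∨
      ∀ r < R, 2 * s * Fintype.card V < rowCost G L (L + s) (row v₀ (L + s) l r))
      fun l _ hl => by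
        by_contra hc
        push Not at hc
        exact hl ⟨hc.1, hc.2⟩).trans (prob_or_le _ _ _)
  have h5 : (R : ℝ) * prob (L + s) (fun l => IsMisleading G L s K E fun j => l.getD j v₀) ≤ _ :=
    mul_le_mul_of_nonneg_left (prob_isMisleading_le G v₀ (L := L) hs hE hK) (Nat.cast_nonneg R)
  have h6 := pow_le_pow_left₀ (prob_nonneg _ _) (prob_rowCost_le G v₀ L s) R
  linarith

end Rows

/-! ### The recursive oracle as a stack machine -/

section Scan

/-- A configuration of the stack machine that answers the oracle calls on consecutive positions:
the position `q` of the current top-level call, the positions of the pending calls (the innermost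
one first), the position `j` that the innermost call scans next, and the number `X` of top-level
calls that were answered positively. -/
structure Cfg : Type where
  q : ℕ
  stack : List ℕ
  j : ℕ
  X : ℕ

/-- The innermost call answers no: its caller goes on behind the position it asked about. -/
def answerNo (c : Cfg) : Cfg :=
  match c.stack with
  | [] => c
  | [_] => ⟨c.q + 1, [c.q + 1], 0, c.X⟩
  | p :: p' :: rest => ⟨c.q, p' :: rest, p + 1, c.X⟩

/-- The innermost call answers yes, so that its caller answers no. -/
def answerYes (c : Cfg) : Cfg :=
  match c.stack with
  | [] => c
  | [_] => ⟨c.q + 1, [c.q + 1], 0, c.X + 1⟩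
  | _ :: p' :: rest => answerNo ⟨c.q, p' :: rest, c.j, c.X⟩

theorem answerNo_congr {c : Cfg} {p : ℕ} {rest : List ℕ} (h : c.stack = p :: rest) (j : ℕ) :
    answerNo ⟨c.q, p :: rest, j, c.X⟩ = answerNo c := by
  obtain ⟨q, st, i, X⟩ := c
  subst h
  rcases rest with - | ⟨g, rest⟩ <;> rfl

theorem answerYes_congr {c : Cfg} {p : ℕ} {rest : List ℕ} (h : c.stack = p :: rest) (j : ℕ) :
    answerYes ⟨c.q, p :: rest, j, c.X⟩ = answerYes c := by
  obtain ⟨q, st, i, X⟩ := c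
  subst h
  rcases rest with - | ⟨g, - | ⟨g', rest⟩⟩ <;> rfl

variable {V : Type*} (G : SimpleGraph V) (x : ℕ → V)

open Classical in
/-- One step of the stack machine on the sequence `x`; it rests once `q` has reached `e`. -/
noncomputable def scanStep (e : ℕ) (c : Cfg) : Cfg :=
  if c.q < e then
    match c.stack with
    | [] => c
    | p :: rest =>
      if x p = x c.j then answerYes c
      else if G.Adj (x p) (x c.j) then ⟨c.q, c.j :: p :: rest, 0, c.X⟩
      else ⟨c.q, p :: rest, c.j + 1, c.X⟩
  else c

theorem scanStep_iterate_of_le {e : ℕ} {c : Cfg} (h : e ≤ c.q) (t : ℕ) :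
    (scanStep G x e)^[t] c = c := by
  induction t with
  | zero => rfl
  | succ t ih => rw [Function.iterate_succ_apply, scanStep, if_neg (by omega), ih]

variable [Fintype V]

theorem stateAt_of_notMem_alive {v : V} {j m : ℕ} (hjm : j ≤ m)
    (h : v ∉ alive G (stateAt G x j).1) :
    v ∉ alive G (stateAt G x m).1 ∧ (stateAt G x m).2 v = (stateAt G x j).2 v ∧
      (v ∈ (stateAt G x m).1 ↔ v ∈ (stateAt G x j).1) := by
  classical
  induction m, hjm using Nat.le_induction with
  | base => exact ⟨h, rfl, Iff.rfl⟩
  | succ m _ ih =>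
    obtain ⟨h1, h2, h3⟩ := ih
    refine ⟨fun h' => h1 (alive_greedyStep_subset G _ _ h'), ?_, ?_⟩
    · simp [stateAt, costStep, h1, h2]
    · rw [← h3]
      change v ∈ greedyStep G _ _ ↔ _
      by_cases hx : x m ∈ alive G (stateAt G x m).1
      · rw [greedyStep_of_mem G hx, Finset.mem_insert, or_iff_right]
        rintro rfl
        exact h1 hx
      · rw [greedyStep_of_notMem G hx]

theorem stateAt_independent (j : ℕ) :
    ∀ u ∈ (stateAt G x j).1, ∀ v ∈ (stateAt G x j).1, ¬ G.Adj u v := by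
  rw [stateAt_fst_eq_foldl]
  exact foldl_greedyStep_independent G _ ∅ (by simp)

theorem stateAt_mono {j m : ℕ} (hjm : j ≤ m) : (stateAt G x j).1 ⊆ (stateAt G x m).1 := by
  induction m, hjm using Nat.le_induction with
  | base => exact subset_rfl
  | succ m _ ih => exact ih.trans (subset_greedyStep G _ _)

theorem stateAt_succ_snd_self (p : ℕ) :
    (stateAt G x (p + 1)).2 (x p) = callCost G (stateAt G x p) (x p) := by
  simp [stateAt, costStep, callCost]

/-- The stack machine answers the innermost call correctly, in as many steps as `costStep` counts.
The call may already have scanned the positions below `c.j`. -/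
theorem scanStep_iterate_call {e : ℕ} (p : ℕ) :
    ∀ (c : Cfg) (rest : List ℕ), c.q < e → c.stack = p :: rest → c.j ≤ p →
      x p ∈ alive G (stateAt G x c.j).1 →
      ∃ D, (stateAt G x c.j).2 (x p) + D = (stateAt G x (p + 1)).2 (x p) ∧
        (x p ∈ (stateAt G x (p + 1)).1 → (scanStep G x e)^[D] c = answerYes c) ∧
        (x p ∉ (stateAt G x (p + 1)).1 → (scanStep G x e)^[D] c = answerNo c) := by
  classical
  induction p using Nat.strong_induction_on with
  | _ p ihp =>
  intro c rest hq hst hj hal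
  obtain ⟨k, hk⟩ := Nat.exists_eq_add_of_le hj
  induction k using Nat.strong_induction_on generalizing c with
  | _ k ihk =>
  by_cases hx : x p = x c.j
  · -- The scan meets the vertex itself while it is undetermined: it is chosen here.
    have hmem : x p ∈ (stateAt G x (c.j + 1)).1 := by
      change x p ∈ greedyStep G _ _
      rw [← hx, greedyStep_of_mem G hal]
      exact Finset.mem_insert_self _ _
    have hna : x p ∉ alive G (stateAt G x (c.j + 1)).1 := fun h => ((mem_alive G).1 h).1 hmem
    obtain ⟨-, h2, h3⟩ := stateAt_of_notMem_alive G x (m := p + 1) (by omega) hna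
    refine ⟨1, ?_, fun _ => ?_, fun h => absurd (h3.2 hmem) h⟩
    · rw [h2]
      rw [hx] at hal ⊢
      simp [stateAt, costStep, hal]
    · rw [Function.iterate_one, scanStep, if_pos hq, hst]
      simp only [hx, if_true]
  · have hjp : c.j < p := lt_of_le_of_ne hj fun h => hx (by rw [h])
    by_cases ha : G.Adj (x p) (x c.j)
    · obtain ⟨D₁, hD₁, hy, hn⟩ := ihp c.j hjp ⟨c.q, c.j :: p :: rest, 0, c.X⟩ (p :: rest) hq rfl
        (Nat.zero_le _) (by simp [mem_alive, stateAt])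
      have hpush : scanStep G x e c = ⟨c.q, c.j :: p :: rest, 0, c.X⟩ := by
        rw [scanStep, if_pos hq, hst]
        simp only [hx, ha, if_true, if_false]
      have hcost : (stateAt G x (c.j + 1)).2 (x p) = (stateAt G x c.j).2 (x p) + (1 + D₁) := by
        rw [stateAt_succ_snd_self] at hD₁
        have : D₁ = callCost G (stateAt G x c.j) (x c.j) := by
          rw [← hD₁]; simp [stateAt]
        rw [this]
        simp [stateAt, costStep, hal, ha.symm]
      by_cases hm : x c.j ∈ (stateAt G x (c.j + 1)).1
      · -- The neighbour is chosen, which determines the caller.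
        have hna : x p ∉ alive G (stateAt G x (c.j + 1)).1 :=
          fun h => ((mem_alive G).1 h).2 _ hm ha.symm
        have hnI : x p ∉ (stateAt G x (c.j + 1)).1 :=
          fun h => stateAt_independent G x _ _ h _ hm ha
        obtain ⟨-, h2, h3⟩ := stateAt_of_notMem_alive G x (m := p + 1) (by omega) hna
        refine ⟨1 + D₁, ?_, fun h => absurd (h3.1 h) hnI, fun _ => ?_⟩
        · rw [h2, hcost]
        · rw [add_comm, Function.iterate_succ_apply, hpush, hy hm, answerYes]
          exact answerNo_congr hst _
      · have hnx : x c.j ∉ alive G (stateAt G x c.j).1 := by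
          intro h
          apply hm
          change _ ∈ greedyStep G _ _
          rw [greedyStep_of_mem G h]
          exact Finset.mem_insert_self _ _
        have hal' : x p ∈ alive G (stateAt G x (c.j + 1)).1 :=
          (mem_alive_greedyStep G).2 ⟨hal, fun h => absurd h hnx⟩
        obtain ⟨D₂, hD₂, hy₂, hn₂⟩ := ihk (k - 1) (by omega) ⟨c.q, p :: rest, c.j + 1, c.X⟩ hq rfl
          hjp hal' (by simp only; omega)
        have hit : ∀ D, (scanStep G x e)^[1 + D₁ + D] c =
            (scanStep G x e)^[D] ⟨c.q, p :: rest, c.j + 1, c.X⟩ := by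
          intro D
          rw [add_comm, Function.iterate_add_apply, add_comm 1, Function.iterate_succ_apply, hpush,
            hn hm]
          rfl
        refine ⟨1 + D₁ + D₂, ?_, fun h => ?_, fun h => ?_⟩
        · simp only at hD₂; omega
        · rw [hit, hy₂ h, answerYes_congr hst]
        · rw [hit, hn₂ h, answerNo_congr hst]
    · have hal' : x p ∈ alive G (stateAt G x (c.j + 1)).1 :=
        (mem_alive_greedyStep G).2 ⟨hal, fun _ => ⟨hx, fun h => ha h.symm⟩⟩
      obtain ⟨D₂, hD₂, hy₂, hn₂⟩ := ihk (k - 1) (by omega) ⟨c.q, p :: rest, c.j + 1, c.X⟩ hq rfl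
        hjp hal' (by simp only; omega)
      have hnext : scanStep G x e c = ⟨c.q, p :: rest, c.j + 1, c.X⟩ := by
        rw [scanStep, if_pos hq, hst]
        simp only [hx, ha, if_false]
      have hcost : (stateAt G x (c.j + 1)).2 (x p) = (stateAt G x c.j).2 (x p) + 1 := by
        simp [stateAt, costStep, hal, G.adj_comm (x c.j), ha]
      refine ⟨D₂ + 1, ?_, fun h => ?_, fun h => ?_⟩
      · simp only at hD₂; omega
      · rw [Function.iterate_succ_apply, hnext, hy₂ h, answerYes_congr hst]
      · rw [Function.iterate_succ_apply, hnext, hn₂ h, answerNo_congr hst]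

/-- The stack machine counts the hits, provided that the first `L` vertices determine all others. -/
theorem scanStep_iterate_rowCost {L W : ℕ} (hLW : L ≤ W) (h : alive G (stateAt G x L).1 = ∅) :
    (scanStep G x W)^[rowCost G L W x] ⟨L, [L], 0, 0⟩ = ⟨W, [W], 0, hits G L W x⟩ := by
  classical
  suffices ∀ q, L ≤ q → q ≤ W →
      (scanStep G x W)^[rowCost G L q x] ⟨L, [L], 0, 0⟩ = ⟨q, [q], 0, hits G L q x⟩ from
    this W hLW le_rfl
  intro q hq
  induction q, hq using Nat.le_induction with
  | base => intro _; simp [rowCost, hits]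
  | succ q hLq ih =>
    intro hqW
    have hiff : x q ∈ (stateAt G x (q + 1)).1 ↔ x q ∈ (stateAt G x L).1 :=
      (stateAt_of_notMem_alive G x (by omega) (by simp [h])).2.2
    obtain ⟨D, hD, hy, hn⟩ := scanStep_iterate_call G x (e := W) q ⟨q, [q], 0, hits G L q x⟩ []
      (by simp only; omega) rfl (Nat.zero_le _) (by simp [mem_alive, stateAt])
    rw [stateAt_succ_snd_self] at hD
    have hD' : D = callCost G (stateAt G x q) (x q) := by rw [← hD]; simp [stateAt]
    have hI : Finset.Ico L (q + 1) = insert q (Finset.Ico L q) := by ext; simp; omega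
    rw [rowCost, hI, Finset.sum_insert (by simp), ← hD', Function.iterate_add_apply]
    rw [rowCost] at ih
    rw [ih (by omega)]
    by_cases hm : x q ∈ (stateAt G x L).1
    · rw [hy (hiff.2 hm), answerYes, hits, hits, hI, Finset.filter_insert, if_pos hm,
        Finset.card_insert_of_notMem (by simp)]
    · rw [hn fun h' => hm (hiff.1 h'), answerNo, hits, hits, hI, Finset.filter_insert, if_neg hm]

end Scan

/-! ### Deterministic executions -/

section Logic

variable {M : ℕ → ℕ → ℕ} {N : ℕ}

/-- From memory `m`, the program `p` halts with memory `m'` after time at most `c`, without making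
random choices. -/
def Prog.Ends (M : ℕ → ℕ → ℕ) (N : ℕ) (p : Prog) (m : ℕ → ℕ) (c : ℕ) (m' : ℕ → ℕ) : Prop :=
  ∀ t, ∃ t' ≤ t + c, p.exec M N ⟨m, t⟩ = PMF.pure (some ⟨m', t'⟩)

theorem andThen_pure_some (s : State) (f : State → PMF (Option State)) :
    andThen (PMF.pure (some s)) f = f s := by
  rw [andThen, PMF.pure_bind]

theorem Prog.Ends.mono {p : Prog} {m m' : ℕ → ℕ} {c c' : ℕ} (h : p.Ends M N m c m')
    (hc : c ≤ c') : p.Ends M N m c' m' := fun t => by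
  obtain ⟨t', ht, h⟩ := h t
  exact ⟨t', by omega, h⟩

theorem Prog.Ends.seq {p q : Prog} {m m₁ m₂ : ℕ → ℕ} {c₁ c₂ : ℕ} (h₁ : p.Ends M N m c₁ m₁)
    (h₂ : q.Ends M N m₁ c₂ m₂) : (Prog.seq p q).Ends M N m (c₁ + c₂) m₂ := fun t => by
  obtain ⟨t₁, ht₁, h₁⟩ := h₁ t
  obtain ⟨t₂, ht₂, h₂⟩ := h₂ t₁
  refine ⟨t₂, by omega, ?_⟩
  rw [Prog.exec, h₁, andThen_pure_some, h₂]

theorem Prog.Ends.ite_pos {e : Expr} {p q : Prog} {m m' : ℕ → ℕ} {c : ℕ} (he : e.val m ≠ 0)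
    (h : p.Ends M N m c m') : (Prog.ite e p q).Ends M N m (1 + e.cost m + c) m' := fun t => by
  obtain ⟨t', ht, h⟩ := h (t + (1 + e.cost m))
  refine ⟨t', by omega, ?_⟩
  rw [Prog.exec, if_neg he]
  exact h

theorem Prog.Ends.ite_neg {e : Expr} {p q : Prog} {m m' : ℕ → ℕ} {c : ℕ} (he : e.val m = 0)
    (h : q.Ends M N m c m') : (Prog.ite e p q).Ends M N m (1 + e.cost m + c) m' := fun t => by
  obtain ⟨t', ht, h⟩ := h (t + (1 + e.cost m))
  refine ⟨t', by omega, ?_⟩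
  rw [Prog.exec, if_pos he]
  exact h

/-- A while loop with an invariant and a decreasing measure. -/
theorem Prog.ends_loop {e : Expr} {p : Prog} {c c' : ℕ} (Inv : (ℕ → ℕ) → Prop)
    (μ : (ℕ → ℕ) → ℕ)
    (hstep : ∀ m, Inv m → e.val m ≠ 0 → ∃ m', p.Ends M N m c m' ∧ Inv m' ∧ μ m' < μ m)
    (hcost : ∀ m, Inv m → 1 + e.cost m ≤ c') (m : ℕ → ℕ) (hm : Inv m) (hN : μ m < N) :
    ∃ m', (Prog.loop e p).Ends M N m ((μ m + 1) * (c + c')) m' ∧ Inv m' ∧ e.val m' = 0 := by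
  suffices ∀ (B K : ℕ) (m : ℕ → ℕ), Inv m → μ m ≤ B → B < K →
      ∃ m', Inv m' ∧ e.val m' = 0 ∧ ∀ t, ∃ t' ≤ t + (B + 1) * (c + c'),
        whileLoop e (p.exec M N) K ⟨m, t⟩ = PMF.pure (some ⟨m', t'⟩) by
    obtain ⟨m', h1, h2, h3⟩ := this (μ m) N m hm le_rfl hN
    exact ⟨m', h3, h1, h2⟩
  intro B
  induction B with
  | zero =>
    intro K m hm hB hK
    obtain ⟨K, rfl⟩ : ∃ k, K = k + 1 := ⟨K - 1, by omega⟩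
    by_cases he : e.val m = 0
    · refine ⟨m, hm, he, fun t => ⟨t + (1 + e.cost m), ?_, by rw [whileLoop, if_pos he]; rfl⟩⟩
      have := hcost m hm
      omega
    · obtain ⟨m', -, -, h⟩ := hstep m hm he
      omega
  | succ B ih =>
    intro K m hm hB hK
    obtain ⟨K, rfl⟩ : ∃ k, K = k + 1 := ⟨K - 1, by omega⟩
    by_cases he : e.val m = 0
    · refine ⟨m, hm, he, fun t => ⟨t + (1 + e.cost m), ?_, by rw [whileLoop, if_pos he]; rfl⟩⟩
      have := hcost m hm
      nlinarith
    · obtain ⟨m₁, h1, h2, h3⟩ := hstep m hm he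
      obtain ⟨m', h4, h5, h6⟩ := ih K m₁ h2 (by omega) (by omega)
      refine ⟨m', h4, h5, fun t => ?_⟩
      obtain ⟨t₁, ht₁, h7⟩ := h1 (t + (1 + e.cost m))
      obtain ⟨t', ht', h8⟩ := h6 t₁
      refine ⟨t', ?_, ?_⟩
      · have := hcost m hm
        nlinarith
      · rw [whileLoop, if_neg he]
        change andThen (p.exec M N ⟨m, t + (1 + e.cost m)⟩) _ = _
        rw [h7, andThen_pure_some, h8]

/-! ### The cost of straight-line programs -/

/-- If all cells of the memory have bit length at most `w`, then the bit length of the value of `e`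
is at most `w * e.width`. -/
def Expr.width : Expr → ℕ
  | .const k => Nat.size k
  | .mem _ => 1
  | .add a b => a.width + b.width
  | .sub a _ => a.width
  | .mul a b => a.width + b.width
  | .div a _ => a.width

/-- If all cells of the memory have bit length at most `w`, then `e` is evaluated in time at most
`w * e.weight`. -/
def Expr.weight : Expr → ℕ
  | .const k => 1 + Nat.size k
  | .mem a => a.weight + 2
  | .add a b => a.weight + b.weight + (1 + (a.width + b.width))
  | .sub a b => a.weight + b.weight + (1 + a.width)
  | .mul a b => a.weight + b.weight + (1 + (a.width + b.width))
  | .div a b => a.weight + b.weight + (1 + a.width)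

theorem size_add_le (a b : ℕ) : Nat.size (a + b) ≤ Nat.size a + Nat.size b := by
  rw [Nat.size_le, pow_add]
  have ha := Nat.lt_size_self a
  have hb := Nat.lt_size_self b
  nlinarith

theorem size_mul_le (a b : ℕ) : Nat.size (a * b) ≤ Nat.size a + Nat.size b := by
  rw [Nat.size_le, pow_add]
  exact Nat.mul_lt_mul'' (Nat.lt_size_self a) (Nat.lt_size_self b)

theorem Expr.size_val_le {m : ℕ → ℕ} {w : ℕ} (hw : 1 ≤ w) (hm : ∀ a, Nat.size (m a) ≤ w)
    (e : Expr) : Nat.size (e.val m) ≤ w * e.width := by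
  induction e with
  | const k => exact Nat.le_mul_of_pos_left _ hw
  | mem a _ => simpa [Expr.val, Expr.width] using hm _
  | add a b iha ihb => rw [Expr.width, mul_add]; exact (size_add_le _ _).trans (by omega)
  | sub a b iha ihb => exact (Nat.size_le_size (Nat.sub_le _ _)).trans iha
  | mul a b iha ihb => rw [Expr.width, mul_add]; exact (size_mul_le _ _).trans (by omega)
  | div a b iha ihb => exact (Nat.size_le_size (Nat.div_le_self _ _)).trans iha

theorem Expr.cost_le {m : ℕ → ℕ} {w : ℕ} (hw : 1 ≤ w) (hm : ∀ a, Nat.size (m a) ≤ w)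
    (e : Expr) : e.cost m ≤ w * e.weight := by
  induction e with
  | const k => exact Nat.le_mul_of_pos_left _ hw
  | mem a ih =>
    have := hm (a.val m)
    rw [Expr.cost, Expr.weight, mul_add]; omega
  | add a b iha ihb =>
    have := Expr.size_val_le hw hm (.add a b)
    simp only [Expr.cost, Expr.weight, Expr.val, Expr.width, mul_add, mul_one] at *; omega
  | sub a b iha ihb =>
    have := Expr.size_val_le hw hm (.sub a b)
    simp only [Expr.cost, Expr.weight, Expr.val, Expr.width, mul_add, mul_one] at *; omega
  | mul a b iha ihb =>
    have := Expr.size_val_le hw hm (.mul a b)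
    simp only [Expr.cost, Expr.weight, Expr.val, Expr.width, mul_add, mul_one] at *; omega
  | div a b iha ihb =>
    have := Expr.size_val_le hw hm (.div a b)
    simp only [Expr.cost, Expr.weight, Expr.val, Expr.width, mul_add, mul_one] at *; omega

/-- Programs without loops and random choices. -/
def Prog.IsBasic : Prog → Prop
  | .skip => True
  | .assign _ _ => True
  | .query _ _ _ => True
  | .rand _ _ => False
  | .seq p q => p.IsBasic ∧ q.IsBasic
  | .ite _ p q => p.IsBasic ∧ q.IsBasic
  | .loop _ _ => False

/-- The effect of a program without loops and random choices on the memory (and a default value for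
other programs). -/
def Prog.eff (M : ℕ → ℕ → ℕ) : Prog → (ℕ → ℕ) → ℕ → ℕ
  | .skip, m => m
  | .assign a e, m => Function.update m (a.val m) (e.val m)
  | .query a u v, m => Function.update m (a.val m) (M (u.val m) (v.val m))
  | .rand _ _, m => m
  | .seq p q, m => q.eff M (p.eff M m)
  | .ite e p q, m => if e.val m = 0 then q.eff M m else p.eff M m
  | .loop _ _, m => m

/-- The factor by which a program without loops can increase the bit lengths of the cells. -/
def Prog.growth : Prog → ℕ
  | .assign _ e => 1 + e.width
  | .seq p q => p.growth * q.growth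
  | .ite _ p q => p.growth + q.growth
  | _ => 1

/-- If all cells of the memory have bit length at most `w`, then a program `p` without loops and
random choices takes time at most `w * p.weight`. -/
def Prog.weight : Prog → ℕ
  | .skip => 1
  | .assign a e => 1 + a.weight + e.weight
  | .query a u v => 1 + a.weight + u.weight + v.weight
  | .seq p q => p.weight + p.growth * q.weight
  | .ite e p q => 1 + e.weight + (p.weight + q.weight)
  | _ => 1

theorem Prog.one_le_growth (p : Prog) : 1 ≤ p.growth := by
  induction p with
  | seq p q hp hq => exact Nat.mul_le_mul hp hq
  | ite e p q hp hq => exact hp.trans (Nat.le_add_right _ _)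
  | assign a e => exact Nat.le_add_right _ _
  | _ => exact le_rfl

theorem Prog.ends_eff_and_size_le (hM : ∀ u v, M u v ≤ 1) {p : Prog} (hp : p.IsBasic)
    {m : ℕ → ℕ} {w : ℕ} (hw : 1 ≤ w) (hm : ∀ a, Nat.size (m a) ≤ w) :
    p.Ends M N m (w * p.weight) (p.eff M m) ∧ ∀ a, Nat.size (p.eff M m a) ≤ w * p.growth := by
  induction p generalizing m w with
  | skip =>
    refine ⟨fun t => ⟨t + 1, ?_, rfl⟩, by simpa [Prog.eff, Prog.growth] using hm⟩
    simpa [Prog.weight] using hw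
  | assign a e =>
    refine ⟨fun t => ⟨t + (1 + a.cost m + e.cost m), ?_, rfl⟩, fun b => ?_⟩
    · have h1 := a.cost_le hw hm
      have h2 := e.cost_le hw hm
      simp only [Prog.weight, mul_add, mul_one]; omega
    · have h1 := e.size_val_le hw hm
      have h2 := hm b
      simp only [Prog.eff, Prog.growth, mul_add, mul_one, Function.update_apply]
      split_ifs <;> omega
  | query a u v =>
    refine ⟨fun t => ⟨t + (1 + a.cost m + u.cost m + v.cost m), ?_, rfl⟩, fun b => ?_⟩
    · have h1 := a.cost_le hw hm
      have h2 := u.cost_le hw hm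
      have h3 := v.cost_le hw hm
      simp only [Prog.weight, mul_add, mul_one]; omega
    · have h2 := hm b
      have h3 : Nat.size (M (u.val m) (v.val m)) ≤ 1 := Nat.size_le_size (hM _ _)
      simp only [Prog.eff, Prog.growth, mul_one, Function.update_apply]
      split_ifs <;> omega
  | rand a e => exact hp.elim
  | seq p q ihp ihq =>
    obtain ⟨h1, h2⟩ := ihp hp.1 hw hm
    obtain ⟨h3, h4⟩ := ihq hp.2 (Nat.mul_le_mul hw p.one_le_growth) h2
    refine ⟨(h1.seq h3).mono (le_of_eq ?_), fun a => (h4 a).trans (le_of_eq ?_)⟩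
    · rw [Prog.weight]; ring
    · rw [Prog.growth]; ring
  | ite e p q ihp ihq =>
    have hc := e.cost_le hw hm
    obtain ⟨h1, h2⟩ := ihp hp.1 hw hm
    obtain ⟨h3, h4⟩ := ihq hp.2 hw hm
    by_cases he : e.val m = 0
    · simp only [Prog.eff, if_pos he, Prog.weight, Prog.growth, mul_add]
      exact ⟨(Prog.Ends.ite_neg he h3).mono (by omega), fun a => (h4 a).trans (by omega)⟩
    · simp only [Prog.eff, if_neg he, Prog.weight, Prog.growth, mul_add]
      exact ⟨(Prog.Ends.ite_pos he h1).mono (by omega), fun a => (h2 a).trans (by omega)⟩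
  | loop e p => exact hp.elim

theorem Prog.ends_eff (hM : ∀ u v, M u v ≤ 1) {p : Prog} (hp : p.IsBasic)
    {m : ℕ → ℕ} {w : ℕ} (hw : 1 ≤ w) (hm : ∀ a, Nat.size (m a) ≤ w) :
    p.Ends M N m (w * p.weight) (p.eff M m) :=
  (Prog.ends_eff_and_size_le hM hp hw hm).1

end Logic

/-! ### Drawing the random tape -/

section Draw

variable {n : ℕ} [NeZero n]

/-- The distribution of a list of `d` independent uniform elements of `Fin n`. -/
noncomputable def draw (n : ℕ) [NeZero n] : ℕ → PMF (List (Fin n))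
  | 0 => PMF.pure []
  | d + 1 => (PMF.uniformOfFintype (Fin n)).bind fun x => (draw n d).map (x :: ·)

theorem length_of_mem_support_draw {d : ℕ} {l : List (Fin n)} (h : l ∈ (draw n d).support) :
    l.length = d := by
  induction d generalizing l with
  | zero => simp [draw] at h; simp [h]
  | succ d ih =>
    simp only [draw, PMF.mem_support_bind_iff, PMF.mem_support_map_iff] at h
    obtain ⟨x, -, l', hl', rfl⟩ := h
    simp [ih hl']

theorem toOuterMeasure_draw (d : ℕ) (p : List (Fin n) → Prop) :
    (draw n d).toOuterMeasure {l | p l} = ENNReal.ofReal (prob d p) := by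
  classical
  induction d generalizing p with
  | zero =>
    rw [draw, PMF.toOuterMeasure_pure_apply]
    by_cases h : p [] <;> simp [prob, avg, h]
  | succ d ih =>
    rw [draw, PMF.toOuterMeasure_bind_apply, tsum_fintype]
    simp only [PMF.uniformOfFintype_apply, PMF.toOuterMeasure_map_apply, Set.preimage_ofPred_eq, ih]
    rw [← Finset.mul_sum, ← ENNReal.ofReal_sum_of_nonneg fun x _ => prob_nonneg _ _]
    have hn : (0 : ℝ) < Fintype.card (Fin n) := by exact_mod_cast Fintype.card_pos
    conv_rhs => rw [prob, avg]
    rw [ENNReal.ofReal_mul (by positivity), ENNReal.ofReal_inv_of_pos hn, ENNReal.ofReal_natCast]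
    rfl

theorem uniformOfFinset_range_eq_map (h : (Finset.range n).Nonempty) :
    PMF.uniformOfFinset (Finset.range n) h = (PMF.uniformOfFintype (Fin n)).map Fin.val := by
  ext a
  rw [PMF.uniformOfFinset_apply, PMF.map_apply, tsum_fintype]
  by_cases ha : a < n
  · rw [Finset.sum_eq_single (⟨a, ha⟩ : Fin n)]
    · simp [ha]
    · intro b _ hb
      exact if_neg fun hab => hb (Fin.ext hab.symm)
    · simp
  · rw [if_neg (by simpa using ha), Finset.sum_eq_zero]
    intro b _
    exact if_neg fun hab : a = b => ha (by rw [hab]; exact b.2)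

/-- Fill the tape cells `30 + 3 i, 30 + 3 (i + 1), …` with the elements of a list. Cell `11` holds
the number of the next tape cell. -/
def fillTape (m : ℕ → ℕ) (i : ℕ) : List (Fin n) → ℕ → ℕ
  | [] => m
  | x :: l => fillTape (Function.update (Function.update m (30 + 3 * i) x) 11 (i + 1)) (i + 1) l

theorem fillTape_apply_of_forall_ne {n : ℕ} (l : List (Fin n)) (m : ℕ → ℕ) (i a : ℕ) (h11 : a ≠ 11)
    (ha : ∀ j, i ≤ j → j < i + l.length → a ≠ 30 + 3 * j) : fillTape m i l a = m a := by
  induction l generalizing m i with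
  | nil => rfl
  | cons x l ih =>
    rw [fillTape, ih, Function.update_of_ne h11, Function.update_of_ne (ha i le_rfl (by simp))]
    intro j h1 h2
    exact ha j (by omega) (by simp; omega)

theorem fillTape_apply (l : List (Fin n)) (m : ℕ → ℕ) (i j : ℕ) (hj : j < l.length) :
    fillTape m i l (30 + 3 * (i + j)) = l.getD j 0 := by
  induction l generalizing m i j with
  | nil => simp at hj
  | cons x l ih =>
    rcases j with - | j
    · rw [fillTape, fillTape_apply_of_forall_ne _ _ _ _ (by omega) (by omega)]
      simp [show 30 + 3 * i ≠ 11 by omega]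
    · rw [fillTape, show i + (j + 1) = i + 1 + j by ring, ih _ _ _ (by simpa using hj)]
      simp

/-- Draw tape cells until the counter in cell `11` reaches the content of cell `10`. Cell `1` holds
the number of vertices. -/
def drawLoop : Prog :=
  .loop (.sub (.mem (.const 10)) (.mem (.const 11)))
    (.seq (.rand (.add (.const 30) (.mul (.const 3) (.mem (.const 11))))
        (.sub (.mem (.const 1)) (.const 1)))
      (.assign (.const 11) (.add (.mem (.const 11)) (.const 1))))

theorem exec_whileLoop_draw (M : ℕ → ℕ → ℕ) (N w : ℕ) (hw : 1 ≤ w) (d : ℕ) :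
    ∀ (K : ℕ) (m : ℕ → ℕ) (t : ℕ), d < K → (∀ a, Nat.size (m a) ≤ w) → m 1 = n →
      m 10 = m 11 + d → ∃ F : List (Fin n) → State,
        whileLoop (.sub (.mem (.const 10)) (.mem (.const 11)))
          (Prog.exec M N (.seq (.rand (.add (.const 30) (.mul (.const 3) (.mem (.const 11))))
              (.sub (.mem (.const 1)) (.const 1)))
            (.assign (.const 11) (.add (.mem (.const 11)) (.const 1))))) K ⟨m, t⟩ =
          (draw n d).map (fun l => some (F l)) ∧
        ∀ l, l.length = d → (F l).mem = fillTape m (m 11) l ∧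
          (F l).time ≤ t + (d + 1) * (w * 100) := by
  induction d with
  | zero =>
    intro K m t hK hm h1 h10
    obtain ⟨K, rfl⟩ : ∃ k, K = k + 1 := ⟨K - 1, by omega⟩
    refine ⟨fun _ => State.tick ⟨m, t⟩
      (1 + (Expr.sub (.mem (.const 10)) (.mem (.const 11))).cost m), ?_, ?_⟩
    · rw [whileLoop, if_pos (by simp [Expr.val]; omega), draw, PMF.pure_map]
    · intro l hl
      rw [List.length_eq_zero_iff.1 hl]
      refine ⟨rfl, ?_⟩
      have hc := (Expr.sub (.mem (.const 10)) (.mem (.const 11))).cost_le hw hm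
      rw [show (Expr.sub (.mem (.const 10)) (.mem (.const 11))).weight = 16 by decide] at hc
      simp only [State.tick]
      omega
  | succ d ih =>
    intro K m t hK hm h1 h10
    obtain ⟨K, rfl⟩ : ∃ k, K = k + 1 := ⟨K - 1, by omega⟩
    have hn : 0 < n := NeZero.pos n
    set e₁ : Expr := .sub (.mem (.const 10)) (.mem (.const 11)) with he₁
    set e₂ : Expr := .add (.const 30) (.mul (.const 3) (.mem (.const 11))) with he₂
    set e₃ : Expr := .sub (.mem (.const 1)) (.const 1) with he₃
    set e₄ : Expr := .add (.mem (.const 11)) (.const 1) with he₄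
    have hc₁ := e₁.cost_le hw hm
    have hc₂ := e₂.cost_le hw hm
    have hc₃ := e₃.cost_le hw hm
    have hm' : ∀ (x : Fin n) a,
        Nat.size (Function.update m (30 + 3 * m 11) (x : ℕ) a) ≤ w := by
      intro x a
      rw [Function.update_apply]
      split_ifs
      · exact (Nat.size_le_size (x.2.le.trans_eq h1.symm)).trans (hm 1)
      · exact hm a
    have hm'' : ∀ (x : Fin n) a, Nat.size (Function.update
        (Function.update m (30 + 3 * m 11) (x : ℕ)) 11 (m 11 + 1) a) ≤ w := by
      intro x a
      rw [Function.update_apply]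
      split_ifs
      · exact (Nat.size_le_size (by omega : m 11 + 1 ≤ m 10)).trans (hm 10)
      · exact hm' x a
    have hF := fun x : Fin n => ih K (Function.update
        (Function.update m (30 + 3 * m 11) (x : ℕ)) 11 (m 11 + 1))
        (t + (1 + e₁.cost m) + (1 + e₂.cost m + e₃.cost m) + (1 + (Expr.const 11).cost
          (Function.update m (30 + 3 * m 11) (x : ℕ)) +
          e₄.cost (Function.update m (30 + 3 * m 11) (x : ℕ)))) (by omega) (hm'' x)
        (by
          rw [Function.update_of_ne (by norm_num), Function.update_of_ne (by omega), h1])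
        (by
          rw [Function.update_of_ne (by norm_num), Function.update_of_ne (by omega),
            Function.update_self]
          omega)
    choose F hF1 hF2 using hF
    refine ⟨fun l => match l with
      | [] => ⟨m, 0⟩
      | x :: l => F x l, ?_, ?_⟩
    · rw [whileLoop, if_neg (by simp [he₁, Expr.val]; omega), draw, PMF.map_bind]
      have hr : Prog.exec M N (.seq (.rand e₂ e₃) (.assign (.const 11) e₄))
          (State.tick ⟨m, t⟩ (1 + e₁.cost m)) =
          (PMF.uniformOfFintype (Fin n)).map fun x : Fin n => some (⟨Function.update
            (Function.update m (30 + 3 * m 11) (x : ℕ)) 11 (m 11 + 1), t + (1 + e₁.cost m) +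
            (1 + e₂.cost m + e₃.cost m) + (1 + (Expr.const 11).cost
              (Function.update m (30 + 3 * m 11) (x : ℕ)) +
              e₄.cost (Function.update m (30 + 3 * m 11) (x : ℕ)))⟩ : State) := by
        have hu := uniformOfFinset_range_eq_map (n := n) (Finset.nonempty_range_iff.2 hn.ne')
        have hval : e₃.val m + 1 = n := by simp [he₃, Expr.val, h1]; omega
        simp only [Prog.exec, State.tick, hval, hu]
        rw [andThen, PMF.map_comp, PMF.bind_map]
        rw [← PMF.bind_pure_comp]
        congr 1
        funext x
        simp only [Function.comp, State.write]
        congr 4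
        simp [he₂, he₄, Expr.val, Function.update_apply]
        intro h; omega
      rw [hr, andThen, PMF.bind_map]
      congr 1
      funext x
      rw [PMF.map_comp]
      exact hF1 x
    · intro l hl
      rcases l with - | ⟨x, l⟩
      · simp at hl
      · obtain ⟨h2, h3⟩ := hF2 x l (by simpa using hl)
        refine ⟨?_, h3.trans ?_⟩
        · simp only [h2, fillTape, Function.update_self]
        · have hc₄ := e₄.cost_le hw (hm' x)
          have hc₅ := (Expr.const 11).cost_le hw (hm' x)
          rw [show e₁.weight = 16 by decide] at hc₁
          rw [show e₂.weight = 29 by decide] at hc₂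
          rw [show e₃.weight = 8 by decide] at hc₃
          rw [show e₄.weight = 12 by decide] at hc₄
          rw [show (Expr.const 11).weight = 5 by decide] at hc₅
          nlinarith

theorem exec_drawLoop (M : ℕ → ℕ → ℕ) (N w : ℕ) (hw : 1 ≤ w) {d : ℕ} (hd : d < N) (m : ℕ → ℕ)
    (t : ℕ) (hm : ∀ a, Nat.size (m a) ≤ w) (h1 : m 1 = n) (h10 : m 10 = d) (h11 : m 11 = 0) :
    ∃ F : List (Fin n) → State,
      drawLoop.exec M N ⟨m, t⟩ = (draw n d).map (fun l => some (F l)) ∧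
      ∀ l, l.length = d → (F l).mem = fillTape m 0 l ∧ (F l).time ≤ t + (d + 1) * (w * 100) := by
  obtain ⟨F, hF⟩ := exec_whileLoop_draw M N w hw d N m t hd hm h1 (by omega)
  rw [h11] at hF
  exact ⟨F, hF⟩

end Draw

/-! ### The program: memory layout -/

/-- The address of the `i`-th tape cell. -/
def tapeAddr (i : ℕ) : ℕ := 30 + 3 * i

/-- The address of the `i`-th stack cell. -/
def stackAddr (i : ℕ) : ℕ := 31 + 3 * i

/-- The address of the `i`-th cell of the list of chosen vertices. -/
def listAddr (i : ℕ) : ℕ := 32 + 3 * i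

theorem stackAddr_eq_iff {i j : ℕ} : stackAddr i = stackAddr j ↔ i = j := by
  simp [stackAddr]

theorem listAddr_eq_iff {i j : ℕ} : listAddr i = listAddr j ↔ i = j := by
  simp [listAddr]

theorem tapeAddr_ne_stackAddr {i j : ℕ} : tapeAddr i ≠ stackAddr j := by
  simp only [tapeAddr, stackAddr]; omega

theorem tapeAddr_ne_listAddr {i j : ℕ} : tapeAddr i ≠ listAddr j := by
  simp only [tapeAddr, listAddr]; omega

theorem tapeAddr_ne {i c : ℕ} (h : c < 30) : tapeAddr i ≠ c := by
  simp only [tapeAddr]; omega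

theorem stackAddr_ne {i c : ℕ} (h : c < 30) : stackAddr i ≠ c := by
  simp only [stackAddr]; omega

theorem listAddr_ne {i c : ℕ} (h : c < 30) : listAddr i ≠ c := by
  simp only [listAddr]; omega

theorem ne_stackAddr {i c : ℕ} (h : c < 30) : c ≠ stackAddr i := (stackAddr_ne h).symm

theorem ne_listAddr {i c : ℕ} (h : c < 30) : c ≠ listAddr i := (listAddr_ne h).symm

/-- The content of the cell with constant address `i`. -/
def cell (i : ℕ) : Expr := .mem (.const i)

/-- The address of a tape cell, as an expression. -/
def tapeExpr (e : Expr) : Expr := .add (.const 30) (.mul (.const 3) e)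

/-- The address of a stack cell, as an expression. -/
def stackExpr (e : Expr) : Expr := .add (.const 31) (.mul (.const 3) e)

/-- The address of a list cell, as an expression. -/
def listExpr (e : Expr) : Expr := .add (.const 32) (.mul (.const 3) e)

/-- Increment the cell with constant address `i`. -/
def incr (i : ℕ) : Prog := .assign (.const i) (.add (cell i) (.const 1))

/-- Run a list of programs one after the other. -/
def block : List Prog → Prog
  | [] => .skip
  | p :: l => .seq p (block l)

/-- The expression that is zero if and only if `a` and `b` have the same value. -/
def distExpr (a b : Expr) : Expr := .add (.sub a b) (.sub b a)

section Val

variable (m : ℕ → ℕ)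

theorem val_cell (i : ℕ) : (cell i).val m = m i := rfl

theorem val_const (i : ℕ) : (Expr.const i).val m = i := rfl

theorem val_mem (e : Expr) : (Expr.mem e).val m = m (e.val m) := rfl

theorem val_add (a b : Expr) : (Expr.add a b).val m = a.val m + b.val m := rfl

theorem val_sub (a b : Expr) : (Expr.sub a b).val m = a.val m - b.val m := rfl

theorem val_mul (a b : Expr) : (Expr.mul a b).val m = a.val m * b.val m := rfl

theorem val_div (a b : Expr) : (Expr.div a b).val m = a.val m / b.val m := rfl

theorem val_tapeExpr (e : Expr) : (tapeExpr e).val m = tapeAddr (e.val m) := rfl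

theorem val_stackExpr (e : Expr) : (stackExpr e).val m = stackAddr (e.val m) := rfl

theorem val_listExpr (e : Expr) : (listExpr e).val m = listAddr (e.val m) := rfl

theorem val_distExpr_eq_zero (a b : Expr) :
    (distExpr a b).val m = 0 ↔ a.val m = b.val m := by
  simp only [distExpr, Expr.val]; omega

variable (M : ℕ → ℕ → ℕ)

theorem eff_assign (a e : Expr) :
    (Prog.assign a e).eff M m = Function.update m (a.val m) (e.val m) := rfl

theorem eff_query (a u v : Expr) :
    (Prog.query a u v).eff M m = Function.update m (a.val m) (M (u.val m) (v.val m)) := rfl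

theorem eff_ite (e : Expr) (p q : Prog) :
    (Prog.ite e p q).eff M m = if e.val m = 0 then q.eff M m else p.eff M m := rfl

theorem eff_incr (i : ℕ) : (incr i).eff M m = Function.update m i (m i + 1) := rfl

theorem eff_block_nil : (block []).eff M m = m := rfl

theorem eff_block_cons (p : Prog) (l : List Prog) :
    (block (p :: l)).eff M m = (block l).eff M (p.eff M m) := rfl

end Val

theorem adjOracle_val {n : ℕ} (G : SimpleGraph (Fin n)) (u v : Fin n) [Decidable (G.Adj u v)] :
    adjOracle G u v = if G.Adj u v then 1 else 0 := by
  simp [adjOracle]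

theorem adjOracle_le_one {n : ℕ} (G : SimpleGraph (Fin n)) (u v : ℕ) : adjOracle G u v ≤ 1 := by
  unfold adjOracle
  split_ifs <;> omega

/-- The facts about the memory that hold from the moment when the tape has been drawn. -/
structure Frame (n L s K w : ℕ) (τ : ℕ → Fin n) (m : ℕ → ℕ) : Prop where
  h1 : m 1 = n
  h4 : m 4 = L
  h5 : m 5 = s
  h6 : m 6 = L + s
  h8 : m 8 = K
  h9 : m 9 = 2 * s * n
  tape : ∀ i, m (tapeAddr i) = τ i
  size : ∀ a, Nat.size (m a) ≤ w

theorem Frame.of_eq {n L s K w : ℕ} {τ : ℕ → Fin n} {m m' : ℕ → ℕ} (h : Frame n L s K w τ m)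
    (h1 : ∀ a < 10, a ≠ 7 → m' a = m a) (h2 : ∀ i, m' (tapeAddr i) = m (tapeAddr i))
    (h3 : ∀ a, Nat.size (m' a) ≤ w) : Frame n L s K w τ m' where
  h1 := by rw [h1 1 (by norm_num) (by norm_num), h.h1]
  h4 := by rw [h1 4 (by norm_num) (by norm_num), h.h4]
  h5 := by rw [h1 5 (by norm_num) (by norm_num), h.h5]
  h6 := by rw [h1 6 (by norm_num) (by norm_num), h.h6]
  h8 := by rw [h1 8 (by norm_num) (by norm_num), h.h8]
  h9 := by rw [h1 9 (by norm_num) (by norm_num), h.h9]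
  tape i := by rw [h2, h.tape]
  size := h3

theorem size_update_le {m : ℕ → ℕ} {w a x : ℕ} (hm : ∀ a, Nat.size (m a) ≤ w)
    (hx : Nat.size x ≤ w) (b : ℕ) : Nat.size (Function.update m a x b) ≤ w := by
  rw [Function.update_apply]
  split_ifs
  · exact hx
  · exact hm b

/-! ### The program: greedy process on one row -/

/-- One step of the exhaustive greedy process: compare the vertex at tape position `cell 15` with
the `cell 16`-th chosen vertex, and choose it if it has been compared with all `cell 17` of them. -/
def greedyBody : Prog :=
  block [.assign (.const 19) (.mem (tapeExpr (cell 15))),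
    .ite (.sub (cell 17) (cell 16))
      (block [.assign (.const 20) (.mem (listExpr (cell 16))),
        .ite (distExpr (cell 19) (cell 20))
          (block [.query (.const 21) (cell 20) (cell 19),
            .ite (cell 21) (block [incr 15, .assign (.const 16) (.const 0)]) (incr 16)])
          (block [incr 15, .assign (.const 16) (.const 0)])])
      (block [.assign (listExpr (cell 17)) (cell 19), incr 17, incr 15,
        .assign (.const 16) (.const 0)])]

/-- Run the greedy process on the first `cell 4` tape cells after position `cell 12`, but stop when
more than `cell 8` vertices have been chosen. The number of chosen vertices is left in cell `17`. -/
def greedyLoop : Prog :=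
  .loop (.mul (.sub (cell 18) (cell 15)) (.sub (.add (cell 8) (.const 1)) (cell 17))) greedyBody

section GreedyPhase

variable {n : ℕ} (G : SimpleGraph (Fin n)) (L K w b : ℕ) (x : ℕ → Fin n) (m₀ : ℕ → ℕ)

/-- The invariant of `greedyLoop`: the first `i` vertices of the row `x` have been processed. -/
structure GreedyInv (i : ℕ) (m : ℕ → ℕ) : Prop where
  le : i ≤ L
  h15 : m 15 = b + i
  h16 : m 16 ≤ m 17
  h17 : m 17 = (stateAt G x i).1.card
  h17' : m 17 ≤ K + 1
  h18 : m 18 = b + L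
  list_mem : ∀ a < m 17, ∃ v ∈ (stateAt G x i).1, m (listAddr a) = v
  mem_list : ∀ v ∈ (stateAt G x i).1, ∃ a < m 17, m (listAddr a) = v
  compared : ∀ a < m 16, ∀ v : Fin n, m (listAddr a) = v → v ≠ x i ∧ ¬ G.Adj v (x i)
  low : ∀ a < 15, m a = m₀ a
  tape : ∀ j, m (tapeAddr j) = m₀ (tapeAddr j)
  size : ∀ a, Nat.size (m a) ≤ w

variable {G L K w b x m₀}

theorem GreedyInv.step {Z : ℕ} (hZ : Nat.size Z ≤ w) (hL : b + L ≤ Z) (hK : K + 1 ≤ Z)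
    (hn : n ≤ Z) (h1 : 1 ≤ Z)
    (h8 : m₀ 8 = K) (htape : ∀ j, m₀ (tapeAddr (b + j)) = x j) {i : ℕ} {m : ℕ → ℕ}
    (h : GreedyInv G L K w b x m₀ i m) (hi : i < L) (hμ : m 17 ≤ K) :
    ∃ i', GreedyInv G L K w b x m₀ i' (greedyBody.eff (adjOracle G) m) ∧
      (m 18 - (greedyBody.eff (adjOracle G) m) 15) * (K + 2) -
        (greedyBody.eff (adjOracle G) m) 16 < (m 18 - m 15) * (K + 2) - m 16 := by
  classical
  have hsz : ∀ z ≤ Z, Nat.size z ≤ w := fun z hz => (Nat.size_le_size hz).trans hZ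
  have hu : m (tapeAddr (m 15)) = x i := by rw [h.h15, h.tape, htape]
  have hmeas : ∀ t, (m 18 - (b + i + 1)) * (K + 2) - t < (m 18 - m 15) * (K + 2) - m 16 := by
    intro t
    rw [h.h15, h.h18]
    obtain ⟨d, rfl⟩ := Nat.exists_eq_add_of_lt hi
    have := h.h16
    rw [show b + (i + d + 1) - (b + i + 1) = d by omega,
      show b + (i + d + 1) - (b + i) = d + 1 by omega, add_mul]
    omega
  -- The state after a vertex that is not chosen.
  have hskip : ∀ m' : ℕ → ℕ, x i ∉ alive G (stateAt G x i).1 → m' 15 = b + i + 1 → m' 16 = 0 →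
      m' 17 = m 17 → m' 18 = m 18 → (∀ a, m' (listAddr a) = m (listAddr a)) →
      (∀ a < 15, m' a = m a) → (∀ j, m' (tapeAddr j) = m (tapeAddr j)) →
      (∀ a, Nat.size (m' a) ≤ w) → GreedyInv G L K w b x m₀ (i + 1) m' := by
    intro m' hna e15 e16 e17 e18 elist elow etape esize
    have hI : (stateAt G x (i + 1)).1 = (stateAt G x i).1 := greedyStep_of_notMem G hna
    exact ⟨hi, by rw [e15, add_assoc], by omega, by rw [e17, hI, h.h17], by rw [e17]; exact h.h17',
      by rw [e18, h.h18], by rw [e17, hI]; simpa only [elist] using h.list_mem,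
      by rw [e17, hI]; simpa only [elist] using h.mem_list, by rw [e16]; omega,
      fun a ha => by rw [elow a ha, h.low a ha], fun j => by rw [etape, h.tape], esize⟩
  by_cases ht : m 17 - m 16 = 0
  · -- All chosen vertices have been compared: the vertex is chosen.
    have heff : greedyBody.eff (adjOracle G) m = Function.update (Function.update (Function.update
        (Function.update (Function.update m 19 (x i)) (listAddr (m 17)) (x i)) 17 (m 17 + 1))
          15 (b + i + 1)) 16 0 := by
      simp only [greedyBody, eff_block_cons, eff_block_nil, eff_assign, eff_ite, eff_incr,
        val_const, val_mem, val_cell, val_tapeExpr, val_listExpr, val_sub, hu]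
      have e1 : Function.update m 19 (x i : ℕ) 17 = m 17 := by simp
      have e2 : Function.update m 19 (x i : ℕ) 16 = m 16 := by simp
      simp only [e1, e2]
      rw [if_pos ht]
      simp [ne_listAddr, h.h15]
    have hal : x i ∈ alive G (stateAt G x i).1 := by
      rw [mem_alive]
      refine ⟨fun hx => ?_, fun v hv hadj => ?_⟩
      · obtain ⟨a, ha, hav⟩ := h.mem_list _ hx
        exact (h.compared a (by omega) _ hav).1 rfl
      · obtain ⟨a, ha, hav⟩ := h.mem_list _ hv
        exact (h.compared a (by omega) _ hav).2 hadj
    have hI : (stateAt G x (i + 1)).1 = insert (x i) (stateAt G x i).1 := greedyStep_of_mem G hal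
    have e17 : greedyBody.eff (adjOracle G) m 17 = m 17 + 1 := by rw [heff]; simp
    have elist : ∀ a, greedyBody.eff (adjOracle G) m (listAddr a) =
        if a = m 17 then (x i : ℕ) else m (listAddr a) := by
      intro a
      rw [heff]
      simp [Function.update_apply, listAddr_ne, listAddr_eq_iff]
    refine ⟨i + 1, ⟨hi, ?_, ?_, ?_, ?_, ?_, ?_, ?_, ?_, ?_, ?_, ?_⟩, ?_⟩
    · rw [heff]; simp [add_assoc]
    · rw [heff]; simp
    · rw [e17, hI, Finset.card_insert_of_notMem ((mem_alive G).1 hal).1, ← h.h17]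
    · rw [e17]; omega
    · rw [heff]; simp [ne_listAddr, h.h18]
    · rw [e17]
      intro a ha
      rw [elist]
      by_cases ham : a = m 17
      · exact ⟨x i, by simp [hI], by simp [ham]⟩
      · obtain ⟨v, hv, hav⟩ := h.list_mem a (by omega)
        exact ⟨v, by simp [hI, hv], by simpa [ham] using hav⟩
    · rw [e17]
      intro v hv
      simp only [elist]
      rw [hI, Finset.mem_insert] at hv
      rcases hv with rfl | hv
      · exact ⟨m 17, by omega, by simp⟩
      · obtain ⟨a, ha, hav⟩ := h.mem_list v hv
        exact ⟨a, by omega, by simp [ha.ne, hav]⟩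
    · rw [heff]; simp
    · intro a ha
      rw [← h.low a ha, heff]
      simp only [Function.update_apply]
      rw [if_neg (by omega), if_neg (by omega), if_neg (by omega),
        if_neg (ne_listAddr (by omega)), if_neg (by omega)]
    · intro j
      rw [← h.tape j, heff]
      simp [tapeAddr_ne, tapeAddr_ne_listAddr]
    · have hb : b + i + 1 ≤ Z := by omega
      rw [heff]
      exact size_update_le (size_update_le (size_update_le (size_update_le (size_update_le h.size
        (hsz _ ((x i).2.le.trans hn))) (hsz _ ((x i).2.le.trans hn))) (hsz _ (by omega)))
        (hsz _ hb)) (hsz _ (by omega))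
    · rw [heff]; simpa using hmeas 0
  · obtain ⟨v, hv, hav⟩ := h.list_mem (m 16) (by omega)
    have heff : greedyBody.eff (adjOracle G) m =
        if v = x i then
          Function.update (Function.update (Function.update (Function.update m 19 (x i)) 20 v)
            15 (b + i + 1)) 16 0
        else if G.Adj v (x i) then
          Function.update (Function.update (Function.update (Function.update (Function.update m
            19 (x i)) 20 v) 21 1) 15 (b + i + 1)) 16 0
        else Function.update (Function.update (Function.update (Function.update m
            19 (x i)) 20 v) 21 0) 16 (m 16 + 1) := by
      simp only [greedyBody, eff_block_cons, eff_block_nil, eff_assign, eff_ite, eff_incr,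
        eff_query, val_const, val_mem, val_cell, val_tapeExpr, val_listExpr, val_sub, hu,
        val_distExpr_eq_zero]
      have e1 : Function.update m 19 (x i : ℕ) 17 = m 17 := by simp
      have e2 : Function.update m 19 (x i : ℕ) 16 = m 16 := by simp
      have e3 : Function.update m 19 (x i : ℕ) (listAddr (m 16)) = v := by
        rw [Function.update_of_ne (listAddr_ne (by norm_num)), hav]
      simp only [e1, e2, e3]
      rw [if_neg ht]
      have e4 : Function.update (Function.update m 19 (x i : ℕ)) 20 (v : ℕ) 19 = x i := by simp
      have e5 : Function.update (Function.update m 19 (x i : ℕ)) 20 (v : ℕ) 20 = v := by simp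
      have e6 : Function.update (Function.update m 19 (x i : ℕ)) 20 (v : ℕ) 15 = b + i := by
        simp [h.h15]
      simp only [e4, e5, e6, adjOracle_val]
      by_cases hvx : v = x i
      · simp [hvx]
      · have : ¬ (x i : ℕ) = v := fun h => hvx (Fin.ext h.symm)
        rw [if_neg this, if_neg hvx]
        by_cases hadj : G.Adj v (x i)
        · simp [hadj, h.h15]
        · simp [hadj]
    rw [heff]
    have hbi : b + i + 1 ≤ Z := by omega
    have hv' : (v : ℕ) ≤ Z := v.2.le.trans hn
    have hx' : (x i : ℕ) ≤ Z := (x i).2.le.trans hn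
    split_ifs with hvx hadj
    · refine ⟨i + 1, hskip _ ?_ (by simp) (by simp) (by simp) (by simp) ?_ ?_ ?_ ?_, ?_⟩
      · intro hal
        exact ((mem_alive G).1 hal).1 (hvx ▸ hv)
      · intro a; simp [listAddr_ne]
      · intro a ha
        simp only [Function.update_apply]
        rw [if_neg (by omega), if_neg (by omega), if_neg (by omega), if_neg (by omega)]
      · intro a; simp [tapeAddr_ne]
      · exact size_update_le (size_update_le (size_update_le (size_update_le h.size
          (hsz _ hx')) (hsz _ hv')) (hsz _ hbi)) (hsz _ (by omega))
      · simpa using hmeas 0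
    · refine ⟨i + 1, hskip _ ?_ (by simp) (by simp) (by simp) (by simp) ?_ ?_ ?_ ?_, ?_⟩
      · intro hal
        exact ((mem_alive G).1 hal).2 v hv hadj
      · intro a; simp [listAddr_ne]
      · intro a ha
        simp only [Function.update_apply]
        rw [if_neg (by omega), if_neg (by omega), if_neg (by omega), if_neg (by omega),
          if_neg (by omega)]
      · intro a; simp [tapeAddr_ne]
      · exact size_update_le (size_update_le (size_update_le (size_update_le (size_update_le h.size
          (hsz _ hx')) (hsz _ hv')) (hsz _ h1)) (hsz _ hbi)) (hsz _ (by omega))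
      · simpa using hmeas 0
    · refine ⟨i, ⟨h.le, ?_, ?_, ?_, ?_, ?_, ?_, ?_, ?_, ?_, ?_, ?_⟩, ?_⟩
      · simp [h.h15]
      · simp; omega
      · simp [h.h17]
      · simpa using h.h17'
      · simp [h.h18]
      · simpa [Function.update_apply, listAddr_ne] using h.list_mem
      · simpa [Function.update_apply, listAddr_ne] using h.mem_list
      · intro a ha v' hv''
        simp at ha
        have hv3 : m (listAddr a) = v' := by
          simpa [Function.update_apply, listAddr_ne] using hv''
        rcases Nat.lt_or_eq_of_le ha with ha | rfl
        · exact h.compared a ha v' hv3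
        · obtain rfl : v = v' := Fin.ext (hav.symm.trans hv3)
          exact ⟨hvx, hadj⟩
      · intro a ha
        rw [← h.low a ha]
        simp only [Function.update_apply]
        rw [if_neg (by omega), if_neg (by omega), if_neg (by omega), if_neg (by omega)]
      · intro j
        rw [← h.tape j]
        simp [tapeAddr_ne]
      · exact size_update_le (size_update_le (size_update_le (size_update_le h.size
          (hsz _ hx')) (hsz _ hv')) (hsz _ (by omega))) (hsz _ (by omega))
      · simp only [Function.update_apply]
        norm_num
        have := h.h16
        rw [h.h15, h.h18]
        obtain ⟨d, rfl⟩ := Nat.exists_eq_add_of_lt hi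
        rw [show b + (i + d + 1) - (b + i) = d + 1 by omega, add_mul]
        omega

theorem greedyLoop_ends {N Z : ℕ} (hw : 1 ≤ w) (hZ : Nat.size Z ≤ w) (hL : b + L ≤ Z)
    (hK : K + 1 ≤ Z) (hn : n ≤ Z) (h1 : 1 ≤ Z) (hN : L * (K + 2) < N) (h8 : m₀ 8 = K)
    (htape : ∀ j, m₀ (tapeAddr (b + j)) = x j) {m : ℕ → ℕ}
    (h : GreedyInv G L K w b x m₀ 0 m) :
    ∃ m', greedyLoop.Ends (adjOracle G) N m
        ((L * (K + 2) + 1) * (w * greedyBody.weight + w * (1 + Expr.weight (.mul (.sub (cell 18)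
          (cell 15)) (.sub (.add (cell 8) (.const 1)) (cell 17)))))) m' ∧
      (∀ a < 15, m' a = m₀ a) ∧ (∀ j, m' (tapeAddr j) = m₀ (tapeAddr j)) ∧
      (∀ a, Nat.size (m' a) ≤ w) ∧
      ((m' 17 ≤ K ∧ m' 17 = (stateAt G x L).1.card) ∨
        (m' 17 = K + 1 ∧ K < (stateAt G x L).1.card)) := by
  obtain ⟨m', h2, ⟨⟨i, h3⟩, -⟩, h4⟩ := Prog.ends_loop (M := adjOracle G) (N := N) (p := greedyBody)
    (e := .mul (.sub (cell 18) (cell 15)) (.sub (.add (cell 8) (.const 1)) (cell 17)))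
    (c := w * greedyBody.weight) (c' := w * (1 + Expr.weight (.mul (.sub (cell 18)
          (cell 15)) (.sub (.add (cell 8) (.const 1)) (cell 17)))))
    (fun m' => (∃ i, GreedyInv G L K w b x m₀ i m') ∧
      (m' 18 - m' 15) * (K + 2) - m' 16 ≤ L * (K + 2))
    (fun m' => (m' 18 - m' 15) * (K + 2) - m' 16) (by
      rintro m₁ ⟨⟨i, hi⟩, hle⟩ he
      simp only [val_mul, val_sub, val_cell, val_add, val_const] at he
      rw [hi.h18, hi.h15, hi.low 8 (by norm_num), h8] at he
      have he1 := left_ne_zero_of_mul he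
      have he2 := right_ne_zero_of_mul he
      obtain ⟨i', h5, h6⟩ := hi.step hZ hL hK hn h1 h8 htape (by omega) (by omega)
      have h18 := h5.h18.trans hi.h18.symm
      refine ⟨_, Prog.ends_eff (adjOracle_le_one G) ?_ hw hi.size, ⟨⟨i', h5⟩, ?_⟩, ?_⟩
      · simp [greedyBody, block, Prog.IsBasic, incr]
      · rw [h18]; omega
      · rw [h18]; omega) (by
      rintro m₁ ⟨⟨i, hi⟩, -⟩
      have := Expr.cost_le hw hi.size (.mul (.sub (cell 18) (cell 15))
        (.sub (.add (cell 8) (.const 1)) (cell 17)))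
      rw [mul_add]; omega) m
    ⟨⟨0, h⟩, by rw [h.h18, h.h15, show b + L - (b + 0) = L by omega]; omega⟩
    (by rw [h.h18, h.h15, show b + L - (b + 0) = L by omega]; omega)
  refine ⟨m', h2.mono (Nat.mul_le_mul_right _ ?_), h3.low, h3.tape, h3.size, ?_⟩
  · rw [h.h18, h.h15, show b + L - (b + 0) = L by omega]; omega
  · simp only [val_mul, val_sub, val_cell, val_add, val_const, mul_eq_zero] at h4
    rw [h3.h18, h3.h15, h3.low 8 (by norm_num), h8] at h4
    have h5 := h3.h17'
    have h6 := h3.h17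
    have h7 := Finset.card_le_card (stateAt_mono G x h3.le)
    rcases h4 with h4 | h4
    · have : i = L := by have := h3.le; omega
      subst this
      omega
    · omega

end GreedyPhase

/-! ### The program: sampling on one row -/

/-- Go on with the next top-level oracle call. -/
def nextCall : Prog :=
  block [incr 15, .assign (.const 17) (.const 0), .assign (stackExpr (.const 0)) (cell 15),
    .assign (.const 18) (cell 12)]

/-- One step of the stack machine `scanStep`. Positions are stored as tape positions; cell `15`
holds the current top-level position, cell `16` the position at which to stop, cell `17` the index
of the top of the stack, cell `18` the position to scan, cell `14` the number of hits and cell `19`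
the number of steps that may still be made. -/
def scanBody : Prog :=
  block [.assign (.const 19) (.sub (cell 19) (.const 1)),
    .assign (.const 20) (.mem (tapeExpr (.mem (stackExpr (cell 17))))),
    .assign (.const 21) (.mem (tapeExpr (cell 18))),
    .ite (distExpr (cell 20) (cell 21))
      (block [.query (.const 22) (cell 20) (cell 21),
        .ite (cell 22)
          (block [incr 17, .assign (stackExpr (cell 17)) (cell 18), .assign (.const 18) (cell 12)])
          (incr 18)])
      (.ite (cell 17)
        (.ite (.sub (cell 17) (.const 1))
          (block [.assign (.const 18)
              (.add (.mem (stackExpr (.sub (cell 17) (.const 1)))) (.const 1)),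
            .assign (.const 17) (.sub (cell 17) (.const 2))])
          nextCall)
        (block [incr 14, nextCall]))]

/-- Run the stack machine until all top-level calls have been answered or the budget is used up. -/
def scanLoop : Prog :=
  .loop (.mul (cell 19) (.sub (cell 16) (cell 15))) scanBody

/-- The cells `S 0, S 1, …` hold the given stack, shifted by `b`, with its top in the last cell. -/
def StackHolds (b : ℕ) (S : ℕ → ℕ) : List ℕ → Prop
  | [] => True
  | p :: rest => S rest.length = b + p ∧ StackHolds b S rest

theorem StackHolds.congr {b : ℕ} {S S' : ℕ → ℕ} {l : List ℕ} (h : StackHolds b S l)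
    (hS : ∀ i < l.length, S' i = S i) : StackHolds b S' l := by
  induction l with
  | nil => trivial
  | cons p rest ih =>
    exact ⟨by rw [hS _ (by simp), h.1], ih h.2 fun i hi => hS i (by simp; omega)⟩

section ScanPhase

variable {n : ℕ} (W B w b : ℕ) (m₀ : ℕ → ℕ)

/-- The memory `m` holds the configuration `c` after `t` steps with budget `B`. -/
structure ScanInv (c : Cfg) (t : ℕ) (m : ℕ → ℕ) : Prop where
  h14 : m 14 = c.X
  h15 : m 15 = b + c.q
  h16 : m 16 = b + W
  h17 : m 17 + 1 = c.stack.length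
  h18 : m 18 = b + c.j
  h19 : m 19 + t = B
  stack : StackHolds b (fun i => m (stackAddr i)) c.stack
  q_le : c.q ≤ W
  stack_le : ∀ p ∈ c.stack, p ≤ W + t
  j_le : c.j ≤ W + t
  length_le : c.stack.length ≤ t + 1
  X_le : c.X ≤ t
  low : ∀ a < 14, m a = m₀ a
  tape : ∀ j, m (tapeAddr j) = m₀ (tapeAddr j)
  size : ∀ a, Nat.size (m a) ≤ w

variable {W B w b m₀} (G : SimpleGraph (Fin n)) {x : ℕ → Fin n}

theorem ScanInv.step {Z : ℕ} (hZ : Nat.size Z ≤ w) (hWB : b + W + B + 2 ≤ Z) (hn : n ≤ Z)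
    (h12 : m₀ 12 = b) (htape : ∀ j, m₀ (tapeAddr (b + j)) = x j) {c : Cfg} {t : ℕ} {m : ℕ → ℕ}
    (h : ScanInv W B w b m₀ c t m) (hq : c.q < W) (hB : 0 < m 19) :
    ScanInv W B w b m₀ (scanStep G x W c) (t + 1) (scanBody.eff (adjOracle G) m) := by
  classical
  obtain ⟨q, st, j, X⟩ := c
  rcases st with - | ⟨p, rest⟩
  · exact absurd h.h17 (by simp)
  obtain ⟨h14, h15, h16, h17, h18, h19, hst, q_le, stack_le, j_le, length_le, X_le, low, tape,
    size⟩ := h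
  simp only [List.length_cons, add_left_inj] at h14 h15 h17 h18 q_le j_le length_le X_le hq
  have hsz : ∀ z ≤ Z, Nat.size z ≤ w := fun z hz => (Nat.size_le_size hz).trans hZ
  have hS : m (stackAddr (m 17)) = b + p := by rw [h17]; exact hst.1
  have hxp : m (tapeAddr (b + p)) = x p := by rw [tape, htape]
  have hxj : m (tapeAddr (b + j)) = x j := by rw [tape, htape]
  have hp : p ≤ W + t := stack_le p (by simp)
  have hrest : ∀ p' ∈ rest, p' ≤ W + t := fun p' hp' => stack_le p' (by simp [hp'])
  have hb : m 12 = b := by rw [low 12 (by norm_num), h12]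
  have hxp' : (x p : ℕ) ≤ Z := (x p).2.le.trans hn
  have hxj' : (x j : ℕ) ≤ Z := (x j).2.le.trans hn
  -- The memory before the case distinction.
  obtain ⟨m₃, hm₃⟩ : ∃ m₃, m₃ = Function.update (Function.update (Function.update m 19 (m 19 - 1))
      20 (x p : ℕ)) 21 (x j : ℕ) := ⟨_, rfl⟩
  have heff : scanBody.eff (adjOracle G) m = (Prog.ite (distExpr (cell 20) (cell 21))
      (block [.query (.const 22) (cell 20) (cell 21),
        .ite (cell 22)
          (block [incr 17, .assign (stackExpr (cell 17)) (cell 18), .assign (.const 18) (cell 12)])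
          (incr 18)])
      (.ite (cell 17)
        (.ite (.sub (cell 17) (.const 1))
          (block [.assign (.const 18)
              (.add (.mem (stackExpr (.sub (cell 17) (.const 1)))) (.const 1)),
            .assign (.const 17) (.sub (cell 17) (.const 2))])
          nextCall)
        (block [incr 14, nextCall]))).eff (adjOracle G) m₃ := by
    rw [scanBody, eff_block_cons, eff_block_cons, eff_block_cons, eff_block_cons, eff_block_nil]
    congr 1
    rw [hm₃]
    simp only [eff_assign, val_const, val_mem, val_cell, val_tapeExpr, val_stackExpr, val_sub]
    have e1 : Function.update m 19 (m 19 - 1) 17 = m 17 := by simp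
    have e2 : Function.update m 19 (m 19 - 1) (stackAddr (m 17)) = b + p := by
      rw [Function.update_of_ne (stackAddr_ne (by norm_num)), hS]
    have e3 : Function.update m 19 (m 19 - 1) (tapeAddr (b + p)) = x p := by
      rw [Function.update_of_ne (tapeAddr_ne (by norm_num)), hxp]
    rw [e1, e2, e3]
    have e4 : Function.update (Function.update m 19 (m 19 - 1)) 20 (x p : ℕ) 18 = b + j := by
      simp [h18]
    have e5 : Function.update (Function.update m 19 (m 19 - 1)) 20 (x p : ℕ) (tapeAddr (b + j)) =
        x j := by
      rw [Function.update_of_ne (tapeAddr_ne (by norm_num)),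
        Function.update_of_ne (tapeAddr_ne (by norm_num)), hxj]
    rw [e4, e5]
  have e12 : m₃ 12 = b := by rw [hm₃]; simp [hb]
  have e14 : m₃ 14 = X := by rw [hm₃]; simp [h14]
  have e15 : m₃ 15 = b + q := by rw [hm₃]; simp [h15]
  have e16 : m₃ 16 = b + W := by rw [hm₃]; simp [h16]
  have e17 : m₃ 17 = rest.length := by rw [hm₃]; simp [h17]
  have e18 : m₃ 18 = b + j := by rw [hm₃]; simp [h18]
  have e19 : m₃ 19 + (t + 1) = B := by rw [hm₃]; simp; omega
  have e20 : m₃ 20 = x p := by rw [hm₃]; simp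
  have e21 : m₃ 21 = x j := by rw [hm₃]; simp
  have elow : ∀ a < 14, m₃ a = m₀ a := by
    intro a ha
    rw [hm₃, Function.update_of_ne (by omega), Function.update_of_ne (by omega),
      Function.update_of_ne (by omega), low a ha]
  have etape : ∀ i, m₃ (tapeAddr i) = m₀ (tapeAddr i) := by
    intro i
    rw [hm₃, ← tape]
    simp [tapeAddr_ne]
  have estack : ∀ i, m₃ (stackAddr i) = m (stackAddr i) := by
    intro i
    rw [hm₃]
    simp [stackAddr_ne]
  have esize : ∀ a, Nat.size (m₃ a) ≤ w := by
    rw [hm₃]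
    exact size_update_le (size_update_le (size_update_le size (hsz _ (by omega))) (hsz _ hxp'))
      (hsz _ hxj')
  have hst₃ : StackHolds b (fun i => m₃ (stackAddr i)) (p :: rest) :=
    hst.congr fun i _ => estack i
  clear hm₃ hst hS hxp hxj tape low size estack h14 h15 h16 h18
  -- The memory after the start of the next top-level call.
  have hnext : ∀ X' m₄, m₄ 14 = X' → X' ≤ t + 1 → m₄ 12 = b → m₄ 15 = b + q → m₄ 16 = b + W →
      m₄ 19 + (t + 1) = B → (∀ a < 14, m₄ a = m₀ a) → (∀ i, m₄ (tapeAddr i) = m₀ (tapeAddr i)) →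
      (∀ a, Nat.size (m₄ a) ≤ w) →
      ScanInv W B w b m₀ ⟨q + 1, [q + 1], 0, X'⟩ (t + 1) (nextCall.eff (adjOracle G) m₄) := by
    intro X' m₄ f14 fX f12 f15 f16 f19 flow ftape fsize
    have hn : nextCall.eff (adjOracle G) m₄ = Function.update (Function.update (Function.update
        (Function.update m₄ 15 (b + q + 1)) 17 0) (stackAddr 0) (b + q + 1)) 18 b := by
      simp only [nextCall, eff_block_cons, eff_block_nil, eff_assign, eff_incr, val_const,
        val_cell, val_stackExpr]
      simp [ne_stackAddr, f12, f15]
    rw [hn]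
    refine ⟨?_, ?_, ?_, ?_, ?_, ?_, ⟨?_, trivial⟩, hq, ?_, by simp, by simp, fX, ?_, ?_, ?_⟩
    · simp [ne_stackAddr, f14]
    · simp [ne_stackAddr, add_assoc]
    · simp [ne_stackAddr, f16]
    · simp [ne_stackAddr]
    · simp
    · simpa [ne_stackAddr] using f19
    · simp [stackAddr_ne, add_assoc]
    · simp; omega
    · intro a ha
      rw [Function.update_of_ne (by omega), Function.update_of_ne (ne_stackAddr (by omega)),
        Function.update_of_ne (by omega), Function.update_of_ne (by omega), flow a ha]
    · intro i
      rw [← ftape i]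
      simp [tapeAddr_ne, tapeAddr_ne_stackAddr]
    · exact size_update_le (size_update_le (size_update_le (size_update_le fsize
        (hsz _ (by omega))) (hsz _ (by omega))) (hsz _ (by omega))) (hsz _ (by omega))
  rw [heff, scanStep, if_pos hq]
  simp only
  by_cases hx : x p = x j
  · have hd : (distExpr (cell 20) (cell 21)).val m₃ = 0 := by
      rw [val_distExpr_eq_zero, val_cell, val_cell, e20, e21, hx]
    rw [eff_ite, if_pos hd, if_pos hx, eff_ite]
    rcases rest with - | ⟨g, rest⟩
    · rw [if_pos (by rw [val_cell, e17]; rfl), eff_block_cons, eff_block_cons, eff_block_nil,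
        eff_incr, e14]
      refine hnext (X + 1) _ (by simp) (by omega) (by simp [e12]) (by simp [e15]) (by simp [e16])
        (by simpa using e19) (fun a ha => ?_) (fun i => ?_)
        (size_update_le esize (hsz _ (by omega)))
      · rw [Function.update_of_ne (by omega), elow a ha]
      · rw [Function.update_of_ne (tapeAddr_ne (by norm_num)), etape]
    · rw [if_neg (by rw [val_cell, e17]; simp), eff_ite]
      rcases rest with - | ⟨g', rest⟩
      · rw [if_pos (by rw [val_sub, val_cell, e17]; rfl)]
        exact hnext X m₃ e14 (by omega) e12 e15 e16 e19 elow etape esize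
      · rw [if_neg (by rw [val_sub, val_cell, val_const, e17]; simp)]
        obtain ⟨-, hg, hg'⟩ := hst₃
        have hgW : g ≤ W + t := hrest g (by simp)
        simp only [List.length_cons] at e17 hg
        have hm₅ : (block [.assign (.const 18)
              (.add (.mem (stackExpr (.sub (cell 17) (.const 1)))) (.const 1)),
            .assign (.const 17) (.sub (cell 17) (.const 2))]).eff (adjOracle G) m₃ =
            Function.update (Function.update m₃ 18 (b + g + 1)) 17 rest.length := by
          simp only [eff_block_cons, eff_block_nil, eff_assign, val_const, val_cell, val_stackExpr,
            val_add, val_mem, val_sub, e17, Nat.add_sub_cancel, hg]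
          rw [Function.update_of_ne (by norm_num), e17]
          congr 1
        rw [hm₅]
        refine ⟨?_, ?_, ?_, ?_, ?_, ?_, ?_, q_le, ?_, ?_, ?_, ?_, ?_, ?_, ?_⟩
        · simp [e14, answerYes, answerNo]
        · simp [e15, answerYes, answerNo]
        · simp [e16]
        · simp [answerYes, answerNo]
        · simp [answerYes, answerNo, add_assoc]
        · simpa using e19
        · refine StackHolds.congr hg' fun i _ => ?_
          simp [stackAddr_ne]
        · intro p' hp'
          have := hrest p' (List.mem_cons_of_mem _ hp')
          omega
        · simp only [answerYes, answerNo]; omega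
        · simp only [answerYes, answerNo, List.length_cons] at length_le ⊢; omega
        · simp only [answerYes, answerNo]; omega
        · intro a ha
          rw [Function.update_of_ne (by omega), Function.update_of_ne (by omega), elow a ha]
        · intro i
          rw [← etape i]
          simp [tapeAddr_ne]
        · refine size_update_le (size_update_le esize (hsz _ (by omega))) (hsz _ ?_)
          simp only [List.length_cons] at length_le; omega
  · have hd : (distExpr (cell 20) (cell 21)).val m₃ ≠ 0 := by
      rw [Ne, val_distExpr_eq_zero, val_cell, val_cell, e20, e21]
      exact fun h => hx (Fin.ext h)
    rw [eff_ite, if_neg hd, if_neg hx, eff_block_cons, eff_block_cons, eff_block_nil, eff_query,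
      eff_ite]
    simp only [val_const, val_cell, e20, e21, adjOracle_val, Function.update_self]
    by_cases ha : G.Adj (x p) (x j)
    · rw [if_pos ha, if_pos ha, if_neg one_ne_zero]
      have hm₅ : (block [incr 17, .assign (stackExpr (cell 17)) (cell 18),
          .assign (.const 18) (cell 12)]).eff (adjOracle G) (Function.update m₃ 22 1) =
          Function.update (Function.update (Function.update (Function.update m₃ 22 1) 17
            (rest.length + 1)) (stackAddr (rest.length + 1)) (b + j)) 18 b := by
        simp only [eff_block_cons, eff_block_nil, eff_assign, eff_incr, val_const, val_cell,
          val_stackExpr]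
        simp [ne_stackAddr, e12, e17, e18]
      rw [hm₅]
      refine ⟨?_, ?_, ?_, ?_, ?_, ?_, ⟨?_, ?_⟩, q_le, ?_, ?_, ?_, ?_, ?_, ?_, ?_⟩
      · simp [ne_stackAddr, e14]
      · simp [ne_stackAddr, e15]
      · simp [ne_stackAddr, e16]
      · simp [ne_stackAddr]
      · simp
      · simpa [ne_stackAddr] using e19
      · simp [stackAddr_ne]
      · refine StackHolds.congr hst₃ fun i hi => ?_
        simp only [List.length_cons] at hi
        simp [stackAddr_ne, stackAddr_eq_iff, hi.ne]
      · intro p' hp'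
        rcases List.mem_cons.1 hp' with rfl | hp'
        · omega
        · have := stack_le p' hp'
          omega
      · exact Nat.zero_le _
      · simp only [List.length_cons]; omega
      · simp only; omega
      · intro a ha
        rw [Function.update_of_ne (by omega), Function.update_of_ne (ne_stackAddr (by omega)),
          Function.update_of_ne (by omega), Function.update_of_ne (by omega), elow a ha]
      · intro i
        rw [← etape i]
        simp [tapeAddr_ne, tapeAddr_ne_stackAddr]
      · exact size_update_le (size_update_le (size_update_le (size_update_le esize
          (hsz _ (by omega))) (hsz _ (by omega))) (hsz _ (by omega))) (hsz _ (by omega))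
    · rw [if_neg ha, if_neg ha, if_pos rfl, eff_incr]
      have h18' : Function.update m₃ 22 0 18 = b + j := by simp [e18]
      rw [h18']
      refine ⟨?_, ?_, ?_, ?_, ?_, ?_, ?_, q_le, ?_, ?_, ?_, ?_, ?_, ?_, ?_⟩
      · simp [e14]
      · simp [e15]
      · simp [e16]
      · simp [e17]
      · simp [add_assoc]
      · simpa using e19
      · refine StackHolds.congr hst₃ fun i _ => ?_
        simp [stackAddr_ne]
      · intro p' hp'
        have := stack_le p' hp'
        omega
      · simp only; omega
      · simp only [List.length_cons]; omega
      · simp only; omega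
      · intro a ha
        rw [Function.update_of_ne (by omega), Function.update_of_ne (by omega), elow a ha]
      · intro i
        rw [← etape i]
        simp [tapeAddr_ne]
      · exact size_update_le (size_update_le esize (hsz _ (by omega))) (hsz _ (by omega))

theorem scanLoop_ends {N Z : ℕ} (hw : 1 ≤ w) (hZ : Nat.size Z ≤ w) (hWB : b + W + B + 2 ≤ Z)
    (hn : n ≤ Z) (hN : B < N) (h12 : m₀ 12 = b) (htape : ∀ j, m₀ (tapeAddr (b + j)) = x j)
    {c₀ : Cfg} {m : ℕ → ℕ} (h : ScanInv W B w b m₀ c₀ 0 m) :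
    ∃ m' t, scanLoop.Ends (adjOracle G) N m
        ((B + 1) * (w * scanBody.weight +
          w * (1 + Expr.weight (.mul (cell 19) (.sub (cell 16) (cell 15)))))) m' ∧
      ScanInv W B w b m₀ ((scanStep G x W)^[t] c₀) t m' ∧
      (t = B ∨ ((scanStep G x W)^[t] c₀).q = W) := by
  have hB : m 19 = B := by have := h.h19; omega
  obtain ⟨m', h2, ⟨t, h3⟩, h4⟩ := Prog.ends_loop (M := adjOracle G) (N := N) (p := scanBody)
    (e := .mul (cell 19) (.sub (cell 16) (cell 15)))
    (c := w * scanBody.weight)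
    (c' := w * (1 + Expr.weight (.mul (cell 19) (.sub (cell 16) (cell 15)))))
    (fun m' => ∃ t, ScanInv W B w b m₀ ((scanStep G x W)^[t] c₀) t m') (fun m' => m' 19) (by
      rintro m₁ ⟨t, ht⟩ he
      simp only [val_mul, val_sub, val_cell] at he
      rw [ht.h16, ht.h15] at he
      have he1 := left_ne_zero_of_mul he
      have he2 := right_ne_zero_of_mul he
      have h5 := ht.step G hZ hWB hn h12 htape (by omega) (by omega)
      rw [← Function.iterate_succ_apply' (scanStep G x W) t c₀] at h5
      refine ⟨_, Prog.ends_eff (adjOracle_le_one G) ?_ hw ht.size, ⟨t + 1, h5⟩, ?_⟩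
      · simp [scanBody, nextCall, block, Prog.IsBasic, incr]
      · have := h5.h19
        have := ht.h19
        omega) (by
      rintro m₁ ⟨t, ht⟩
      have := Expr.cost_le hw ht.size (.mul (cell 19) (.sub (cell 16) (cell 15)))
      rw [mul_add]; omega) m ⟨0, h⟩ (by rw [hB]; exact hN)
  rw [hB] at h2
  refine ⟨m', t, h2, h3, ?_⟩
  simp only [val_mul, val_sub, val_cell, mul_eq_zero] at h4
  rw [h3.h16, h3.h15] at h4
  have h5 := h3.h19
  have h6 := h3.q_le
  omega

end ScanPhase

/-! ### The program: rounds and output -/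

/-- Prepare `greedyLoop`. -/
def greedyStart : Prog :=
  block [.assign (.const 15) (cell 12), .assign (.const 16) (.const 0),
    .assign (.const 17) (.const 0), .assign (.const 18) (.add (cell 12) (cell 4))]

/-- Record the exact size of the greedy set. -/
def recordExact : Prog := block [.assign (.const 13) (.const 1), .assign (.const 14) (cell 17)]

/-- Prepare `scanLoop`. -/
def scanStart : Prog :=
  block [.assign (.const 15) (.add (cell 12) (cell 4)),
    .assign (.const 16) (.add (cell 12) (cell 6)), .assign (.const 17) (.const 0),
    .assign (.const 18) (cell 12), .assign (.const 14) (.const 0), .assign (.const 19) (cell 9),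
    .assign (stackExpr (.const 0)) (cell 15)]

/-- Record whether `scanLoop` has answered all top-level calls. -/
def scanEnd : Prog := .ite (.sub (cell 16) (cell 15)) .skip (.assign (.const 13) (.const 2))

/-- Proceed to the next row. -/
def advance : Prog :=
  block [.assign (.const 12) (.add (cell 12) (cell 6)),
    .assign (.const 7) (.sub (cell 7) (.const 1))]

/-- Process one row of the tape: count the greedy set if it is small, and otherwise count the hits
among the samples within the budget. Cell `13` tells the outcome: `1` for an exact count and `2` for
a count of hits in cell `14`, and `0` if the budget was too small. -/
def roundBody : Prog :=
  .seq greedyStart (.seq greedyLoop (.seq (.ite (.sub (.add (cell 8) (.const 1)) (cell 17))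
    recordExact (.seq scanStart (.seq scanLoop scanEnd))) advance))

/-- Process rows until one of them succeeds. -/
def roundLoop : Prog := .loop (.mul (cell 7) (.sub (.const 1) (cell 13))) roundBody

/-- A bound for the time per step of the loops of `roundBody`, in units of the bit length of the
memory cells. -/
def roundWeight : ℕ :=
  greedyStart.weight + (greedyBody.weight + (1 + Expr.weight (.mul (.sub (cell 18)
    (cell 15)) (.sub (.add (cell 8) (.const 1)) (cell 17))))) +
    (1 + (Expr.sub (.add (cell 8) (.const 1)) (cell 17)).weight) + recordExact.weight +
    scanStart.weight + (scanBody.weight +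
      (1 + Expr.weight (.mul (cell 19) (.sub (cell 16) (cell 15))))) + scanEnd.weight +
    advance.weight + (1 + (Expr.mul (cell 7) (.sub (.const 1) (cell 13))).weight)

section Round

variable {n : ℕ} (G : SimpleGraph (Fin n)) {L s K w : ℕ} {τ : ℕ → Fin n}

theorem roundBody_ends {N Z b : ℕ} (hw : 1 ≤ w) (hZ : Nat.size Z ≤ w)
    (hb : b + (L + s) + 2 * s * n + 2 ≤ Z) (hK : K + 1 ≤ Z) (hn : n ≤ Z)
    (hN₁ : L * (K + 2) < N) (hN₂ : 2 * s * n < N) {m : ℕ → ℕ} (h : Frame n L s K w τ m)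
    (h12 : m 12 = b) (h13 : m 13 = 0) :
    ∃ m', roundBody.Ends (adjOracle G) N m
        (w * (roundWeight * (L * (K + 2) + 1 + (2 * s * n + 1)))) m' ∧
      Frame n L s K w τ m' ∧ m' 12 = b + (L + s) ∧ m' 7 = m 7 - 1 ∧
      ((m' 13 = 0 ∧ (alive G (stateAt G (fun j => τ (b + j)) L).1 = ∅ →
          2 * s * n < rowCost G L (L + s) fun j => τ (b + j))) ∨
        (m' 13 = 1 ∧ m' 14 = (stateAt G (fun j => τ (b + j)) L).1.card) ∨
        (m' 13 = 2 ∧ K < (stateAt G (fun j => τ (b + j)) L).1.card ∧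
          (alive G (stateAt G (fun j => τ (b + j)) L).1 = ∅ →
            m' 14 = hits G L (L + s) fun j => τ (b + j)))) := by
  have hsz : ∀ z ≤ Z, Nat.size z ≤ w := fun z hz => (Nat.size_le_size hz).trans hZ
  obtain ⟨x, hx⟩ : ∃ x : ℕ → Fin n, x = fun j => τ (b + j) := ⟨_, rfl⟩
  rw [← hx]
  have htape : ∀ {m : ℕ → ℕ}, Frame n L s K w τ m → ∀ j, m (tapeAddr (b + j)) = x j :=
    fun h j => by rw [h.tape, hx]
  -- The exhaustive greedy process.
  have e₁ : greedyStart.eff (adjOracle G) m = Function.update (Function.update (Function.update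
      (Function.update m 15 b) 16 0) 17 0) 18 (b + L) := by
    simp only [greedyStart, eff_block_cons, eff_block_nil, eff_assign, val_const, val_cell, val_add]
    simp [h12, h.h4]
  have hends₁ : greedyStart.Ends (adjOracle G) N m _ _ := Prog.ends_eff (adjOracle_le_one G)
    (by simp [greedyStart, block, Prog.IsBasic]) hw h.size
  rw [e₁] at hends₁
  generalize hm₁ : Function.update (Function.update (Function.update
      (Function.update m 15 b) 16 0) 17 0) 18 (b + L) = m₁ at hends₁
  have low₁ : ∀ a < 15, m₁ a = m a := fun a ha => by
    rw [← hm₁, Function.update_of_ne (by omega), Function.update_of_ne (by omega),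
      Function.update_of_ne (by omega), Function.update_of_ne (by omega)]
  have tape₁ : ∀ i, m₁ (tapeAddr i) = m (tapeAddr i) := fun i => by
    rw [← hm₁]; simp [tapeAddr_ne]
  have size₁ : ∀ a, Nat.size (m₁ a) ≤ w := by
    rw [← hm₁]
    exact size_update_le (size_update_le (size_update_le (size_update_le h.size
      (hsz _ (by omega))) (hsz _ (by omega))) (hsz _ (by omega))) (hsz _ (by omega))
  have inv₁ : GreedyInv G L K w b x m 0 m₁ := by
    rw [← hm₁] at low₁ tape₁ size₁ ⊢
    refine ⟨Nat.zero_le _, by simp, by simp, by simp [stateAt], by simp, by simp, by simp,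
      by simp [stateAt], by simp, low₁, tape₁, size₁⟩
  obtain ⟨m₂, hends₂, low₂, tape₂, size₂, hres₂⟩ := greedyLoop_ends hw hZ (by omega) hK hn
    (by omega) hN₁ h.h8 (htape h) inv₁
  have fr₂ : Frame n L s K w τ m₂ := h.of_eq (fun a ha _ => low₂ a (by omega)) tape₂ size₂
  have h12₂ : m₂ 12 = b := by rw [low₂ 12 (by norm_num), h12]
  have h13₂ : m₂ 13 = 0 := by rw [low₂ 13 (by norm_num), h13]
  have h7₂ : m₂ 7 = m 7 := low₂ 7 (by norm_num)
  -- The outcome of the row before `advance`.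
  suffices hmid : ∃ m₃, (Prog.ite (.sub (.add (cell 8) (.const 1)) (cell 17))
      recordExact (.seq scanStart (.seq scanLoop scanEnd))).Ends (adjOracle G) N m₂
        (w * ((1 + (Expr.sub (.add (cell 8) (.const 1)) (cell 17)).weight) + recordExact.weight +
          scanStart.weight + (2 * s * n + 1) * (scanBody.weight +
          (1 + Expr.weight (.mul (cell 19) (.sub (cell 16) (cell 15))))) + scanEnd.weight)) m₃ ∧
      (∀ a < 13, m₃ a = m₂ a) ∧ (∀ i, m₃ (tapeAddr i) = m₂ (tapeAddr i)) ∧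
      (∀ a, Nat.size (m₃ a) ≤ w) ∧
      ((m₃ 13 = 0 ∧ (alive G (stateAt G x L).1 = ∅ → 2 * s * n < rowCost G L (L + s) x)) ∨
        (m₃ 13 = 1 ∧ m₃ 14 = (stateAt G x L).1.card) ∨
        (m₃ 13 = 2 ∧ K < (stateAt G x L).1.card ∧
          (alive G (stateAt G x L).1 = ∅ → m₃ 14 = hits G L (L + s) x))) by
    obtain ⟨m₃, hends₃, low₃, tape₃, size₃, hres₃⟩ := hmid
    have e₄ : advance.eff (adjOracle G) m₃ =
        Function.update (Function.update m₃ 12 (b + (L + s))) 7 (m 7 - 1) := by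
      simp only [advance, eff_block_cons, eff_block_nil, eff_assign, val_const, val_cell, val_add,
        val_sub]
      simp [low₃ 12, low₃ 6, low₃ 7, h12₂, h7₂, fr₂.h6]
    have hends₄ : advance.Ends (adjOracle G) N m₃ _ _ := Prog.ends_eff (adjOracle_le_one G)
      (by simp [advance, block, Prog.IsBasic]) hw size₃
    rw [e₄] at hends₄
    refine ⟨_, (hends₁.seq (hends₂.seq (hends₃.seq hends₄))).mono ?_, ?_, ?_, ?_, ?_⟩
    · rw [← mul_add w (Prog.weight _), ← mul_assoc, mul_comm _ w, mul_assoc w, ← mul_add w,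
        ← mul_add w, ← mul_add w]
      refine Nat.mul_le_mul_left w ?_
      have hpos₁ : 1 ≤ L * (K + 2) + 1 := Nat.le_add_left _ _
      have hpos₂ : 1 ≤ 2 * s * n + 1 := Nat.le_add_left _ _
      generalize L * (K + 2) + 1 = p at *
      generalize 2 * s * n + 1 = q at *
      rw [roundWeight]
      generalize greedyStart.weight = a₁
      generalize (greedyBody.weight + (1 + Expr.weight (.mul (.sub (cell 18)
        (cell 15)) (.sub (.add (cell 8) (.const 1)) (cell 17))))) = a₂
      generalize (1 + (Expr.sub (.add (cell 8) (.const 1)) (cell 17)).weight) = a₃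
      generalize recordExact.weight = a₄
      generalize scanStart.weight = a₅
      generalize (scanBody.weight +
        (1 + Expr.weight (.mul (cell 19) (.sub (cell 16) (cell 15))))) = a₆
      generalize scanEnd.weight = a₇
      generalize advance.weight = a₈
      generalize (1 + (Expr.mul (cell 7) (.sub (.const 1) (cell 13))).weight) = a₉
      have key : ∀ y : ℕ, y ≤ y * p := fun y => Nat.le_mul_of_pos_right _ hpos₁
      have := key a₁
      have := key a₃
      have := key a₄
      have := key a₅
      have := key a₇
      have := key a₈
      simp only [mul_add, add_mul]
      rw [mul_comm p a₂, mul_comm q a₆]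
      omega
    · refine fr₂.of_eq (fun a ha ha7 => ?_) (fun i => ?_) ?_
      · rw [Function.update_of_ne ha7, Function.update_of_ne (by omega), low₃ a (by omega)]
      · rw [← tape₃]; simp [tapeAddr_ne]
      · exact size_update_le (size_update_le size₃ (hsz _ (by omega)))
          ((Nat.size_le_size (Nat.sub_le _ _)).trans (h.size 7))
    · simp
    · simp
    · simpa using hres₃
  have hcost := Expr.cost_le hw size₂ (.sub (.add (cell 8) (.const 1)) (cell 17))
  rcases hres₂ with ⟨hle, hcard⟩ | ⟨hlt, hcard⟩
  · have e₃ : recordExact.eff (adjOracle G) m₂ =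
        Function.update (Function.update m₂ 13 1) 14 (m₂ 17) := by
      simp only [recordExact, eff_block_cons, eff_block_nil, eff_assign, val_const, val_cell]
      simp
    have hends₃ : recordExact.Ends (adjOracle G) N m₂ _ _ := Prog.ends_eff (adjOracle_le_one G)
      (by simp [recordExact, block, Prog.IsBasic]) hw size₂
    rw [e₃] at hends₃
    refine ⟨_, (hends₃.ite_pos ?_).mono ?_, fun a ha => ?_, fun i => ?_, ?_, Or.inr (Or.inl ?_)⟩
    · rw [val_sub, val_add, val_cell, val_const, val_cell, fr₂.h8]; omega
    · simp only [mul_add, mul_one] at hcost ⊢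
      omega
    · rw [Function.update_of_ne (by omega), Function.update_of_ne (by omega)]
    · simp [tapeAddr_ne]
    · exact size_update_le (size_update_le size₂ (hsz _ (by omega))) (size₂ 17)
    · simp [hcard]
  · -- The greedy set is large: sample.
    have e₃ : scanStart.eff (adjOracle G) m₂ = Function.update (Function.update (Function.update
        (Function.update (Function.update (Function.update (Function.update m₂ 15 (b + L))
          16 (b + (L + s))) 17 0) 18 b) 14 0) 19 (2 * s * n)) (stackAddr 0) (b + L) := by
      simp only [scanStart, eff_block_cons, eff_block_nil, eff_assign, val_const, val_cell,
        val_add, val_stackExpr]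
      simp [h12₂, fr₂.h4, fr₂.h6, fr₂.h9]
    have hends₃ : scanStart.Ends (adjOracle G) N m₂ _ _ := Prog.ends_eff (adjOracle_le_one G)
      (by simp [scanStart, block, Prog.IsBasic]) hw size₂
    rw [e₃] at hends₃
    generalize hm₃ : Function.update (Function.update (Function.update
        (Function.update (Function.update (Function.update (Function.update m₂ 15 (b + L))
          16 (b + (L + s))) 17 0) 18 b) 14 0) 19 (2 * s * n)) (stackAddr 0) (b + L) = m₃ at hends₃
    have inv₃ : ScanInv (L + s) (2 * s * n) w b m₂ ⟨L, [L], 0, 0⟩ 0 m₃ := by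
      rw [← hm₃]
      refine ⟨?_, ?_, ?_, ?_, ?_, ?_, ⟨?_, trivial⟩, Nat.le_add_right _ _, by simp, by simp,
        by simp, by simp, fun a ha => ?_, fun i => ?_, ?_⟩
      · simp [ne_stackAddr]
      · simp [ne_stackAddr]
      · simp [ne_stackAddr]
      · simp [ne_stackAddr]
      · simp [ne_stackAddr]
      · simp [ne_stackAddr]
      · simp
      · rw [Function.update_of_ne (ne_stackAddr (by omega)), Function.update_of_ne (by omega),
          Function.update_of_ne (by omega), Function.update_of_ne (by omega),
          Function.update_of_ne (by omega), Function.update_of_ne (by omega),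
          Function.update_of_ne (by omega)]
      · simp [tapeAddr_ne, tapeAddr_ne_stackAddr]
      · exact size_update_le (size_update_le (size_update_le (size_update_le (size_update_le
          (size_update_le (size_update_le size₂ (hsz _ (by omega))) (hsz _ (by omega)))
          (hsz _ (by omega))) (hsz _ (by omega))) (hsz _ (by omega))) (hsz _ (by omega)))
          (hsz _ (by omega))
    obtain ⟨m₄, t, hends₄, inv₄, hend₄⟩ := scanLoop_ends G hw hZ (by omega) hn hN₂ h12₂
      (htape fr₂) inv₃
    have hends₅ : scanEnd.Ends (adjOracle G) N m₄ _ _ := Prog.ends_eff (adjOracle_le_one G)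
      (by simp [scanEnd, Prog.IsBasic]) hw inv₄.size
    have hends := (hends₃.seq (hends₄.seq hends₅)).ite_neg (p := recordExact)
      (e := .sub (.add (cell 8) (.const 1)) (cell 17))
      (by rw [val_sub, val_add, val_cell, val_const, val_cell, fr₂.h8]; omega)
    have hends' := hends.mono (c' := w * ((1 + (Expr.sub (.add (cell 8) (.const 1))
      (cell 17)).weight) + recordExact.weight + scanStart.weight + (2 * s * n + 1) *
      (scanBody.weight + (1 + Expr.weight (.mul (cell 19) (.sub (cell 16) (cell 15))))) +
      scanEnd.weight)) (by
        rw [← mul_add w scanBody.weight, mul_left_comm _ w]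
        simp only [mul_add w, mul_one] at hcost ⊢
        omega)
    -- The relation to the configuration in which all calls have been answered.
    have hfin := scanStep_iterate_rowCost G x (Nat.le_add_right L s)
    have hcmp : ∀ t', t ≤ t' → ((scanStep G x (L + s))^[t] ⟨L, [L], 0, 0⟩).q = L + s →
        (scanStep G x (L + s))^[t'] ⟨L, [L], 0, 0⟩ =
          (scanStep G x (L + s))^[t] ⟨L, [L], 0, 0⟩ := by
      intro t' htt hq
      rw [show t' = t' - t + t by omega, Function.iterate_add_apply,
        scanStep_iterate_of_le G x hq.ge]
    have hafter : ∀ hal : alive G (stateAt G x L).1 = ∅, rowCost G L (L + s) x ≤ t →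
        (scanStep G x (L + s))^[t] ⟨L, [L], 0, 0⟩ =
          ⟨L + s, [L + s], 0, hits G L (L + s) x⟩ := by
      intro hal hle
      rw [show t = t - rowCost G L (L + s) x + rowCost G L (L + s) x by omega,
        Function.iterate_add_apply, hfin hal]
      exact scanStep_iterate_of_le G x (c := ⟨L + s, [L + s], 0, hits G L (L + s) x⟩) le_rfl _
    by_cases hq : ((scanStep G x (L + s))^[t] ⟨L, [L], 0, 0⟩).q = L + s
    · have e₅ : scanEnd.eff (adjOracle G) m₄ = Function.update m₄ 13 2 := by
        rw [scanEnd, eff_ite, if_pos, eff_assign, val_const, val_const]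
        rw [val_sub, val_cell, val_cell, inv₄.h16, inv₄.h15, hq, Nat.sub_self]
      rw [e₅] at hends'
      refine ⟨_, hends', fun a ha => ?_, fun i => ?_, ?_, Or.inr (Or.inr ⟨?_, hcard, ?_⟩)⟩
      · rw [Function.update_of_ne (by omega), inv₄.low a (by omega)]
      · rw [Function.update_of_ne (tapeAddr_ne (by norm_num)), inv₄.tape]
      · exact size_update_le inv₄.size (hsz _ (by omega))
      · simp
      · intro hal
        rw [Function.update_of_ne (by norm_num), inv₄.h14]
        rcases le_total (rowCost G L (L + s) x) t with hle | hle
        · rw [hafter hal hle]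
        · rw [← hcmp _ hle hq, hfin hal]
    · have e₅ : scanEnd.eff (adjOracle G) m₄ = m₄ := by
        have := inv₄.q_le
        rw [scanEnd, eff_ite, if_neg]
        · rfl
        · rw [val_sub, val_cell, val_cell, inv₄.h16, inv₄.h15]; omega
      rw [e₅] at hends'
      refine ⟨_, hends', fun a ha => inv₄.low a (by omega), inv₄.tape, inv₄.size, Or.inl ⟨?_, ?_⟩⟩
      · rw [inv₄.low 13 (by norm_num), h13₂]
      · intro hal
        by_contra hle
        refine hq ?_
        rw [hafter hal (by have := hend₄.resolve_right hq; omega)]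

/-- If the first `L` vertices of a row that is not misleading determine all others, then the size of
its greedy set, and the estimate of it if the set is large, approximate the size of a greedy set. -/
theorem exists_isEstimate {x : ℕ → Fin n} {E : ℕ} {ε : ℝ} (hε : 0 < ε) (hE : 1 / (E : ℝ) ≤ ε)
    (h : ¬ IsMisleading G L s K E x) {y : ℕ}
    (hy : y = (stateAt G x L).1.card ∨
      (K < (stateAt G x L).1.card ∧ y = estimate n s E (hits G L (L + s) x))) :
    ∃ π : Fin n ≃ Fin n, IsEstimate (1 + ε) 0 y (RGMIS G π).card := by
  rw [IsMisleading, not_or, Finset.not_nonempty_iff_eq_empty, not_and, not_not,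
    Fintype.card_fin] at h
  obtain ⟨π, hπ⟩ := exists_RGMIS_eq G _ (stateAt_independent G x L) h.1
  refine ⟨π, ?_⟩
  rw [hπ, IsEstimate, add_zero]
  have h0 : (0 : ℝ) ≤ (stateAt G x L).1.card := Nat.cast_nonneg _
  rcases hy with rfl | ⟨hK, rfl⟩
  · exact ⟨le_rfl, by nlinarith⟩
  · refine ⟨(h.2 hK).1, (h.2 hK).2.trans ?_⟩
    gcongr

/-- Write the result into cell `0`. -/
def outputProg (E : ℕ) : Prog :=
  .ite (.sub (cell 13) (.const 1))
    (.assign (.const 0) (.add (.div (.mul (.mul (cell 14) (cell 1)) (.const (3 * E + 1)))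
      (.mul (.const (3 * E)) (cell 5))) (.const 1)))
    (.assign (.const 0) (cell 14))

theorem roundLoop_output_ends {N Z R E : ℕ} {ε : ℝ} (hε : 0 < ε) (hE : 1 / (E : ℝ) ≤ ε)
    (hw : 1 ≤ w) (hZ : Nat.size Z ≤ w)
    (hb : R * (L + s) + 2 * s * n + 2 ≤ Z) (hK : K + 1 ≤ Z) (hn : n ≤ Z)
    (hN₁ : L * (K + 2) < N) (hN₂ : 2 * s * n < N) (hN₃ : R < N) {m : ℕ → ℕ}
    (h : Frame n L s K w τ m) (h12 : m 12 = 0) (h13 : m 13 = 0) (h7 : m 7 = R) :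
    ∃ m', (Prog.seq roundLoop (outputProg E)).Ends (adjOracle G) N m
        (w * ((R + 1) * (2 * (roundWeight * (L * (K + 2) + 1 + (2 * s * n + 1)))) +
          (outputProg E).weight)) m' ∧
      (((∀ r < R, ¬ IsMisleading G L s K E fun j => τ (r * (L + s) + j)) ∧
        ∃ r < R, rowCost G L (L + s) (fun j => τ (r * (L + s) + j)) ≤ 2 * s * n) →
        ∃ π : Fin n ≃ Fin n, IsEstimate (1 + ε) 0 (m' 0) (RGMIS G π).card) := by
  set C := w * (roundWeight * (L * (K + 2) + 1 + (2 * s * n + 1))) with hC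
  let row : ℕ → ℕ → Fin n := fun r j => τ (r * (L + s) + j)
  let Inv : (ℕ → ℕ) → Prop := fun m => Frame n L s K w τ m ∧
    ∃ r ≤ R, m 12 = r * (L + s) ∧ m 7 + r = R ∧
      ((m 13 = 0 ∧ ∀ r' < r, alive G (stateAt G (row r') L).1 = ∅ →
          2 * s * n < rowCost G L (L + s) (row r')) ∨
        (m 13 = 1 ∧ ∃ r' < R, m 14 = (stateAt G (row r') L).1.card) ∨
        (m 13 = 2 ∧ ∃ r' < R, K < (stateAt G (row r') L).1.card ∧
          (alive G (stateAt G (row r') L).1 = ∅ → m 14 = hits G L (L + s) (row r'))))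
  obtain ⟨m', hends, ⟨fr, r, hr, -, h7', hres⟩, hexit⟩ :=
    Prog.ends_loop (M := adjOracle G) (N := N) (e := .mul (cell 7) (.sub (.const 1) (cell 13)))
    (p := roundBody) (c := C) (c' := C) Inv (fun m => m 7) (by
      rintro m₁ ⟨fr, r, hr, h12, h7, hres⟩ he
      rw [val_mul, val_sub, val_const, val_cell, val_cell] at he
      have he1 := left_ne_zero_of_mul he
      have he2 := right_ne_zero_of_mul he
      have h13 : m₁ 13 = 0 := by omega
      have hrR : (r + 1) * (L + s) ≤ R * (L + s) := Nat.mul_le_mul_right _ (by omega)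
      rw [add_mul, one_mul] at hrR
      obtain ⟨m₂, h1, h2, h3, h4, h5⟩ := roundBody_ends G hw hZ (by omega) hK hn hN₁ hN₂ fr h12 h13
      refine ⟨m₂, h1, ⟨h2, r + 1, by omega, by rw [h3]; ring, by omega, ?_⟩, by omega⟩
      rcases h5 with ⟨h5, h6⟩ | ⟨h5, h6⟩ | ⟨h5, h6⟩
      · refine Or.inl ⟨h5, fun r' hr' => ?_⟩
        rcases Nat.lt_or_eq_of_le (Nat.le_of_lt_succ hr') with hr' | rfl
        · have := hres.resolve_right (by omega)
          exact this.2 r' hr'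
        · exact h6
      · exact Or.inr (Or.inl ⟨h5, r, by omega, h6⟩)
      · exact Or.inr (Or.inr ⟨h5, r, by omega, h6⟩)) (by
      rintro m₁ ⟨fr, -⟩
      have h1 := Expr.cost_le hw fr.size (.mul (cell 7) (.sub (.const 1) (cell 13)))
      have h2 : w * (1 + (Expr.mul (cell 7) (.sub (.const 1) (cell 13))).weight) ≤ C := by
        rw [hC]
        refine Nat.mul_le_mul_left w (le_trans ?_ (Nat.le_mul_of_pos_right _ (by omega)))
        rw [roundWeight]
        exact Nat.le_add_left _ _
      rw [mul_add] at h2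
      omega) m
    ⟨h, 0, Nat.zero_le _, by simpa using h12, by simpa using h7, Or.inl ⟨h13, by simp⟩⟩
    (by rw [h7]; exact hN₃)
  have hout : (outputProg E).Ends (adjOracle G) N m' _ _ := Prog.ends_eff (adjOracle_le_one G)
    (by simp [outputProg, Prog.IsBasic]) hw fr.size
  refine ⟨_, (hends.seq hout).mono ?_, ?_⟩
  · rw [h7, hC]
    apply le_of_eq
    ring
  · rintro ⟨hmis, r₀, hr₀, hcheap⟩
    have halive : ∀ r' < R, alive G (stateAt G (row r') L).1 = ∅ := fun r' hr' => by
      by_contra hne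
      exact hmis r' hr' (Or.inl (Finset.nonempty_iff_ne_empty.2 hne))
    rw [val_mul, val_sub, val_const, val_cell, val_cell, mul_eq_zero] at hexit
    rcases hres with ⟨h13', hall⟩ | ⟨h13', r', hr', h14⟩ | ⟨h13', r', hr', hlarge, h14⟩
    · -- All rounds cannot have run out of budget.
      have hrR : r = R := by omega
      exact absurd hcheap (not_le.2 (hall r₀ (by omega) (halive r₀ hr₀)))
    · have : (outputProg E).eff (adjOracle G) m' 0 = m' 14 := by
        rw [outputProg, eff_ite, if_pos (by rw [val_sub, val_cell, val_const, h13']), eff_assign,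
          val_const, Function.update_self, val_cell]
      rw [this, h14]
      exact exists_isEstimate G hε hE (hmis r' hr') (Or.inl rfl)
    · have : (outputProg E).eff (adjOracle G) m' 0 = estimate n s E (m' 14) := by
        rw [outputProg, eff_ite, if_neg (by rw [val_sub, val_cell, val_const, h13']; norm_num),
          eff_assign, val_const, Function.update_self]
        simp only [val_add, val_div, val_mul, val_cell, val_const, fr.h1, fr.h5, estimate]
      rw [this, h14 (halive r' hr')]
      exact exists_isEstimate G hε hE (hmis r' hr') (Or.inr ⟨hlarge, rfl⟩)

end Round

/-! ### The program: parameters -/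

/-- The least number whose square is at least `n`, for `n ≥ 1`. -/
def ceilSqrt (n : ℕ) : ℕ := Nat.sqrt (n - 1) + 1

/-- The number of vertices that build the greedy set in a round. The factor `2 * k + 4` makes the
probability that a given vertex stays alive at most `n ^ (-(2 * k + 4))`. -/
def greedyLength (k n : ℕ) : ℕ := n * (Nat.size n * (2 * k + 4))

/-- The number of samples in a round. As `144 = 48 * 3`, the constants here and in `threshold` make
the exponent of the Chernoff bound at least `(2 * k + 4) * Nat.size n`. -/
def sampleLength (k n : ℕ) : ℕ := ceilSqrt n * (Nat.size n * (48 * (2 * k + 4)))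

/-- The number of rounds. -/
def rounds (k n : ℕ) : ℕ := Nat.size n * (k + 1)

/-- The minimum of `n` and `ceilSqrt n * (3 * E ^ 2)`: a greedy set of at most this size is counted
exactly. The truncation keeps the bit length of the memory cells independent of `E`. -/
def threshold (E n : ℕ) : ℕ := n - (n - ceilSqrt n * (3 * E ^ 2))

/-- Store the bit length of cell `3` in cell `2`, and reset cell `3` to zero. -/
def sizeLoop : Prog :=
  .loop (cell 3) (block [.assign (.const 3) (.div (cell 3) (.const 2)), incr 2])

/-- Store `ceilSqrt` of cell `1` in cell `3`. -/
def sqrtLoop : Prog := .loop (.sub (cell 1) (.mul (cell 3) (cell 3))) (incr 3)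

/-- Compute the parameters that do not depend on the accuracy. -/
def paramBlock (k : ℕ) : Prog :=
  block [.assign (.const 4) (.mul (cell 1) (.mul (cell 2) (.const (2 * k + 4)))),
    .assign (.const 5) (.mul (cell 3) (.mul (cell 2) (.const (48 * (2 * k + 4))))),
    .assign (.const 6) (.add (cell 4) (cell 5)),
    .assign (.const 7) (.mul (cell 2) (.const (k + 1))),
    .assign (.const 9) (.mul (.mul (.const 2) (cell 5)) (cell 1)),
    .assign (.const 10) (.mul (cell 7) (cell 6))]

/-- Compute the threshold. -/
def thresholdProg (E : ℕ) : Prog :=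
  .assign (.const 8) (.sub (cell 1) (.sub (cell 1) (.mul (cell 3) (.const (3 * E ^ 2)))))

/-- Copy the number of vertices. -/
def copyBlock : Prog := block [.assign (.const 1) (cell 0), .assign (.const 3) (cell 0)]

/-- Compute all parameters. -/
def initProg (k E : ℕ) : Prog :=
  .seq copyBlock (.seq sizeLoop (.seq sqrtLoop (.seq (paramBlock k) (thresholdProg E))))

theorem size_div_two {x : ℕ} (hx : x ≠ 0) : Nat.size (x / 2) + 1 = Nat.size x := by
  conv_rhs => rw [← Nat.bit_bodd_div2 x]
  rw [Nat.size_bit (by rwa [Nat.bit_bodd_div2]), Nat.div2_val]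

theorem ceilSqrt_le {n : ℕ} (hn : 1 ≤ n) : ceilSqrt n ≤ n := by
  have := Nat.sqrt_le_self (n - 1)
  rw [ceilSqrt]; omega

theorem le_ceilSqrt_mul_self (n : ℕ) : n ≤ ceilSqrt n * ceilSqrt n := by
  have := Nat.lt_succ_sqrt (n - 1)
  rw [ceilSqrt]
  simp only [Nat.succ_eq_add_one] at this
  omega

theorem lt_ceilSqrt {n j : ℕ} (hj : j * j < n) : j < ceilSqrt n := by
  rw [ceilSqrt, Nat.lt_succ_iff, Nat.le_sqrt]
  omega

section Init

variable {M : ℕ → ℕ → ℕ} {N n w : ℕ}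

theorem sizeLoop_ends (hM : ∀ u v, M u v ≤ 1) (hw : 1 ≤ w) (hnw : Nat.size n ≤ w) (hN : n < N)
    {m : ℕ → ℕ} (h1 : m 1 = n) (h2 : m 2 = 0) (h3 : m 3 = n) (h4 : ∀ a ≥ 4, m a = 0)
    (hm : ∀ a, Nat.size (m a) ≤ w) :
    ∃ m', sizeLoop.Ends M N m ((n + 1) * (w * 100)) m' ∧ m' 1 = n ∧ m' 2 = Nat.size n ∧ m' 3 = 0 ∧
      (∀ a ≥ 4, m' a = 0) ∧ ∀ a, Nat.size (m' a) ≤ w := by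
  obtain ⟨m', hends, ⟨g1, g2, g4, gm⟩, hexit⟩ := Prog.ends_loop (M := M) (N := N) (e := cell 3)
    (p := block [.assign (.const 3) (.div (cell 3) (.const 2)), incr 2])
    (c := w * 50) (c' := w * 50)
    (fun m => m 1 = n ∧ m 2 + Nat.size (m 3) = Nat.size n ∧ (∀ a ≥ 4, m a = 0) ∧
      ∀ a, Nat.size (m a) ≤ w) (fun m => m 3) (by
      rintro m ⟨h1, h2, h4, hm⟩ he
      rw [val_cell] at he
      have hsize := size_div_two he
      have hends := Prog.ends_eff (N := N) hM
        (p := block [.assign (.const 3) (.div (cell 3) (.const 2)), incr 2])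
        (by simp [block, incr, Prog.IsBasic]) hw hm
      have e : (block [.assign (.const 3) (.div (cell 3) (.const 2)), incr 2]).eff M m =
          Function.update (Function.update m 3 (m 3 / 2)) 2 (m 2 + 1) := by
        simp only [eff_block_cons, eff_block_nil, eff_assign, eff_incr, val_const, val_cell,
          val_div]
        simp
      rw [e] at hends
      refine ⟨_, hends.mono (Nat.mul_le_mul_left w (by decide)), ⟨by simpa using h1, ?_, fun a ha =>
        ?_, ?_⟩, ?_⟩
      · simp; omega
      · rw [Function.update_of_ne (by omega), Function.update_of_ne (by omega), h4 a ha]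
      · refine size_update_le (size_update_le hm ?_) ?_
        · have := hm 3
          omega
        · exact (Nat.size_le_size (show m 2 + 1 ≤ Nat.size n by omega)).trans
            ((Nat.size_le.2 (Nat.lt_pow_self one_lt_two)).trans hnw)
      · simp; omega) (by
      rintro m ⟨-, -, -, hm⟩
      have := (cell 3).cost_le hw hm
      rw [show (cell 3).weight = 5 by decide] at this
      omega) m ⟨h1, by rw [h2, h3, zero_add], h4, hm⟩ (by rw [h3]; exact hN)
  rw [val_cell] at hexit
  refine ⟨m', hends.mono (by rw [h3]; exact Nat.mul_le_mul_left _ (by omega)), g1, ?_, hexit, g4,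
    gm⟩
  simpa [hexit] using g2

theorem sqrtLoop_ends (hM : ∀ u v, M u v ≤ 1) (hw : 1 ≤ w) (hnw : Nat.size n ≤ w) (hn : 1 ≤ n)
    (hN : n < N) {m : ℕ → ℕ} (h1 : m 1 = n) (h3 : m 3 = 0) (hm : ∀ a, Nat.size (m a) ≤ w) :
    ∃ m', sqrtLoop.Ends M N m ((n + 1) * (w * 100)) m' ∧ m' 3 = ceilSqrt n ∧
      (∀ a ≠ 3, m' a = m a) ∧ ∀ a, Nat.size (m' a) ≤ w := by
  have hle := ceilSqrt_le hn
  obtain ⟨m', hends, ⟨g1, g2, g3, gm⟩, hexit⟩ := Prog.ends_loop (M := M) (N := N)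
    (e := .sub (cell 1) (.mul (cell 3) (cell 3))) (p := incr 3) (c := w * 50) (c' := w * 50)
    (fun m' => m' 1 = n ∧ m' 3 ≤ ceilSqrt n ∧ (∀ a ≠ 3, m' a = m a) ∧
      ∀ a, Nat.size (m' a) ≤ w) (fun m => ceilSqrt n - m 3) (by
      rintro m ⟨h1, h2, h3, hm⟩ he
      simp only [val_sub, val_mul, val_cell] at he
      have hlt : m 3 < ceilSqrt n := lt_ceilSqrt (by omega)
      have hends := Prog.ends_eff (N := N) hM (p := incr 3) (by simp [incr, Prog.IsBasic]) hw hm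
      rw [eff_incr] at hends
      refine ⟨_, hends.mono (Nat.mul_le_mul_left w (by decide)), ⟨by simpa using h1, ?_, fun a ha =>
        ?_, ?_⟩, ?_⟩
      · simp; omega
      · rw [Function.update_of_ne ha, h3 a ha]
      · exact size_update_le hm ((Nat.size_le_size (by omega)).trans hnw)
      · simp; omega) (by
      rintro m ⟨-, -, -, hm⟩
      have := (Expr.sub (cell 1) (.mul (cell 3) (cell 3))).cost_le hw hm
      rw [show (Expr.sub (cell 1) (.mul (cell 3) (cell 3))).weight = 19 by decide] at this
      omega) m ⟨h1, by rw [h3]; exact Nat.zero_le _, fun _ _ => rfl, hm⟩ (by omega)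
  refine ⟨m', hends.mono (Nat.mul_le_mul (by omega) (by omega)), ?_, g3, gm⟩
  simp only [val_sub, val_mul, val_cell] at hexit
  refine le_antisymm g2 ?_
  rw [ceilSqrt, Nat.succ_le_iff, Nat.sqrt_lt]
  omega

/-- The memory after the computation of the parameters. Here `w` bounds the bit length of all
parameters. -/
theorem initProg_ends (hM : ∀ u v, M u v ≤ 1) {k E Z : ℕ} (hw : 1 ≤ w) (hZ : Nat.size Z ≤ w)
    (hb : rounds k n * (greedyLength k n + sampleLength k n) + 2 * sampleLength k n * n + n ≤ Z)
    (hn : 1 ≤ n) (hN : n < N) :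
    ∃ m', (initProg k E).Ends M N (initState n).mem
        (w * ((n + 1) * 200 + copyBlock.weight + (paramBlock k).weight + (thresholdProg E).weight))
          m' ∧
      m' 1 = n ∧ m' 4 = greedyLength k n ∧ m' 5 = sampleLength k n ∧
      m' 6 = greedyLength k n + sampleLength k n ∧ m' 7 = rounds k n ∧ m' 8 = threshold E n ∧
      m' 9 = 2 * sampleLength k n * n ∧
      m' 10 = rounds k n * (greedyLength k n + sampleLength k n) ∧
      (∀ a ≥ 11, m' a = 0) ∧ ∀ a, Nat.size (m' a) ≤ w := by
  have hsz : ∀ z ≤ Z, Nat.size z ≤ w := fun z hz => (Nat.size_le_size hz).trans hZ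
  have hnw : Nat.size n ≤ w := hsz n (by omega)
  have hR : 1 ≤ rounds k n := Nat.mul_pos (Nat.size_pos.2 hn) (Nat.succ_pos k)
  have hLs := Nat.le_mul_of_pos_left (greedyLength k n + sampleLength k n) hR
  have hRL : rounds k n ≤ rounds k n * (greedyLength k n + sampleLength k n) :=
    Nat.le_mul_of_pos_right _ (Nat.add_pos_left (Nat.mul_pos hn (Nat.mul_pos (Nat.size_pos.2 hn)
      (by omega))) _)
  have hm₀ : ∀ a, Nat.size ((initState n).mem a) ≤ w :=
    size_update_le (m := fun _ => 0) (by simp) hnw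
  have hends₁ := Prog.ends_eff (N := N) hM (p := copyBlock)
    (by simp [copyBlock, block, Prog.IsBasic]) hw hm₀
  have e₁ : copyBlock.eff M (initState n).mem =
      Function.update (Function.update (initState n).mem 1 n) 3 n := by
    simp only [copyBlock, eff_block_cons, eff_block_nil, eff_assign, val_const, val_cell]
    simp [initState]
  rw [e₁] at hends₁
  obtain ⟨m₂, hends₂, a1, a2, a3, a4, am⟩ := sizeLoop_ends (M := M) (N := N) hM hw hnw hN
    (m := Function.update (Function.update (initState n).mem 1 n) 3 n)
    (by simp) (by simp [initState]) (by simp) (fun a ha => by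
      rw [Function.update_of_ne (by omega), Function.update_of_ne (by omega)]
      exact Function.update_of_ne (show a ≠ 0 by omega) n fun _ => 0)
    (size_update_le (size_update_le hm₀ hnw) hnw)
  obtain ⟨m₃, hends₃, b3, b, bm⟩ := sqrtLoop_ends (N := N) hM hw hnw hn hN a1 a3 am
  have b1 : m₃ 1 = n := by rw [b 1 (by norm_num), a1]
  have b2 : m₃ 2 = Nat.size n := by rw [b 2 (by norm_num), a2]
  have hends₄ := Prog.ends_eff (N := N) hM (p := paramBlock k)
    (by simp [paramBlock, block, Prog.IsBasic]) hw bm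
  have e₄ : (paramBlock k).eff M m₃ = Function.update (Function.update (Function.update
      (Function.update (Function.update (Function.update m₃ 4 (greedyLength k n))
        5 (sampleLength k n)) 6 (greedyLength k n + sampleLength k n)) 7 (rounds k n))
        9 (2 * sampleLength k n * n))
        10 (rounds k n * (greedyLength k n + sampleLength k n)) := by
    simp only [paramBlock, eff_block_cons, eff_block_nil, eff_assign, val_const, val_cell, val_mul,
      val_add]
    simp [b1, b2, b3, greedyLength, sampleLength, rounds]
  rw [e₄] at hends₄
  generalize hm₄ : Function.update (Function.update (Function.update
      (Function.update (Function.update (Function.update m₃ 4 (greedyLength k n))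
        5 (sampleLength k n)) 6 (greedyLength k n + sampleLength k n)) 7 (rounds k n))
        9 (2 * sampleLength k n * n))
        10 (rounds k n * (greedyLength k n + sampleLength k n)) = m₄ at hends₄
  have dm : ∀ a, Nat.size (m₄ a) ≤ w := by
    rw [← hm₄]
    exact size_update_le (size_update_le (size_update_le (size_update_le (size_update_le
      (size_update_le bm (hsz _ (by omega))) (hsz _ (by omega))) (hsz _ (by omega)))
      (hsz _ (by omega))) (hsz _ (by omega))) (hsz _ (by omega))
  have hends₅ := Prog.ends_eff (N := N) hM (p := thresholdProg E)
    (by simp [thresholdProg, Prog.IsBasic]) hw dm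
  have e₅ : (thresholdProg E).eff M m₄ = Function.update m₄ 8 (threshold E n) := by
    simp only [thresholdProg, eff_assign, val_const, val_cell, val_mul, val_sub]
    simp [← hm₄, b1, b3, threshold]
  rw [e₅] at hends₅
  refine ⟨_, (hends₁.seq (hends₂.seq (hends₃.seq (hends₄.seq hends₅)))).mono (le_of_eq (by ring)),
    by simp [← hm₄, b1], by simp [← hm₄], by simp [← hm₄], by simp [← hm₄], by simp [← hm₄],
    by simp, by simp [← hm₄], by simp [← hm₄], fun a ha => ?_,
    size_update_le dm (hsz _ ((Nat.sub_le _ _).trans (by omega)))⟩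
  rw [← hm₄, Function.update_of_ne (by omega), Function.update_of_ne (by omega),
    Function.update_of_ne (by omega), Function.update_of_ne (by omega),
    Function.update_of_ne (by omega), Function.update_of_ne (by omega),
    Function.update_of_ne (by omega), b a (by omega), a4 a (by omega)]

end Init

/-! ### The time bound -/

theorem size_le_self (n : ℕ) : Nat.size n ≤ n := Nat.size_le.2 (Nat.lt_pow_self one_lt_two)

/-- A bound for all numbers that occur as contents of memory cells. -/
def cellBound (k n : ℕ) : ℕ :=
  rounds k n * (greedyLength k n + sampleLength k n) + 2 * sampleLength k n * n + n + 2

theorem exists_size_cellBound_le (k : ℕ) :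
    ∃ c, ∀ n, 1 ≤ n → Nat.size (cellBound k n) ≤ c * Nat.size n := by
  obtain ⟨D, hD⟩ : ∃ D, D = (k + 1) * (2 * k + 4 + 48 * (2 * k + 4)) +
    2 * (48 * (2 * k + 4)) + 3 := ⟨_, rfl⟩
  refine ⟨Nat.size D + 3, fun n hn => ?_⟩
  have hl := size_le_self n
  have hr := ceilSqrt_le hn
  have h1 : rounds k n ≤ n * (k + 1) := Nat.mul_le_mul_right _ hl
  have h2 : greedyLength k n ≤ n * (n * (2 * k + 4)) := by rw [greedyLength]; gcongr
  have h3 : sampleLength k n ≤ n * (n * (48 * (2 * k + 4))) := by rw [sampleLength]; gcongr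
  have h4 : cellBound k n ≤ n * (n * (n * D)) := by
    calc cellBound k n ≤ n * (k + 1) * (n * (n * (2 * k + 4)) + n * (n * (48 * (2 * k + 4)))) +
          2 * (n * (n * (48 * (2 * k + 4)))) * n + n * (n * (n * 1)) + n * (n * (n * 2)) := by
          rw [cellBound]
          have h5 : 1 ≤ n * n := Nat.mul_le_mul hn hn
          gcongr
          · rw [mul_one]; exact Nat.le_mul_of_pos_right _ h5
          · rw [← mul_assoc, ← mul_assoc]
            exact Nat.le_mul_of_pos_left _ (Nat.mul_pos h5 hn)
      _ = n * (n * (n * D)) := by rw [hD]; ring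
  have h5 : 1 ≤ Nat.size n := Nat.size_pos.2 hn
  calc Nat.size (cellBound k n) ≤ Nat.size (n * (n * (n * D))) := Nat.size_le_size h4
    _ ≤ Nat.size n + (Nat.size n + (Nat.size n + Nat.size D)) := (size_mul_le _ _).trans
        (Nat.add_le_add_left ((size_mul_le _ _).trans (Nat.add_le_add_left (size_mul_le _ _) _)) _)
    _ ≤ (Nat.size D + 3) * Nat.size n := by nlinarith

/-- A bound for the running time if the bit length of all memory cells is at most `w`. -/
def totalTime (k E n w : ℕ) : ℕ :=
  w * ((n + 1) * 200 + copyBlock.weight + (paramBlock k).weight + (thresholdProg E).weight) +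
    (rounds k n * (greedyLength k n + sampleLength k n) + 1) * (w * 100) +
    w * ((rounds k n + 1) * (2 * (roundWeight * (greedyLength k n * (threshold E n + 2) + 1 +
      (2 * sampleLength k n * n + 1)))) + (outputProg E).weight)

theorem weight_le {E : ℕ} (hE : 1 ≤ E) :
    (thresholdProg E).weight ≤ 100 * E ^ 2 ∧ (outputProg E).weight ≤ 500 * E ^ 2 := by
  have h1 : Nat.size (3 * E ^ 2) ≤ 3 * E ^ 2 := size_le_self _
  have h2 : Nat.size (3 * E) ≤ 3 * E := size_le_self _
  have h3 : Nat.size (3 * E + 1) ≤ 3 * E + 1 := size_le_self _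
  have h4 : E ≤ E ^ 2 := Nat.le_self_pow two_ne_zero E
  have s1 : Nat.size 1 = 1 := by decide
  have s3 : Nat.size 3 = 2 := by decide
  have s5 : Nat.size 5 = 3 := by decide
  have s8 : Nat.size 8 = 4 := by decide
  have s13 : Nat.size 13 = 4 := by decide
  have s14 : Nat.size 14 = 4 := by decide
  constructor
  · simp only [thresholdProg, Prog.weight, Expr.weight, Expr.width, cell, s1, s3, s8]
    omega
  · simp only [outputProg, Prog.weight, Expr.weight, Expr.width, cell, s1, s5, s13, s14,
      Nat.size_zero]
    omega

theorem exists_totalTime_le (k c : ℕ) :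
    ∃ A : ℕ, ∀ n E, 1 ≤ n → 1 ≤ E → totalTime k E n (c * Nat.size n) ≤
      A * (n * ceilSqrt n * E ^ 2 * Nat.size n ^ 3) := by
  obtain ⟨a, ha⟩ : ∃ a, a = 2 * k + 4 := ⟨_, rfl⟩
  refine ⟨c * (400 + copyBlock.weight + (paramBlock k).weight + 100) +
    c * (100 * ((k + 1) * (49 * a) + 1)) +
    c * ((k + 2) * (2 * (roundWeight * (5 * a + 1 + (2 * (48 * a) + 1)))) + 500),
    fun n E hn hE => ?_⟩
  have hl : 1 ≤ Nat.size n := Nat.size_pos.2 hn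
  have hr : 1 ≤ ceilSqrt n := Nat.succ_pos _
  have hrn := ceilSqrt_le hn
  have he : 1 ≤ E ^ 2 := Nat.one_le_pow _ _ hE
  obtain ⟨hw1, hw2⟩ := weight_le hE
  have hK : threshold E n + 2 ≤ 5 * (ceilSqrt n * E ^ 2) := by
    have : 1 ≤ ceilSqrt n * E ^ 2 := Nat.mul_le_mul hr he
    have : threshold E n ≤ ceilSqrt n * (3 * E ^ 2) := by rw [threshold]; omega
    nlinarith
  rw [totalTime, rounds, greedyLength, sampleLength, ← ha]
  generalize threshold E n + 2 = K at *
  generalize (thresholdProg E).weight = p₁ at *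
  generalize (outputProg E).weight = p₂ at *
  generalize copyBlock.weight = p₃ at *
  generalize (paramBlock k).weight = p₄ at *
  generalize roundWeight = p₅ at *
  generalize Nat.size n = l at *
  generalize ceilSqrt n = r at *
  generalize E ^ 2 = e at *
  conv_rhs => rw [add_mul, add_mul]
  -- Every summand is bounded by a constant times `n * r * e * l ^ 3`.
  refine Nat.add_le_add (Nat.add_le_add ?_ ?_) ?_
  · calc c * l * ((n + 1) * 200 + p₃ + p₄ + p₁)
        ≤ c * l * ((n + n) * 200 + n * p₃ + n * p₄ + n * (100 * e)) := by
          gcongr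
          · exact Nat.le_mul_of_pos_left _ hn
          · exact Nat.le_mul_of_pos_left _ hn
          · exact hw1.trans (Nat.le_mul_of_pos_left _ hn)
      _ ≤ c * l * ((n * e + n * e) * 200 + n * e * p₃ + n * e * p₄ + n * (100 * e)) := by
          have : n ≤ n * e := Nat.le_mul_of_pos_right _ he
          gcongr
      _ = c * (400 + p₃ + p₄ + 100) * (n * 1 * e * (1 * 1 * l)) := by ring
      _ ≤ c * (400 + p₃ + p₄ + 100) * (n * r * e * (l * l * l)) := by gcongr
      _ = _ := by ring
  · calc (l * (k + 1) * (n * (l * a) + r * (l * (48 * a))) + 1) * (c * l * 100)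
        ≤ (l * (k + 1) * (n * (l * a) + n * (l * (48 * a))) + n * (l * l)) * (c * l * 100) := by
          gcongr
          exact Nat.mul_le_mul hn (Nat.mul_le_mul hl hl)
      _ = c * (100 * ((k + 1) * (49 * a) + 1)) * (n * 1 * 1 * l ^ 3) := by ring
      _ ≤ _ := by gcongr
  · calc c * l * ((l * (k + 1) + 1) * (2 * (p₅ * (n * (l * a) * K + 1 +
          (2 * (r * (l * (48 * a))) * n + 1)))) + p₂)
        ≤ c * l * ((l * (k + 1) + l) * (2 * (p₅ * (n * (l * a) * (5 * (r * e)) + n * r * e * l +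
          (2 * (r * (l * (48 * a))) * (n * e) + n * r * e * l)))) + n * r * l * l * (500 * e)) := by
          have h1 : 1 ≤ n * r * e * l :=
            Nat.mul_le_mul (Nat.mul_le_mul (Nat.mul_le_mul hn hr) he) hl
          have h2 : 1 ≤ n * r * l * l :=
            Nat.mul_le_mul (Nat.mul_le_mul (Nat.mul_le_mul hn hr) hl) hl
          gcongr
          · exact Nat.le_mul_of_pos_right _ he
          · exact hw2.trans (Nat.le_mul_of_pos_left _ h2)
      _ = _ := by ring

theorem size_le_log {n : ℕ} (hn : 1 ≤ n) : (Nat.size n : ℝ) ≤ 2 * (1 + Real.log n) := by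
  have h1 : 2 ^ (Nat.size n - 1) ≤ n := by
    by_contra h
    have := Nat.size_le.2 (not_le.1 h)
    have := Nat.size_pos.2 hn
    omega
  have h2 : ((2 : ℝ) ^ (Nat.size n - 1)) ≤ n := by exact_mod_cast h1
  have h3 := Real.log_le_log (by positivity) h2
  rw [Real.log_pow, Nat.cast_sub (Nat.size_pos.2 hn), Nat.cast_one] at h3
  have h4 := Real.log_two_gt_d9
  have h5 : (1 : ℝ) ≤ Nat.size n := by exact_mod_cast Nat.size_pos.2 hn
  nlinarith

theorem ceilSqrt_le_sqrt {n : ℕ} (hn : 1 ≤ n) : (ceilSqrt n : ℝ) ≤ 2 * √n := by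
  have h1 : (1 : ℝ) ≤ √n := Real.one_le_sqrt.2 (by exact_mod_cast hn)
  have h2 : (Nat.sqrt (n - 1) : ℝ) ≤ √n :=
    (Real.nat_sqrt_le_real_sqrt).trans (Real.sqrt_le_sqrt (by exact_mod_cast Nat.sub_le n 1))
  rw [ceilSqrt]
  push_cast
  linarith

theorem le_timeBound {n A : ℕ} {ε : ℝ} (hn : 1 ≤ n) (h0 : 0 < ε) (h1 : ε < 1) :
    A * (n * ceilSqrt n * ⌈1 / ε⌉₊ ^ 2 * Nat.size n ^ 3) ≤ ⌊timeBound (64 * A) 3 n ε⌋₊ := by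
  refine Nat.le_floor ?_
  have hE : (⌈1 / ε⌉₊ : ℝ) ≤ 2 / ε := by
    have := (Nat.ceil_lt_add_one (one_div_pos.2 h0).le).le
    have h2 : 1 ≤ 1 / ε := by rw [le_div_iff₀ h0]; linarith
    calc (⌈1 / ε⌉₊ : ℝ) ≤ 1 / ε + 1 / ε := by linarith
      _ = 2 / ε := by ring
  have hn0 : (0 : ℝ) < n := by exact_mod_cast hn
  have hlog : 0 ≤ Real.log n := Real.log_nonneg (by exact_mod_cast hn)
  have hpow : (n : ℝ) ^ (3 / 2 : ℝ) = n * √n := by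
    rw [show (3 / 2 : ℝ) = 1 + 1 / 2 by norm_num, Real.rpow_add hn0, Real.rpow_one,
      Real.sqrt_eq_rpow]
  push_cast
  calc (A : ℝ) * (n * ceilSqrt n * ⌈1 / ε⌉₊ ^ 2 * Nat.size n ^ 3)
      ≤ A * (n * (2 * √n) * (2 / ε) ^ 2 * (2 * (1 + Real.log n)) ^ 3) := by
        gcongr
        · exact ceilSqrt_le_sqrt hn
        · exact size_le_log hn
    _ = timeBound (64 * A) 3 n ε := by rw [timeBound, hpow]; ring

/-! ### The failure probability -/

theorem exp_neg_size_le {n : ℕ} (hn : 1 ≤ n) :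
    Real.exp (-(Nat.size n : ℝ)) ≤ (n : ℝ)⁻¹ ∧ (1 / 2 : ℝ) ^ Nat.size n ≤ (n : ℝ)⁻¹ := by
  have hn0 : (0 : ℝ) < n := by exact_mod_cast hn
  have h1 : (n : ℝ) ≤ 2 ^ Nat.size n := by exact_mod_cast (Nat.lt_size_self n).le
  have h2 : (2 : ℝ) ≤ Real.exp 1 := by have := Real.add_one_le_exp 1; linarith
  constructor
  · rw [Real.exp_neg]
    refine inv_anti₀ hn0 (h1.trans ?_)
    rw [← mul_one (Nat.size n : ℝ), Real.exp_nat_mul]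
    gcongr
  · rw [one_div, inv_pow]
    exact inv_anti₀ hn0 h1

theorem failure_le {n k E : ℕ} (hn : 2 ≤ n) (hE : 1 ≤ E) :
    rounds k n * (n * Real.exp (-(greedyLength k n / n : ℝ)) +
      2 * Real.exp (-(sampleLength k n * ((ceilSqrt n * (3 * E ^ 2) : ℕ) + 1) /
        (144 * E ^ 2 * n) : ℝ))) + (1 / 2) ^ rounds k n ≤ ((n : ℝ) ^ k)⁻¹ := by
  have hn0 : (0 : ℝ) < n := by exact_mod_cast (by omega : 0 < n)
  have hn2 : (2 : ℝ) ≤ n := by exact_mod_cast hn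
  have hE0 : (0 : ℝ) < E := by exact_mod_cast hE
  obtain ⟨hexp, hhalf⟩ := exp_neg_size_le (by omega : 1 ≤ n)
  have hpow : Real.exp (-((Nat.size n : ℝ) * (2 * k + 4 : ℕ))) ≤ ((n : ℝ)⁻¹) ^ (2 * k + 4) := by
    rw [show -((Nat.size n : ℝ) * (2 * k + 4 : ℕ)) = (2 * k + 4 : ℕ) * -(Nat.size n : ℝ) by ring,
      Real.exp_nat_mul]
    gcongr
  have h1 : Real.exp (-(greedyLength k n / n : ℝ)) ≤ ((n : ℝ)⁻¹) ^ (2 * k + 4) := by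
    refine le_trans (le_of_eq ?_) hpow
    rw [greedyLength]
    push_cast
    congr 2
    field_simp
  have h2 : Real.exp (-(sampleLength k n * ((ceilSqrt n * (3 * E ^ 2) : ℕ) + 1) /
        (144 * E ^ 2 * n) : ℝ)) ≤ ((n : ℝ)⁻¹) ^ (2 * k + 4) := by
    refine le_trans (Real.exp_le_exp.2 (neg_le_neg ?_)) hpow
    have hr : (n : ℝ) ≤ ceilSqrt n * ceilSqrt n := by exact_mod_cast le_ceilSqrt_mul_self n
    rw [le_div_iff₀ (by positivity), sampleLength]
    push_cast
    calc (Nat.size n * (2 * k + 4) * (144 * E ^ 2 * n) : ℝ)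
        ≤ (Nat.size n * (2 * k + 4) * (144 * E ^ 2 * (ceilSqrt n * ceilSqrt n)) : ℝ) := by gcongr
      _ = (ceilSqrt n * (Nat.size n * (48 * (2 * k + 4))) * (ceilSqrt n * (3 * E ^ 2)) : ℝ) := by
          ring
      _ ≤ _ := by gcongr; linarith
  have h3 : ((rounds k n : ℕ) : ℝ) ≤ (n : ℝ) ^ (k + 1) := by
    have : rounds k n ≤ n ^ (k + 1) := by
      calc rounds k n ≤ n * n ^ k := Nat.mul_le_mul (size_le_self n) (Nat.lt_pow_self (by omega))
        _ = n ^ (k + 1) := by ring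
    exact_mod_cast this
  have h4 : (1 / 2 : ℝ) ^ rounds k n ≤ ((n : ℝ)⁻¹) ^ (k + 1) := by
    rw [rounds, pow_mul]
    gcongr
  have hcancel : ∀ x : ℝ, n * x = 1 →
      (n : ℝ) ^ (k + 1) * (n * x ^ (2 * k + 4) + n * x ^ (2 * k + 4)) = 2 * x * x ^ (k + 1) := by
    intro x hx
    calc _ = 2 * (n * x) ^ (k + 2) * x ^ (k + 2) := by ring
      _ = _ := by rw [hx]; ring
  have h5 : 2 * (n : ℝ)⁻¹ ≤ 1 := by rw [← div_eq_mul_inv, div_le_one hn0]; exact hn2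
  calc _ ≤ (n : ℝ) ^ (k + 1) * (n * ((n : ℝ)⁻¹) ^ (2 * k + 4) + 2 * ((n : ℝ)⁻¹) ^ (2 * k + 4)) +
        ((n : ℝ)⁻¹) ^ (k + 1) := by gcongr
    _ ≤ (n : ℝ) ^ (k + 1) * (n * ((n : ℝ)⁻¹) ^ (2 * k + 4) + n * ((n : ℝ)⁻¹) ^ (2 * k + 4)) +
        ((n : ℝ)⁻¹) ^ (k + 1) := by gcongr
    _ = 2 * (n : ℝ)⁻¹ * ((n : ℝ)⁻¹) ^ (k + 1) + ((n : ℝ)⁻¹) ^ (k + 1) := by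
        rw [hcancel _ (mul_inv_cancel₀ hn0.ne')]
    _ ≤ 1 * ((n : ℝ)⁻¹) ^ (k + 1) + ((n : ℝ)⁻¹) ^ (k + 1) := by gcongr
    _ = 2 * (n : ℝ)⁻¹ * ((n : ℝ)⁻¹) ^ k := by ring
    _ ≤ 1 * ((n : ℝ)⁻¹) ^ k := by gcongr
    _ = _ := by rw [one_mul, inv_pow]

/-! ### The algorithm -/

theorem size_fillTape_le {n w : ℕ} (l : List (Fin n)) {m : ℕ → ℕ} {i : ℕ}
    (hm : ∀ a, Nat.size (m a) ≤ w) (hn : Nat.size n ≤ w) (hi : Nat.size (i + l.length) ≤ w)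
    (a : ℕ) :
    Nat.size (fillTape m i l a) ≤ w := by
  induction l generalizing m i with
  | nil => exact hm a
  | cons x l ih =>
    rw [List.length_cons, ← add_assoc, add_right_comm] at hi
    exact ih (size_update_le (size_update_le hm ((Nat.size_le_size x.2.le).trans hn))
      ((Nat.size_le_size (Nat.le_add_right _ _)).trans hi)) hi

/-- The randomized algorithm with failure probability `n ^ (-k)` and accuracy `1 / E`. -/
def algorithm (k E : ℕ) : Prog :=
  .seq (initProg k E) (.seq drawLoop (.seq roundLoop (outputProg E)))

/-- Only the tape is random: the run of the algorithm is a function of it. -/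
theorem algorithm_run {n k E N w : ℕ} {ε : ℝ} [NeZero n] (G : SimpleGraph (Fin n))
    (hε : 0 < ε) (hE : 1 / (E : ℝ) ≤ ε) (hw : 1 ≤ w) (hZ : Nat.size (cellBound k n) ≤ w)
    (hN : totalTime k E n w ≤ N) :
    ∃ H : List (Fin n) → State,
      (algorithm k E).run G N =
        (draw n (rounds k n * (greedyLength k n + sampleLength k n))).map (fun l => some (H l)) ∧
      ∀ l, l.length = rounds k n * (greedyLength k n + sampleLength k n) →
        (H l).time ≤ N ∧
        (IsReliable G 0 (greedyLength k n) (sampleLength k n) (threshold E n) E (rounds k n) l →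
          ∃ π : Fin n ≃ Fin n, IsEstimate (1 + ε) 0 ((H l).mem 0) (RGMIS G π).card) := by
  have hn : 1 ≤ n := NeZero.pos n
  have hsz : ∀ z ≤ cellBound k n, Nat.size z ≤ w := fun z hz => (Nat.size_le_size hz).trans hZ
  have hK : threshold E n ≤ n := Nat.sub_le _ _
  have hnN : n < N := by
    refine lt_of_lt_of_le ?_ hN
    have := Nat.le_mul_of_pos_left ((n + 1) * 200 + copyBlock.weight + (paramBlock k).weight +
      (thresholdProg E).weight) hw
    rw [totalTime]
    omega
  have hdN : rounds k n * (greedyLength k n + sampleLength k n) < N := by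
    refine lt_of_lt_of_le ?_ hN
    have := Nat.le_mul_of_pos_right (rounds k n * (greedyLength k n + sampleLength k n) + 1)
      (show 0 < w * 100 by omega)
    rw [totalTime]
    omega
  have hloop : (rounds k n + 1) * (greedyLength k n * (threshold E n + 2) + 1 +
      (2 * sampleLength k n * n + 1)) ≤ N := by
    refine le_trans ?_ hN
    have h1 : 1 ≤ 2 * roundWeight := by
      rw [roundWeight]; omega
    calc _ ≤ (2 * roundWeight) * ((rounds k n + 1) * (greedyLength k n * (threshold E n + 2) + 1 +
          (2 * sampleLength k n * n + 1))) := Nat.le_mul_of_pos_left _ h1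
      _ = (rounds k n + 1) * (2 * (roundWeight * (greedyLength k n * (threshold E n + 2) + 1 +
          (2 * sampleLength k n * n + 1)))) := by ring
      _ ≤ _ := (Nat.le_add_right _ (outputProg E).weight).trans (Nat.le_mul_of_pos_left _ hw)
      _ ≤ totalTime k E n w := Nat.le_add_left _ _
  have hloop₁ := (Nat.le_mul_of_pos_left _ (Nat.succ_pos (rounds k n))).trans hloop
  have hloop₂ := (Nat.le_mul_of_pos_right (rounds k n + 1) (Nat.succ_pos _)).trans hloop
  obtain ⟨m₁, hends₁, a1, a4, a5, a6, a7, a8, a9, a10, a11, am⟩ :=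
    initProg_ends (M := adjOracle G) (N := N) (k := k) (E := E) (adjOracle_le_one G) hw hZ
      (by rw [cellBound]; omega) hn hnN
  obtain ⟨t₁, ht₁, he₁⟩ := hends₁ 0
  obtain ⟨F, hF, hF'⟩ := exec_drawLoop (adjOracle G) N w hw hdN m₁ t₁ am a1 a10 (a11 11 le_rfl)
  have hstep : ∀ l : List (Fin n), ∃ st : State,
      l.length = rounds k n * (greedyLength k n + sampleLength k n) →
        (Prog.seq roundLoop (outputProg E)).exec (adjOracle G) N (F l) = PMF.pure (some st) ∧
        st.time ≤ N ∧
        (IsReliable G 0 (greedyLength k n) (sampleLength k n) (threshold E n) E (rounds k n) l →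
          ∃ π : Fin n ≃ Fin n, IsEstimate (1 + ε) 0 (st.mem 0) (RGMIS G π).card) := by
    intro l
    by_cases hl : l.length = rounds k n * (greedyLength k n + sampleLength k n)
    swap
    · exact ⟨F l, fun h => absurd h hl⟩
    obtain ⟨hmem, htime⟩ := hF' l hl
    have hlow : ∀ a < 30, a ≠ 11 → (F l).mem a = m₁ a := fun a ha ha' => by
      rw [hmem, fillTape_apply_of_forall_ne _ _ _ _ ha' fun j _ _ => by omega]
    -- Beyond the end of the drawn tape the cells still hold zero, the default value of `getD`.
    have htape : ∀ i, (F l).mem (tapeAddr i) = (l.getD i 0 : Fin n) := fun i => by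
      rw [hmem, tapeAddr]
      by_cases hi : i < l.length
      · have := fillTape_apply l m₁ 0 i hi
        rwa [zero_add] at this
      · rw [fillTape_apply_of_forall_ne _ _ _ _ (by omega) (by omega), a11 _ (by omega),
          List.getD_eq_default _ _ (by omega)]
        simp
    have hfr : Frame n (greedyLength k n) (sampleLength k n) (threshold E n) w
        (fun i => l.getD i 0) (F l).mem := by
      refine ⟨?_, ?_, ?_, ?_, ?_, ?_, htape, fun a => ?_⟩
      · rw [hlow 1 (by norm_num) (by norm_num), a1]
      · rw [hlow 4 (by norm_num) (by norm_num), a4]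
      · rw [hlow 5 (by norm_num) (by norm_num), a5]
      · rw [hlow 6 (by norm_num) (by norm_num), a6]
      · rw [hlow 8 (by norm_num) (by norm_num), a8]
      · rw [hlow 9 (by norm_num) (by norm_num), a9]
      · rw [hmem]
        refine size_fillTape_le l am ?_ ?_ a
        · exact hsz n (by rw [cellBound]; omega)
        · exact hsz _ (by rw [hl, cellBound]; omega)
    obtain ⟨m₂, hends₂, hout⟩ := roundLoop_output_ends G (N := N) (Z := cellBound k n)
      (R := rounds k n) (E := E) hε hE hw hZ
      (by rw [cellBound]; omega) (by rw [cellBound]; omega) (by rw [cellBound]; omega)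
      (by rw [mul_add] at hloop₁ ⊢; omega) (by omega) (by omega) hfr
      (by rw [hlow 12 (by norm_num) (by norm_num), a11 12 (by norm_num)])
      (by rw [hlow 13 (by norm_num) (by norm_num), a11 13 (by norm_num)])
      (by rw [hlow 7 (by norm_num) (by norm_num), a7])
    obtain ⟨t₂, ht₂, he₂⟩ := hends₂ (F l).time
    refine ⟨⟨m₂, t₂⟩, fun _ => ⟨he₂, ?_, fun hrel => hout ?_⟩⟩
    · refine le_trans ?_ hN
      rw [totalTime]
      simp only
      omega
    · rw [IsReliable, Fintype.card_fin] at hrel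
      exact hrel
  choose H hH using hstep
  refine ⟨H, ?_, fun l hl => (hH l hl).2⟩
  have hrun : (algorithm k E).run G N =
      (draw n (rounds k n * (greedyLength k n + sampleLength k n))).bind fun l =>
        (Prog.seq roundLoop (outputProg E)).exec (adjOracle G) N (F l) := by
    change andThen ((initProg k E).exec (adjOracle G) N ⟨(initState n).mem, 0⟩) _ = _
    rw [he₁, andThen_pure_some]
    change andThen (drawLoop.exec (adjOracle G) N ⟨m₁, t₁⟩) _ = _
    rw [hF, andThen, PMF.bind_map]
    rfl
  rw [hrun, ← PMF.bind_pure_comp]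
  ext o
  rw [PMF.bind_apply, PMF.bind_apply]
  refine tsum_congr fun l => ?_
  by_cases hl : l ∈ (draw n (rounds k n * (greedyLength k n + sampleLength k n))).support
  · rw [(hH l (length_of_mem_support_draw hl)).1]
    rfl
  · rw [(PMF.apply_eq_zero_iff _ _).2 hl, zero_mul, zero_mul]

/-- With high probability the tape is reliable. For `n ≥ 2` this is the bound for the failure
probability; truncating the threshold at `n` does not matter, as greedy sets have size at most
`n`. -/
theorem le_prob_isReliable {n k E : ℕ} [NeZero n] (G : SimpleGraph (Fin n)) (hE : 1 ≤ E) :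
    1 - ((n : ℝ) ^ k)⁻¹ ≤ prob (rounds k n * (greedyLength k n + sampleLength k n))
      (IsReliable G 0 (greedyLength k n) (sampleLength k n) (threshold E n) E (rounds k n)) := by
  have hn : 1 ≤ n := NeZero.pos n
  obtain rfl | hn2 : n = 1 ∨ 2 ≤ n := by omega
  · simpa using prob_nonneg _ _
  have hr : 1 ≤ ceilSqrt n := Nat.succ_pos _
  have hs : 0 < sampleLength k n :=
    Nat.mul_pos hr (Nat.mul_pos (Nat.size_pos.2 hn) (by omega))
  have hK : 3 * E ≤ ceilSqrt n * (3 * E ^ 2) + 1 := by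
    have h1 : E ≤ E ^ 2 := Nat.le_self_pow two_ne_zero E
    have h2 := Nat.le_mul_of_pos_left (3 * E ^ 2) hr
    omega
  have h := prob_isReliable_ge G (0 : Fin n) (L := greedyLength k n) hs hE hK (rounds k n)
  rw [Fintype.card_fin] at h
  refine le_trans (le_trans (sub_le_sub_left (failure_le hn2 hE) 1) h) (prob_mono fun l _ hl => ?_)
  refine ⟨fun r hr hmis => hl.1 r hr (hmis.imp_right fun hmis => ⟨?_, hmis.2⟩), hl.2⟩
  have h1 := hmis.1
  have h2 := Finset.card_le_univ
    (stateAt G (row 0 (greedyLength k n + sampleLength k n) l r) (greedyLength k n)).1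
  rw [Fintype.card_fin] at h2
  rw [threshold] at h1
  omega

end SublinearMIS

theorem theorem2 :
    ∃ c : ℕ, ∀ k : ℕ, ∃ C : ℝ, ∀ ε : ℝ, 0 < ε → ε < 1 →
      ∃ P : SublinearMIS.Prog, ∀ n : ℕ, 1 ≤ n → ∀ G : SimpleGraph (Fin n),
        P.RunsInTime G (SublinearMIS.timeBound C c n ε) ∧
        1 - ((n : ℝ≥0∞) ^ k)⁻¹ ≤
          P.outputProb G (SublinearMIS.timeBound C c n ε) (fun y =>
            ∃ π : Fin n ≃ Fin n,
              SublinearMIS.IsEstimate (1 + ε) 0 y (SublinearMIS.RGMIS G π).card) := by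
  refine ⟨3, fun k => ?_⟩
  obtain ⟨c, hc⟩ := SublinearMIS.exists_size_cellBound_le k
  obtain ⟨A, hA⟩ := SublinearMIS.exists_totalTime_le k c
  refine ⟨64 * A, fun ε h0 h1 => ⟨SublinearMIS.algorithm k ⌈1 / ε⌉₊, fun n hn G => ?_⟩⟩
  have : NeZero n := ⟨by omega⟩
  have hE : 1 ≤ ⌈1 / ε⌉₊ := Nat.ceil_pos.2 (by positivity)
  have hE' : 1 / (⌈1 / ε⌉₊ : ℝ) ≤ ε := by
    rw [one_div_le (by exact_mod_cast hE) h0]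
    exact Nat.le_ceil _
  have hT := (hA n _ hn hE).trans (SublinearMIS.le_timeBound hn h0 h1)
  have hT0 : 0 ≤ SublinearMIS.timeBound (64 * A) 3 n ε := by
    have := Real.log_natCast_nonneg n
    rw [SublinearMIS.timeBound]
    positivity
  generalize SublinearMIS.timeBound (64 * A) 3 n ε = T at *
  have hw : 1 ≤ c * Nat.size n := le_trans (Nat.size_pos.2 (by rw [SublinearMIS.cellBound]; omega))
    (hc n hn)
  obtain ⟨H, hH, hH'⟩ := SublinearMIS.algorithm_run G h0 hE' hw (hc n hn) hT
  have hfloor : ∀ t : ℕ, t ≤ ⌊T⌋₊ → (t : ℝ) ≤ T := fun t => (Nat.le_floor_iff hT0).1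
  constructor
  · intro o ho
    rw [hH, PMF.mem_support_map_iff] at ho
    obtain ⟨l, hl, rfl⟩ := ho
    exact ⟨H l, rfl, hfloor _ (hH' l (SublinearMIS.length_of_mem_support_draw hl)).1⟩
  · rw [SublinearMIS.Prog.outputProb, hH, PMF.toOuterMeasure_map_apply]
    calc 1 - ((n : ℝ≥0∞) ^ k)⁻¹ = ENNReal.ofReal (1 - ((n : ℝ) ^ k)⁻¹) := by
          rw [ENNReal.ofReal_sub _ (by positivity), ENNReal.ofReal_one,
            ENNReal.ofReal_inv_of_pos (by positivity), ENNReal.ofReal_pow (by positivity),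
            ENNReal.ofReal_natCast]
      _ ≤ _ := ENNReal.ofReal_le_ofReal (SublinearMIS.le_prob_isReliable G hE)
      _ = _ := (SublinearMIS.toOuterMeasure_draw _ _).symm
      _ ≤ _ := PMF.toOuterMeasure_mono _ fun l hl => by
        have := hH' l (SublinearMIS.length_of_mem_support_draw hl.2)
        exact ⟨H l, rfl, hfloor _ this.1, this.2 hl.1⟩
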